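/- Let $p$ be a prime and let $R$ be either a field $k$ of characteristic $p$, or a complete discrete valuation ring $\mathcal{O}$ of characteristic $0$ with residue field of characteristic $p$. Let $G$ and $H$ be finite groups, let $b$ be a block (primitive central idempotent) of $RG$ and $c$ a block of $RH$. The cohomological Mackey algebra $co\mu_R(G)$ is the quotient of the Mackey algebra $\mu_R(G)$, with its usual generators $t^K_L, r^K_L$ ($L\leqslant K\leqslant G$) and $c_{g,L}$ for conjugation to ${}^gL=gLg^{-1}$ ($g\in G$, $L\leqslant G$), by the relations $t^K_Lr^K_L=|K:L|\,t^K_K$. For a central element $z=\sum_{x\in G}\lambda_x x$ of $RG$ let $$\iota(z)=\sum_{L\leqslant G}\ \sum_{g\in[L\backslash G/L]}\Big(\sum_{h\in L}\lambda_{gh}\Big)\,t^L_{L\cap {}^gL}\,c_{g,L^g\cap L}\,r^L_{L^g\cap L}\in co\mu_R(G)$$ (with $L^g=g^{-1}Lg$) be its image under the canonical isomorphism $Z(RG)\to Z(co\mu_R(G))$. The Cartan matrix of an $R$-algebra that is finitely generated as an $R$-module is indexed by the isomorphism classes of finitely generated projective indecomposable modules; its entry at $(P,Q)$ is the multiplicity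 of the simple module $P/\mathrm{rad}\,P$ as a composition factor of $Q/\mathfrak{m}Q$, where $\mathfrak{m}$ is the maximal ideal of $R$ (so $\mathfrak m=0$ if $R=k$). Two algebras have the same Cartan matrix if the matrices agree after a bijection between their index sets. A $p$-permutation module is a direct summand of the permutation module of a finite set with group action. Let $X$ be an $RHc$-$RGb$-bimodule (with $R$ acting centrally) such that $X\otimes_{RGb}-:RGb\text{-}Mod\to RHc\text{-}Mod$ is an equivalence of categories. It is a splendid Morita equivalence if $X$ is a $p$-permutation $R[H\times G]$-module, for the action $(h,g)x=hxg^{-1}$. It is a permeable Morita equivalence if $X\otimes_{RGb}-$ sends $p$-permutation $RGb$-modules to $p$-permutation $RHc$-modules and $X^*\otimes_{RHc}-$, with $X^*=Hom_R(X,R)$, sends $p$-permutation $RHc$-modules to $p$-permutation $RGb$-modules. If the algebras $co\mu_R(G)\iota(b)$ and $co\mu_R(H)\iota(c)$ do not have the same Cartan matrix, then $RGb$ and $RHc$ are not splendidly Morita equivalent, and they are not permeably Morita equivalent. -/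

import Mathlib

open scoped TensorProduct Pointwise
open CategoryTheory

universe u

noncomputable section

namespace CohomologicalMackey

/-! ### Coefficient rings and blocks -/

/-- The coefficient rings `R = 𝒪` or `R = k` of a `p`-modular system `(K, 𝒪, k)`: either a field
of characteristic `p`, or a complete discrete valuation ring of characteristic zero whose residue
field has characteristic `p`. -/
def IsModularCoefficientRing (p : ℕ) (R : Type u) [CommRing R] [IsLocalRing R] : Prop :=
  (IsField R ∧ CharP R p) ∨
    ∃ _ : IsDomain R, IsDiscreteValuationRing R ∧ CharZero R ∧
      IsAdicComplete (IsLocalRing.maximalIdeal R) R ∧ CharP (IsLocalRing.ResidueField R) p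

/-- A block (idempotent) of a ring: a primitive central idempotent. -/
structure IsBlock {A : Type u} [Ring A] (b : A) : Prop where
  mem_center : b ∈ Subring.center A
  isIdempotentElem : IsIdempotentElem b
  ne_zero : b ≠ 0
  primitive : ∀ e ∈ Subring.center A, IsIdempotentElem e → e * b = e → e = 0 ∨ e = b

section BlockAlgebra

variable (R : Type u) [CommRing R] {A : Type u} [Ring A] [Algebra R A]

/-- The relation imposing `e = 1`. -/
inductive BlockRel (e : A) : A → A → Prop
  | one : BlockRel e e 1

/-- The block algebra `Ae` of a central idempotent `e` of an `R`-algebra `A`, realised as the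
quotient of `A` by the two-sided ideal generated by `1 - e`. The projection restricts to a
multiplicative bijection from `Ae` onto it which sends `e` to `1`, see
`BlockAlgebra.bijective_mk`. -/
abbrev BlockAlgebra (e : A) : Type u := RingQuot (BlockRel e)

/-- The projection `A → Ae`, `a ↦ ae`. -/
abbrev BlockAlgebra.mk (e : A) : A →ₐ[R] BlockAlgebra e := RingQuot.mkAlgHom R (BlockRel e)

theorem BlockAlgebra.mk_self (e : A) : BlockAlgebra.mk R e e = 1 := by
  rw [BlockAlgebra.mk, RingQuot.mkAlgHom_rel R (BlockRel.one (e := e)), map_one]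

theorem BlockAlgebra.bijective_mk (e : A) (hc : e ∈ Subring.center A) (he : IsIdempotentElem e) :
    Function.Bijective (fun a : {a : A // a * e = a} => BlockAlgebra.mk R e a) := by
  have hcomm : ∀ a, a * e = e * a := fun a => (Subring.mem_center_iff.1 hc a)
  constructor
  · -- left multiplication on `Ae` separates the elements of `Ae`
    let L : Submodule R A := LinearMap.range (LinearMap.mulRight R e)
    have hL : ∀ x : L, (x : A) * e = x := by
      rintro ⟨_, y, rfl⟩
      simp [mul_assoc, he.eq]
    let φ : A →ₐ[R] Module.End R L := AlgHom.ofLinearMap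
      { toFun := fun a =>
          { toFun := fun x => ⟨a * x, a * x, by
              simp [mul_assoc, hL x]⟩
            map_add' := fun x y => by ext; simp [mul_add]
            map_smul' := fun r x => by ext; simp }
        map_add' := fun a b => by ext; simp [add_mul]
        map_smul' := fun r a => by ext; simp }
      (by ext; simp) (fun a b => by ext; simp [mul_assoc])
    have hφ : ∀ ⦃x y : A⦄, BlockRel e x y → φ x = φ y := by
      rintro _ _ ⟨⟩
      ext x
      have h2 : e * (x : A) = x := by rw [← hcomm, hL]
      simpa [φ] using h2
    rintro ⟨a, ha⟩ ⟨b, hb⟩ hab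
    have h := congrArg (RingQuot.liftAlgHom R ⟨φ, hφ⟩) hab
    simp only [BlockAlgebra.mk, RingQuot.liftAlgHom_mkAlgHom_apply] at h
    have h1 := congrArg (fun f : Module.End R L => ((f ⟨e, 1, by simp⟩ : L) : A)) h
    have h2 : a * e = b * e := h1
    exact Subtype.ext (ha.symm.trans (h2.trans hb))
  · intro y
    obtain ⟨a, rfl⟩ := RingQuot.mkAlgHom_surjective R (BlockRel e) y
    refine ⟨⟨a * e, by rw [mul_assoc, he.eq]⟩, ?_⟩
    have := BlockAlgebra.mk_self R e
    simp only [map_mul]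
    rw [this, mul_one]

end BlockAlgebra

/-! ### The Mackey algebra and the cohomological Mackey algebra -/

section Mackey

variable (R : Type u) [CommRing R] (G : Type u) [Group G]

/-- `conj g H` is `ᵍH = g H g⁻¹`. -/
abbrev conj {G : Type u} [Group G] (g : G) (H : Subgroup G) : Subgroup G := MulAut.conj g • H

/-- The generators `t^K_H`, `r^K_H` (for `H ≤ K`) and `c_{g,H}` of the Mackey algebra. -/
inductive Gen : Type u
  | t (K H : Subgroup G) (h : H ≤ K)
  | r (K H : Subgroup G) (h : H ≤ K)
  | c (g : G) (H : Subgroup G)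

variable {G}

/-- The subgroup indexing the left side (the target) of a generator. -/
def Gen.left : Gen G → Subgroup G
  | t K _ _ => K
  | r _ H _ => H
  | c g H => conj g H

/-- The subgroup indexing the right side (the source) of a generator. -/
def Gen.right : Gen G → Subgroup G
  | t _ H _ => H
  | r K _ _ => K
  | c _ H => H

/-- The generator `t^K_H` in the free algebra; `fr` and `fc` below are the other generators. -/
abbrev ft (K H : Subgroup G) (h : H ≤ K) : FreeAlgebra R (Gen G) := FreeAlgebra.ι R (Gen.t K H h)
abbrev fr (K H : Subgroup G) (h : H ≤ K) : FreeAlgebra R (Gen G) := FreeAlgebra.ι R (Gen.r K H h)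
abbrev fc (g : G) (H : Subgroup G) : FreeAlgebra R (Gen G) := FreeAlgebra.ι R (Gen.c g H)

theorem conj_mono (g : G) {H K : Subgroup G} (h : H ≤ K) : conj g H ≤ conj g K :=
  Subgroup.pointwise_smul_le_pointwise_smul_iff.2 h

/-- The defining relations of the Mackey algebra. Here `L^h = h⁻¹ L h = conj h⁻¹ L`, and
`[L\H/K]` is the chosen system of representatives `Quotient.out` of the double cosets. -/
inductive MackeyRel : FreeAlgebra R (Gen G) → FreeAlgebra R (Gen G) → Prop
  | one : MackeyRel (∑ᶠ H : Subgroup G, ft R H H le_rfl) 1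
  | t_self (H : Subgroup G) : MackeyRel (ft R H H le_rfl) (fr R H H le_rfl)
  | c_self (H : Subgroup G) (h : G) (hh : h ∈ H) : MackeyRel (fc R h H) (ft R H H le_rfl)
  | t_t (H K L : Subgroup G) (h₁ : H ≤ K) (h₂ : K ≤ L) :
      MackeyRel (ft R L K h₂ * ft R K H h₁) (ft R L H (h₁.trans h₂))
  | r_r (H K L : Subgroup G) (h₁ : H ≤ K) (h₂ : K ≤ L) :
      MackeyRel (fr R K H h₁ * fr R L K h₂) (fr R L H (h₁.trans h₂))
  | c_c (H : Subgroup G) (g g' : G) :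
      MackeyRel (fc R g' (conj g H) * fc R g H) (fc R (g' * g) H)
  | t_c (H K : Subgroup G) (h : H ≤ K) (g : G) :
      MackeyRel (ft R (conj g K) (conj g H) (conj_mono g h) * fc R g H)
        (fc R g K * ft R K H h)
  | r_c (H K : Subgroup G) (h : H ≤ K) (g : G) :
      MackeyRel (fr R (conj g K) (conj g H) (conj_mono g h) * fc R g K)
        (fc R g H * fr R K H h)
  | mackey (L H K : Subgroup G) (hL : L ≤ H) (hK : K ≤ H) :
      MackeyRel (fr R H L hL * ft R H K hK)
        (∑ᶠ D : DoubleCoset.Quotient (L.subgroupOf H : Set H) (K.subgroupOf H : Set H),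
          ft R L (L ⊓ conj (D.out : G) K) inf_le_left *
            fc R (D.out : G) (conj (D.out : G)⁻¹ L ⊓ K) *
              fr R K (conj (D.out : G)⁻¹ L ⊓ K) inf_le_right)
  | zero (x y : Gen G) (h : x.right ≠ y.left) :
      MackeyRel (FreeAlgebra.ι R x * FreeAlgebra.ι R y) 0

variable (G)

/-- The Mackey algebra `μ_R(G)`. -/
abbrev MackeyAlgebra : Type u := RingQuot (MackeyRel R (G := G))

variable {G}

/-- The image of a generator in the Mackey algebra. -/
abbrev mackeyGen (x : Gen G) : MackeyAlgebra R G :=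
  RingQuot.mkAlgHom R (MackeyRel R (G := G)) (FreeAlgebra.ι R x)

/-- The cohomological relations `t^H_K r^H_K = |H : K| t^H_H`. -/
inductive CohomologicalRel : MackeyAlgebra R G → MackeyAlgebra R G → Prop
  | rel (H K : Subgroup G) (h : K ≤ H) :
      CohomologicalRel (mackeyGen R (.t H K h) * mackeyGen R (.r H K h))
        ((K.relIndex H : R) • mackeyGen R (.t H H le_rfl))

variable (G)

/-- The cohomological Mackey algebra `coμ_R(G)`, the quotient of the Mackey algebra by the
two-sided ideal generated by the elements `t^H_K r^H_K - |H : K| t^H_H`. -/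
abbrev CoMackeyAlgebra : Type u := RingQuot (CohomologicalRel R (G := G))

variable {G}

/-- The image of a generator in the cohomological Mackey algebra. -/
abbrev coGen (x : Gen G) : CoMackeyAlgebra R G :=
  RingQuot.mkAlgHom R (CohomologicalRel R (G := G)) (mackeyGen R x)

/-- The canonical isomorphism `ι : Z(RG) → Z(coμ_R(G))`, on a central element `z = ∑ λ_x x`. It is
`ι(z) = ∑_{H ≤ G} 1/|H| ∑_{x ∈ G} λ_x t^H_1 c_{1,x} r^H_1`, where the denominators are cancelled
by collecting, for each `g ∈ [H\G/H]`, the terms with `x` in the double coset `HgH`: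
`ι(z) = ∑_{H ≤ G} ∑_{g ∈ [H\G/H]} (∑_{h ∈ H} λ_{gh}) t^H_{H ∩ ᵍH} c_{g, Hᵍ ∩ H} r^H_{Hᵍ ∩ H}`. -/
def iota (z : MonoidAlgebra R G) : CoMackeyAlgebra R G :=
  ∑ᶠ H : Subgroup G, ∑ᶠ D : DoubleCoset.Quotient (H : Set G) (H : Set G),
    (∑ᶠ h : H, z.coeff (D.out * h)) •
      (coGen R (.t H (H ⊓ conj D.out H) inf_le_left) *
        coGen R (.c D.out (conj D.out⁻¹ H ⊓ H)) *
          coGen R (.r H (conj D.out⁻¹ H ⊓ H) inf_le_right))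

end Mackey

/-! ### Cartan matrices -/

section Cartan

variable (R : Type u) [CommRing R] [IsLocalRing R] (A : Type u) [Ring A]

/-- The factor `N / N'` of two submodules `N' ≤ N`. -/
abbrev Factor {M : Type u} [AddCommGroup M] [Module A M] (N N' : Submodule A M) : Type u :=
  N ⧸ N'.submoduleOf N

/-- The number of factors of a composition series which are isomorphic to `S`. -/
def factorCount {M : Type u} [AddCommGroup M] [Module A M] (S : Type u) [AddCommGroup S]
    [Module A S] (s : CompositionSeries (Submodule A M)) : ℕ :=
  Nat.card {i : Fin s.length // Nonempty (Factor A (s i.succ) (s i.castSucc) ≃ₗ[A] S)}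

/-- The multiplicity of `S` as a composition factor of a module `M` of finite length: the number
of factors isomorphic to `S` of a composition series of `M`. By the Jordan-Hölder theorem
(`multiplicity_eq`) the set below has just one element. -/
def multiplicity (M S : Type u) [AddCommGroup M] [Module A M] [AddCommGroup S] [Module A S] : ℕ :=
  sSup {n | ∃ s : CompositionSeries (Submodule A M),
    s.head = ⊥ ∧ s.last = ⊤ ∧ factorCount A S s = n}

theorem factorCount_eq {M : Type u} [AddCommGroup M] [Module A M] (S : Type u) [AddCommGroup S]
    [Module A S] (s s' : CompositionSeries (Submodule A M)) (hb : s.head = s'.head)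
    (ht : s.last = s'.last) : factorCount A S s = factorCount A S s' := by
  obtain ⟨f, hf⟩ := CompositionSeries.jordan_holder s s' hb ht
  have key : ∀ x y : Submodule A M × Submodule A M, JordanHolderLattice.Iso x y →
      Nonempty (Factor A x.2 x.1 ≃ₗ[A] Factor A y.2 y.1) := by
    intro x y h
    induction h with
    | rel x y h =>
      obtain ⟨x1, x2⟩ := x
      obtain ⟨y1, y2⟩ := y
      obtain ⟨-, h2, h3⟩ := h
      subst h2 h3
      have e := (LinearMap.quotientInfEquivSupQuotient y2 x1).symm
      rw [sup_comm] at e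
      refine ⟨e.trans (Submodule.quotEquivOfEq _ _ ?_)⟩
      ext z
      simp [Submodule.submoduleOf]
    | refl x => exact ⟨LinearEquiv.refl _ _⟩
    | symm x y _ ih => exact ih.map LinearEquiv.symm
    | trans x y z _ _ ih₁ ih₂ => exact ⟨ih₁.some.trans ih₂.some⟩
  refine Nat.card_congr (f.subtypeEquiv fun i => ?_)
  obtain ⟨e⟩ := key _ _ (hf i)
  exact ⟨fun ⟨e'⟩ => ⟨e.symm.trans e'⟩, fun ⟨e'⟩ => ⟨e.trans e'⟩⟩

theorem multiplicity_eq {M : Type u} [AddCommGroup M] [Module A M] (S : Type u) [AddCommGroup S]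
    [Module A S] (s : CompositionSeries (Submodule A M)) (hb : s.head = ⊥) (ht : s.last = ⊤) :
    multiplicity A M S = factorCount A S s := by
  have : {n | ∃ s : CompositionSeries (Submodule A M),
      s.head = ⊥ ∧ s.last = ⊤ ∧ factorCount A S s = n} = {factorCount A S s} := by
    ext n
    constructor
    · rintro ⟨s', h1, h2, rfl⟩
      exact factorCount_eq A S s' s (h1.trans hb.symm) (h2.trans ht.symm)
    · rintro rfl
      exact ⟨s, hb, ht, rfl⟩
  rw [multiplicity, this, csSup_singleton]

/-- Finitely generated projective indecomposable modules. -/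
structure IsPIM (P : Type u) [AddCommGroup P] [Module A P] : Prop where
  finite : Module.Finite A P
  projective : Module.Projective A P
  nontrivial : Nontrivial P
  indecomposable : ∀ N N' : Submodule A P, IsCompl N N' → N = ⊥ ∨ N' = ⊥

/-- The set of isomorphism classes of finitely generated projective indecomposable modules. -/
abbrev PIM : Type (u + 1) :=
  Skeleton (ObjectProperty.FullSubcategory fun P : ModuleCat.{u} A => IsPIM A P)

variable {A} in
/-- A representative of an isomorphism class. -/
abbrev PIM.rep (P : PIM A) : ModuleCat.{u} A := ((fromSkeleton _).obj P).obj

variable [Algebra R A]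

/-- The submodule `𝔪M` of an `A`-module, where `𝔪` is the maximal ideal of `R`. -/
def maximalIdealSMul (M : Type u) [AddCommGroup M] [Module A M] : Submodule A M :=
  Submodule.span A
    {x | ∃ r ∈ IsLocalRing.maximalIdeal R, ∃ m : M, algebraMap R A r • m = x}

/-- The Cartan matrix of an algebra `A` over a local ring `R`. Its rows and columns are indexed
by the isomorphism classes of projective indecomposable modules, and its entry at `(P, Q)` is the
multiplicity of the simple module `P / rad P` as a composition factor of the reduction `Q / 𝔪Q`
(which is `Q` itself if `R` is a field). -/
def cartanMatrix : Matrix (PIM A) (PIM A) ℕ := fun P Q =>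
  multiplicity A (Q.rep ⧸ maximalIdealSMul R A Q.rep) (P.rep ⧸ Module.jacobson A P.rep)

/-- Two algebras have the same Cartan matrix: the matrices agree after a bijection between their
index sets. -/
def SameCartanMatrix (B : Type u) [Ring B] [Algebra R B] : Prop :=
  ∃ σ : PIM A ≃ PIM B, ∀ P Q : PIM A, cartanMatrix R B (σ P) (σ Q) = cartanMatrix R A P Q

end Cartan

/-! ### Bimodules and tensor products -/

section Bimodule

/-- A `B`-`A`-bimodule for two `R`-algebras, on which `R` acts centrally. The right action of `A`
is given as a left action of `Aᵐᵒᵖ`. -/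
structure Bimodule (R : Type u) [CommRing R] (B A : Type u) [Ring B] [Algebra R B] [Ring A]
    [Algebra R A] where
  carrier : Type u
  [addCommGroup : AddCommGroup carrier]
  [module : Module R carrier]
  [leftModule : Module B carrier]
  [rightModule : Module Aᵐᵒᵖ carrier]
  [leftTower : IsScalarTower R B carrier]
  [rightTower : IsScalarTower R Aᵐᵒᵖ carrier]
  [comm : SMulCommClass B Aᵐᵒᵖ carrier]

attribute [instance] Bimodule.addCommGroup Bimodule.module Bimodule.leftModule
  Bimodule.rightModule Bimodule.leftTower Bimodule.rightTower Bimodule.comm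

namespace Bimodule

variable {R : Type u} [CommRing R] {A B : Type u} [Ring B] [Algebra R B] [Ring A] [Algebra R A]

instance : CoeSort (Bimodule R B A) (Type u) := ⟨carrier⟩

/-- The `R`-linear dual `X* = Hom_R(X, R)` of a `B`-`A`-bimodule, an `A`-`B`-bimodule through
`(a f b)(x) = f(b x a)`. -/
def dual (X : Bimodule R B A) : Bimodule R A B :=
  letI leftMod : Module A (X →ₗ[R] R) :=
    { smul := fun a f => f ∘ₗ Algebra.lsmul R R X (MulOpposite.op a)
      one_smul := fun f => by ext x; change f _ = _; simp
      mul_smul := fun a a' f => by ext x; change f _ = f _; simp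
      smul_zero := fun a => rfl
      zero_smul := fun f => by ext x; change f _ = _; simp
      smul_add := fun a f g => rfl
      add_smul := fun a a' f => by ext x; change f _ = f _ + f _; simp }
  letI rightMod : Module Bᵐᵒᵖ (X →ₗ[R] R) :=
    { smul := fun b f => f ∘ₗ Algebra.lsmul R R X b.unop
      one_smul := fun f => by ext x; change f _ = _; simp
      mul_smul := fun a a' f => by ext x; change f _ = f _; simp
      smul_zero := fun a => rfl
      zero_smul := fun f => by ext x; change f _ = _; simp
      smul_add := fun a f g => rfl
      add_smul := fun a a' f => by ext x; change f _ = f _ + f _; simp }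
  { carrier := X →ₗ[R] R
    leftModule := leftMod
    rightModule := rightMod
    leftTower := ⟨fun r a f => by ext x; change f _ = r • f _; simp⟩
    rightTower := ⟨fun r a f => by ext x; change f _ = r • f _; simp⟩
    comm := ⟨fun a b f => by ext x; change f _ = f _; simp [smul_comm]⟩ }

variable (X : Bimodule R B A)

/-- The `B`-submodule of `X ⊗_ℤ V` generated by the elements `xa ⊗ v - x ⊗ av`. -/
def balancing (V : Type u) [AddCommGroup V] [Module A V] : Submodule B (X ⊗[ℤ] V) :=
  Submodule.span B
    {t | ∃ (x : X) (a : A) (v : V), t = (MulOpposite.op a • x) ⊗ₜ[ℤ] v - x ⊗ₜ[ℤ] (a • v)}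

/-- The tensor product `X ⊗_A V` of a `B`-`A`-bimodule and a left `A`-module, a left
`B`-module. -/
abbrev Tensor (V : Type u) [AddCommGroup V] [Module A V] : Type u :=
  (X ⊗[ℤ] V) ⧸ X.balancing V

/-- The map `X ⊗_A f`. -/
def tensorMap {V W : Type u} [AddCommGroup V] [Module A V] [AddCommGroup W] [Module A W]
    (f : V →ₗ[A] W) : X.Tensor V →ₗ[B] X.Tensor W :=
  Submodule.mapQ _ _
    (TensorProduct.AlgebraTensorModule.map (LinearMap.id : X →ₗ[B] X) f.toAddMonoidHom.toIntLinearMap)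
    (by
      rw [balancing, Submodule.span_le]
      rintro _ ⟨x, a, v, rfl⟩
      refine Submodule.subset_span ⟨x, a, f v, ?_⟩
      simp)

/-- The functor `X ⊗_A - : A-Mod → B-Mod`. -/
def tensorFunctor : ModuleCat.{u} A ⥤ ModuleCat.{u} B where
  obj V := ModuleCat.of B (X.Tensor V)
  map f := ModuleCat.ofHom (X.tensorMap f.hom)
  map_id V := by
    refine ModuleCat.hom_ext (LinearMap.ext fun t => ?_)
    obtain ⟨t, rfl⟩ := Submodule.Quotient.mk_surjective _ t
    induction t with
    | zero => simp
    | add s t hs ht => rw [Submodule.Quotient.mk_add, map_add, hs, ht, map_add]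
    | tmul x v => rfl
  map_comp f g := by
    refine ModuleCat.hom_ext (LinearMap.ext fun t => ?_)
    obtain ⟨t, rfl⟩ := Submodule.Quotient.mk_surjective _ t
    induction t with
    | zero => simp
    | add s t hs ht => rw [Submodule.Quotient.mk_add, map_add, hs, ht, map_add]
    | tmul x v => rfl

end Bimodule

end Bimodule

/-! ### Permutation modules, splendid and permeable Morita equivalences -/

section Morita

/-- Finitely generated permutation projective (for `R = 𝒪` or `k`: `p`-permutation)
`RG`-modules, that is direct summands of `RΩ` for a finite `G`-set `Ω`. -/
def IsPPermutation (R : Type u) [CommRing R] (G : Type u) [Group G] (M : Type u) [AddCommGroup M]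
    [Module (MonoidAlgebra R G) M] : Prop :=
  ∃ (Ω : Type u) (_ : Finite Ω) (_ : MulAction G Ω)
    (i : M →ₗ[MonoidAlgebra R G] (Representation.ofMulAction R G Ω).asModule)
    (q : (Representation.ofMulAction R G Ω).asModule →ₗ[MonoidAlgebra R G] M),
    q ∘ₗ i = LinearMap.id

variable {R : Type u} [CommRing R] {G H : Type u} [Group G] [Group H]

/-- An `RGb`-module which is `p`-permutation as an `RG`-module; these are the objects of
`perm⁺_R(b)`. -/
def IsBlockPPermutation (b : MonoidAlgebra R G) (V : ModuleCat.{u} (BlockAlgebra b)) : Prop :=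
  IsPPermutation R G ((ModuleCat.restrictScalars (BlockAlgebra.mk R b).toRingHom).obj V)

/-- The block algebra element given by a group element, as a monoid homomorphism `g ↦ gb`. -/
def blockOf (b : MonoidAlgebra R G) : G →* BlockAlgebra b :=
  (BlockAlgebra.mk R b : MonoidAlgebra R G →* BlockAlgebra b).comp (MonoidAlgebra.of R G)

/-- The representation of `H × G` on an `RHc`-`RGb`-bimodule, `(h, g) x = h x g⁻¹`. -/
def bimoduleRep {c : MonoidAlgebra R H} {b : MonoidAlgebra R G}
    (X : Bimodule R (BlockAlgebra c) (BlockAlgebra b)) : Representation R (H × G) X where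
  toFun x := Algebra.lsmul R R X (blockOf c x.1) *
    Algebra.lsmul R R X (MulOpposite.op (blockOf b x.2⁻¹))
  map_one' := by simp
  map_mul' x y := by
    ext m
    simp [smul_comm]

/-- A bimodule `X` is permeable if `X ⊗_{RGb} -` maps `perm⁺_R(b)` to `perm⁺_R(c)`. -/
def IsPermeable {c : MonoidAlgebra R H} {b : MonoidAlgebra R G}
    (X : Bimodule R (BlockAlgebra c) (BlockAlgebra b)) : Prop :=
  ∀ V : ModuleCat.{u} (BlockAlgebra b),
    IsBlockPPermutation b V → IsBlockPPermutation c (X.tensorFunctor.obj V)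

/-- `RGb` and `RHc` are permeably Morita equivalent: there is an `RHc`-`RGb`-bimodule `X` such
that `X ⊗_{RGb} -` is an equivalence of categories and `X` and `X*` are permeable. -/
def PermeablyMoritaEquivalent (b : MonoidAlgebra R G) (c : MonoidAlgebra R H) : Prop :=
  ∃ X : Bimodule R (BlockAlgebra c) (BlockAlgebra b),
    X.tensorFunctor.IsEquivalence ∧ IsPermeable X ∧ IsPermeable X.dual

/-- `RGb` and `RHc` are splendidly Morita equivalent: there is an `RHc`-`RGb`-bimodule `X` such
that `X ⊗_{RGb} -` is an equivalence of categories and `X` is a `p`-permutation bimodule, that is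
a `p`-permutation module for `R[H × G]`. -/
def SplendidlyMoritaEquivalent (b : MonoidAlgebra R G) (c : MonoidAlgebra R H) : Prop :=
  ∃ X : Bimodule R (BlockAlgebra c) (BlockAlgebra b),
    X.tensorFunctor.IsEquivalence ∧ IsPPermutation R (H × G) (bimoduleRep X).asModule

end Morita

end CohomologicalMackey

end

/-! The key is Yoshida's theorem: `coμ_R(G)` is the opposite of the endomorphism algebra of `⊕_L
R[G/L]`, and under this identification `ι(b)` becomes multiplication by `b`. Hence `coμ_R(G)ι(b)` is
the opposite of `End(N_b)`, where `N_b = b·⊕_L R[G/L]`. Every `p`-permutation `RGb`-module is a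
summand of a finite direct sum of copies of `N_b`, so this algebra is determined up to Morita
equivalence by the additive category of `p`-permutation modules in the block. A permeable
equivalence must preserve that category, and therefore the Cartan matrix.

In detail, let `X` give a permeable equivalence. Then `X ⊗ N_b` is `p`-permutation, so it is a
summand of a power of `N_c` (`inAdd_blockPerm`). Conversely `X* ⊗ N_c` is a summand of a power of
`N_b`, and `N_c` is a summand of `X ⊗ X* ⊗ N_c` (`inAdd_tensor_dual`), hence of a power of `X ⊗
N_b`. Two modules that are summands of powers of each other have Morita equivalent endomorphism
algebras, through the bimodules of homomorphisms between them (`homContext`). Full faithfulness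
gives `End(X ⊗ N_b) ≅ End(N_b)`, and an `R`-linear equivalence of module categories preserves all
the ingredients of the Cartan matrix (`sameCartanMatrix_of_isEquivalence`).

A splendid equivalence is permeable: if `X` and `V` are summands of `RΩ` and `RΔ`, then `X ⊗ V` is a
summand of `R[(Ω × Δ)/G]`, and `X*` is again a `p`-permutation bimodule
(`isPermeable_of_isPPermutation`, `isPPermutation_dual`).

For Yoshida's theorem, the generators act on the disjoint union of the sets `G/L` by 0-1 matrices of
`G`-invariant relations. The elements `t^K c_g r^L`, one for each double coset `KgL`, span
`coμ_R(G)` and go to the orbit matrices of `G` on pairs of cosets (`span_coBasis`,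
`coMatrix_coBasis`). So the representation is faithful and its image consists of all `G`-invariant
matrices. -/

noncomputable section

namespace CohomologicalMackey

/-! ### Balanced tensor products over a bimodule -/

section TensorAPI

namespace Bimodule

variable {R : Type u} [CommRing R] {A B : Type u} [Ring B] [Algebra R B] [Ring A] [Algebra R A]
variable (X : Bimodule R B A) {V W : Type u} [AddCommGroup V] [Module A V] [AddCommGroup W]

/-- The pure tensor `x ⊗ v` in `X ⊗_A V`. -/
def tmul (x : X) (v : V) : X.Tensor V := Submodule.Quotient.mk (x ⊗ₜ[ℤ] v)

variable {X}

theorem tmul_add (x : X) (v w : V) : X.tmul x (v + w) = X.tmul x v + X.tmul x w := by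
  simp [tmul, TensorProduct.tmul_add]

theorem add_tmul (x y : X) (v : V) : X.tmul (x + y) v = X.tmul x v + X.tmul y v := by
  simp [tmul, TensorProduct.add_tmul]

theorem op_smul_tmul (x : X) (a : A) (v : V) :
    X.tmul (MulOpposite.op a • x) v = X.tmul x (a • v) :=
  (Submodule.Quotient.eq _).2 (Submodule.subset_span ⟨x, a, v, rfl⟩)

theorem smul_tmul (b : B) (x : X) (v : V) : b • X.tmul x v = X.tmul (b • x) v := rfl

variable (X V) in
/-- The pure tensor as a biadditive map. -/
def tmulHom : X →+ V →+ X.Tensor V :=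
  AddMonoidHom.mk' (fun x => AddMonoidHom.mk' (X.tmul x) (tmul_add x))
    (fun x y => by ext v; exact add_tmul x y v)

/-- The additive map on `X ⊗_A V` given by a balanced biadditive map. -/
def tensorLiftAdd (f : X →+ V →+ W)
    (hA : ∀ x (a : A) v, f (MulOpposite.op a • x) v = f x (a • v)) : X.Tensor V →+ W :=
  QuotientAddGroup.lift (X.balancing V).toAddSubgroup
    (TensorProduct.liftAddHom f (fun r x v => by simp)) (by
      let F : X ⊗[ℤ] V →+ W := TensorProduct.liftAddHom f (fun r x v => by simp)
      -- The balancing relations generate a `B`-submodule, whereas the map is only additive. They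
      -- are therefore shown to lie in the largest `B`-submodule inside its kernel; this works
      -- because the two actions on `X` commute.
      let K : Submodule B (X ⊗[ℤ] V) :=
        { carrier := {t | ∀ b : B, F (b • t) = 0}
          add_mem' := fun {s t} hs ht b => by rw [smul_add, map_add, hs b, ht b, add_zero]
          zero_mem' := fun b => by rw [smul_zero, map_zero]
          smul_mem' := fun b t ht b' => by rw [smul_smul]; exact ht _ }
      have hK : X.balancing V ≤ K := by
        rw [balancing, Submodule.span_le]
        rintro _ ⟨x, a, v, rfl⟩ b
        simp only [F, smul_sub, TensorProduct.smul_tmul', map_sub, TensorProduct.liftAddHom_tmul]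
        rw [smul_comm, hA, sub_self]
      intro t ht
      have := hK ht 1
      rwa [one_smul] at this)

@[simp]
theorem tensorLiftAdd_tmul (f : X →+ V →+ W)
    (hA : ∀ x (a : A) v, f (MulOpposite.op a • x) v = f x (a • v)) (x : X) (v : V) :
    tensorLiftAdd f hA (X.tmul x v) = f x v := rfl

@[simp] theorem tmulHom_apply (x : X) (v : V) : X.tmulHom V x v = X.tmul x v := rfl

theorem sum_tmul {ι : Type*} (s : Finset ι) (x : ι → X) (v : V) :
    X.tmul (∑ i ∈ s, x i) v = ∑ i ∈ s, X.tmul (x i) v := by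
  exact map_sum ((X.tmulHom V).flip v) x s

theorem tmul_sum {ι : Type*} (s : Finset ι) (x : X) (v : ι → V) :
    X.tmul x (∑ i ∈ s, v i) = ∑ i ∈ s, X.tmul x (v i) :=
  map_sum (X.tmulHom V x) v s

@[elab_as_elim]
theorem tensor_induction {motive : X.Tensor V → Prop} (t : X.Tensor V) (zero : motive 0)
    (add : ∀ s t, motive s → motive t → motive (s + t))
    (tmul : ∀ (x : X) (v : V), motive (X.tmul x v)) : motive t := by
  obtain ⟨t, rfl⟩ := Submodule.Quotient.mk_surjective _ t
  induction t with
  | zero => exact zero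
  | add s t hs ht => exact add _ _ hs ht
  | tmul x v => exact tmul x v

theorem exists_sum_tmul (t : X.Tensor V) :
    ∃ (n : ℕ) (x : Fin n → X) (v : Fin n → V), t = ∑ i, X.tmul (x i) (v i) := by
  induction t using tensor_induction with
  | zero => exact ⟨0, Fin.elim0, Fin.elim0, by simp⟩
  | tmul x v => exact ⟨1, fun _ => x, fun _ => v, by simp⟩
  | add s t hs ht =>
    obtain ⟨n, x, v, rfl⟩ := hs
    obtain ⟨m, y, w, rfl⟩ := ht
    exact ⟨n + m, Fin.append x y, Fin.append v w, by simp [Fin.sum_univ_add]⟩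

theorem tensor_addHom_ext {f g : X.Tensor V →+ W} (h : ∀ x v, f (X.tmul x v) = g (X.tmul x v)) :
    f = g := by
  ext t
  induction t using tensor_induction with
  | zero => simp
  | add s t hs ht => rw [map_add, map_add, hs, ht]
  | tmul x v => exact h x v

theorem tensor_hom_ext {S : Type*} [Semiring S] [Module S (X.Tensor V)] [Module S W]
    {f g : X.Tensor V →ₗ[S] W} (h : ∀ x v, f (X.tmul x v) = g (X.tmul x v)) : f = g :=
  LinearMap.toAddMonoidHom_injective (tensor_addHom_ext h)

@[simp]
theorem tensorMap_tmul [Module A W] (f : V →ₗ[A] W) (x : X) (v : V) :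
    X.tensorMap f (X.tmul x v) = X.tmul x (f v) := rfl

variable [Module B W]

/-- The `B`-linear map on `X ⊗_A V` given by a balanced biadditive map. -/
def tensorLift (f : X →+ V →+ W) (hB : ∀ (b : B) x v, f (b • x) v = b • f x v)
    (hA : ∀ x (a : A) v, f (MulOpposite.op a • x) v = f x (a • v)) : X.Tensor V →ₗ[B] W :=
  Submodule.liftQ _
    { toFun := TensorProduct.liftAddHom f (fun r x v => by simp)
      map_add' := map_add _
      map_smul' := fun b t => by
        induction t with
        | zero => simp
        | add s t hs ht => simp only [smul_add, map_add, hs, ht]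
        | tmul x v => simp [TensorProduct.smul_tmul', hB] }
    (by
      rw [balancing, Submodule.span_le]
      rintro _ ⟨x, a, v, rfl⟩
      simp [hA])

@[simp]
theorem tensorLift_tmul (f : X →+ V →+ W) (hB : ∀ (b : B) x v, f (b • x) v = b • f x v)
    (hA : ∀ x (a : A) v, f (MulOpposite.op a • x) v = f x (a • v)) (x : X) (v : V) :
    tensorLift f hB hA (X.tmul x v) = f x v := rfl

end Bimodule

end TensorAPI

/-! ### Permutation modules and their summands in coordinates -/

section PermutationModules

variable {R : Type u} [CommRing R] {G : Type u} [Group G]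

/-- The permutation module `RΩ`. -/
abbrev Perm (R : Type u) [CommRing R] (G : Type u) [Group G] (Ω : Type u) [MulAction G Ω] :
    Type u :=
  (Representation.ofMulAction R G Ω).asModule

namespace Perm

variable {Ω : Type u} [MulAction G Ω]

/-- The coefficient at `ω` of an element of `RΩ`. -/
def coeff (m : Perm R G Ω) (ω : Ω) : R := MonoidAlgebra.coeff (R := R) (M := Ω) m ω

theorem ext {m n : Perm R G Ω} (h : ∀ ω, coeff m ω = coeff n ω) : m = n :=
  MonoidAlgebra.coeff_injective (R := R) (M := Ω) (Finsupp.ext h)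

@[simp] theorem coeff_add (m n : Perm R G Ω) (ω : Ω) :
    coeff (m + n) ω = coeff m ω + coeff n ω := rfl

@[simp] theorem coeff_zero (ω : Ω) : coeff (0 : Perm R G Ω) ω = 0 := rfl

theorem coeff_single_smul (g : G) (r : R) (m : Perm R G Ω) (ω : Ω) :
    coeff (MonoidAlgebra.single g r • m) ω = r * coeff m (g⁻¹ • ω) := by
  rw [Representation.single_smul]
  change (r • Representation.ofMulAction R G Ω g m).coeff ω = _
  exact congrArg (r * ·) (Representation.coeff_ofMulAction g _ ω)

variable (R) in
/-- The basis element of `RΩ` attached to `ω`. -/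
def basis (ω : Ω) : Perm R G Ω := (MonoidAlgebra.single ω 1 : MonoidAlgebra R Ω)

theorem coeff_basis [DecidableEq Ω] (ω ω' : Ω) :
    coeff (basis R ω : Perm R G Ω) ω' = if ω = ω' then 1 else 0 := by
  change (Finsupp.single ω (1 : R)) ω' = _
  rw [Finsupp.single_apply]

theorem smul_basis (g : G) (ω : Ω) :
    basis R (g • ω) = MonoidAlgebra.single g (1 : R) • (basis R ω : Perm R G Ω) := by
  classical
  refine ext fun ω' => ?_
  rw [coeff_single_smul, coeff_basis, coeff_basis, one_mul]
  simp [eq_inv_smul_iff]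

/-- The coefficients of an element of `RΩ` as an additive map. -/
def coeffHom : Perm R G Ω →+ (Ω → R) where
  toFun := coeff
  map_zero' := rfl
  map_add' _ _ := rfl

theorem coeff_sum {ι : Type*} (s : Finset ι) (m : ι → Perm R G Ω) (ω : Ω) :
    coeff (∑ i ∈ s, m i) ω = ∑ i ∈ s, coeff (m i) ω := by
  change coeffHom _ ω = _
  rw [map_sum, Finset.sum_apply]
  rfl

theorem sum_coeff [Fintype Ω] (m : Perm R G Ω) :
    ∑ ω, MonoidAlgebra.single (1 : G) (coeff m ω) • (basis R ω : Perm R G Ω) = m := by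
  classical
  refine ext fun ω => ?_
  rw [coeff_sum]
  simp only [coeff_single_smul, coeff_basis]
  simp

variable {M : Type u} [AddCommGroup M] [Module (MonoidAlgebra R G) M]

/-- An additive map commuting with the multiples of group elements is `RG`-linear. -/
def linearOfSingle {M N : Type*} [AddCommGroup M] [Module (MonoidAlgebra R G) M] [AddCommGroup N]
    [Module (MonoidAlgebra R G) N] (f : M →+ N)
    (h : ∀ (g : G) (r : R) m, f (MonoidAlgebra.single g r • m) = MonoidAlgebra.single g r • f m) :
    M →ₗ[MonoidAlgebra R G] N :=
  { f with
    map_smul' := fun a m => by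
      change f (a • m) = a • f m
      induction a using MonoidAlgebra.induction_linear with
      | zero => simp
      | add a b ha hb => rw [add_smul, map_add, ha, hb, add_smul]
      | single g r => exact h g r m }

/-- The `RG`-linear map `RΩ → M` given by an equivariant map `Ω → M`. -/
def lift [Fintype Ω] (q : Ω → M)
    (hq : ∀ (g : G) ω, q (g • ω) = MonoidAlgebra.single g (1 : R) • q ω) :
    Perm R G Ω →ₗ[MonoidAlgebra R G] M :=
  linearOfSingle
    { toFun := fun m => ∑ ω, MonoidAlgebra.single (1 : G) (coeff m ω) • q ω
      map_zero' := by simp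
      map_add' := fun m n => by
        simp [MonoidAlgebra.single_add, add_smul, Finset.sum_add_distrib] }
    (fun g r m => by
      change ∑ ω, _ = _ • ∑ ω, _
      rw [Finset.smul_sum, ← Equiv.sum_comp (MulAction.toPerm g)]
      refine Finset.sum_congr rfl fun ω _ => ?_
      rw [MulAction.toPerm_apply, coeff_single_smul, hq]
      simp only [smul_smul, MonoidAlgebra.single_mul_single]
      simp)

theorem lift_apply [Fintype Ω] (q : Ω → M)
    (hq : ∀ (g : G) ω, q (g • ω) = MonoidAlgebra.single g (1 : R) • q ω) (m : Perm R G Ω) :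
    lift q hq m = ∑ ω, MonoidAlgebra.single (1 : G) (coeff m ω) • q ω := rfl

/-- The element of `RΩ` with given coefficients. -/
def ofFun [Finite Ω] : (Ω → R) →+ Perm R G Ω where
  toFun c := (MonoidAlgebra.ofCoeff (Finsupp.equivFunOnFinite.symm c) : MonoidAlgebra R Ω)
  map_zero' := by
    refine ext fun ω => ?_
    change (Finsupp.equivFunOnFinite.symm (0 : Ω → R)) ω = 0
    simp
  map_add' c d := by
    refine ext fun ω => ?_
    change (Finsupp.equivFunOnFinite.symm (c + d)) ω =
      (Finsupp.equivFunOnFinite.symm c) ω + (Finsupp.equivFunOnFinite.symm d) ω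
    simp

@[simp] theorem coeff_ofFun [Finite Ω] (c : Ω → R) (ω : Ω) :
    coeff (ofFun c : Perm R G Ω) ω = c ω := rfl

end Perm

/-- A retract of `RΩ` in coordinates: `i` collects the coefficient functions, `q` the images of the
basis points, and the sum formula is the identity of the retraction. In this form summands can be
dualized and tensored by manipulating finite sums. -/
theorem isPPermutation_iff {M : Type u} [AddCommGroup M] [Module (MonoidAlgebra R G) M] :
    IsPPermutation R G M ↔ ∃ (Ω : Type u) (_ : Fintype Ω) (_ : MulAction G Ω)
      (i : M →+ (Ω → R)) (q : Ω → M),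
      (∀ (g : G) (r : R) m ω, i (MonoidAlgebra.single g r • m) ω = r * i m (g⁻¹ • ω)) ∧
      (∀ (g : G) ω, q (g • ω) = MonoidAlgebra.single g (1 : R) • q ω) ∧
      ∀ m, ∑ ω, MonoidAlgebra.single (1 : G) (i m ω) • q ω = m := by
  constructor
  · rintro ⟨Ω, _, _, i, q, h⟩
    have := Fintype.ofFinite Ω
    refine ⟨Ω, this, ‹_›, Perm.coeffHom.comp i.toAddMonoidHom, fun ω => q (Perm.basis R ω),
      fun g r m ω => ?_, fun g ω => ?_, fun m => ?_⟩
    · change Perm.coeff (i _) ω = _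
      rw [map_smul, Perm.coeff_single_smul]
      rfl
    · dsimp only
      rw [Perm.smul_basis, map_smul]
    · simp only [← map_smul, ← map_sum]
      refine (congrArg q (Perm.sum_coeff (i m))).trans ?_
      exact LinearMap.congr_fun h m
  · rintro ⟨Ω, _, _, i, q, hi, hq, h⟩
    refine ⟨Ω, inferInstance, _, Perm.linearOfSingle (Perm.ofFun.comp i) fun g r m => ?_,
      Perm.lift q hq, LinearMap.ext fun m => ?_⟩
    · refine Perm.ext fun ω => ?_
      rw [Perm.coeff_single_smul]
      exact hi g r m ω
    · exact h m

/-- A description of `p`-permutation modules through an additive isomorphism `e : M ≃+ V`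
which turns the action of `r g` into `v ↦ r (g v)`. -/
theorem isPPermutation_iff_of_equiv {M V : Type u} [AddCommGroup M] [Module (MonoidAlgebra R G) M]
    [AddCommGroup V] (e : M ≃+ V) (sc : R → V → V) (act : G → V → V) (sc_one : ∀ v, sc 1 v = v)
    (act_one : ∀ v, act 1 v = v)
    (he : ∀ (g : G) (r : R) m, e (MonoidAlgebra.single g r • m) = sc r (act g (e m))) :
    IsPPermutation R G M ↔ ∃ (Ω : Type u) (_ : Fintype Ω) (_ : MulAction G Ω)
      (i : V →+ (Ω → R)) (q : Ω → V),
      (∀ (r : R) v ω, i (sc r v) ω = r * i v ω) ∧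
      (∀ (g : G) v ω, i (act g v) ω = i v (g⁻¹ • ω)) ∧
      (∀ (g : G) ω, q (g • ω) = act g (q ω)) ∧
      ∀ v, ∑ ω, sc (i v ω) (q ω) = v := by
  rw [isPPermutation_iff]
  constructor
  · rintro ⟨Ω, hΩ, a, i, q, hi, hq, h⟩
    have he' : ∀ g r v, e.symm (sc r (act g v)) = MonoidAlgebra.single g r • e.symm v := by
      intro g r v
      rw [e.symm_apply_eq, he, e.apply_symm_apply]
    refine ⟨Ω, hΩ, a, i.comp e.symm.toAddMonoidHom, fun ω => e (q ω), fun r v ω => ?_,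
      fun g v ω => ?_, fun g ω => ?_, fun v => ?_⟩
    · have := he' 1 r v
      rw [act_one] at this
      change i (e.symm _) ω = r * i (e.symm v) ω
      rw [this, hi, inv_one, one_smul]
    · have := he' g 1 v
      rw [sc_one] at this
      change i (e.symm _) ω = i (e.symm v) _
      rw [this, hi, one_mul]
    · dsimp only
      rw [hq, he, sc_one]
    · apply e.symm.injective
      rw [← h (e.symm v), map_sum]
      refine Finset.sum_congr rfl fun ω _ => ?_
      have := he' 1 (i (e.symm v) ω) (e (q ω))
      rw [act_one, e.symm_apply_apply] at this
      exact this
  · rintro ⟨Ω, hΩ, a, i, q, hi, hi', hq, h⟩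
    refine ⟨Ω, hΩ, a, i.comp e.toAddMonoidHom, fun ω => e.symm (q ω), fun g r v ω => ?_,
      fun g ω => ?_, fun v => ?_⟩
    · change i (e _) ω = r * i (e v) _
      rw [he, hi, hi']
    · dsimp only
      rw [hq, e.symm_apply_eq, he, sc_one, e.apply_symm_apply]
    · apply e.injective
      rw [map_sum, ← h (e v)]
      refine Finset.sum_congr rfl fun ω _ => ?_
      rw [he, act_one, e.apply_symm_apply]
      rfl

theorem blockOf_apply (b : MonoidAlgebra R G) (g : G) :
    blockOf b g = BlockAlgebra.mk R b (MonoidAlgebra.single g 1) := rfl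

theorem mk_single (b : MonoidAlgebra R G) (g : G) (r : R) :
    BlockAlgebra.mk R b (MonoidAlgebra.single g r) =
      algebraMap R (BlockAlgebra b) r * blockOf b g := by
  rw [blockOf_apply, ← AlgHom.commutes (BlockAlgebra.mk R b), ← map_mul]
  congr 1
  simp [MonoidAlgebra.single_mul_single]

theorem isBlockPPermutation_iff {b : MonoidAlgebra R G} {V : ModuleCat.{u} (BlockAlgebra b)} :
    IsBlockPPermutation b V ↔ ∃ (Ω : Type u) (_ : Fintype Ω) (_ : MulAction G Ω)
      (i : V →+ (Ω → R)) (q : Ω → V),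
      (∀ (r : R) v ω, i (algebraMap R (BlockAlgebra b) r • v) ω = r * i v ω) ∧
      (∀ (g : G) v ω, i (blockOf b g • v) ω = i v (g⁻¹ • ω)) ∧
      (∀ (g : G) ω, q (g • ω) = blockOf b g • q ω) ∧
      ∀ v, ∑ ω, algebraMap R (BlockAlgebra b) (i v ω) • q ω = v := by
  refine isPPermutation_iff_of_equiv
    (M := (ModuleCat.restrictScalars (BlockAlgebra.mk R b).toRingHom).obj V) (V := V) (AddEquiv.refl V)
    (fun r v => algebraMap R (BlockAlgebra b) r • v) (fun g v => blockOf b g • v)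
    (by simp) (by simp) fun g r m => ?_
  change BlockAlgebra.mk R b (MonoidAlgebra.single g r) • (show V from m) = _
  rw [mk_single, mul_smul]
  rfl

variable {H : Type u} [Group H]

/-- The scalar part and the group part of the action are separated, so that the left and right
actions can later be used one at a time. -/
theorem isPPermutation_bimoduleRep_iff {c : MonoidAlgebra R H} {b : MonoidAlgebra R G}
    (X : Bimodule R (BlockAlgebra c) (BlockAlgebra b)) :
    IsPPermutation R (H × G) (bimoduleRep X).asModule ↔
      ∃ (Ω : Type u) (_ : Fintype Ω) (_ : MulAction (H × G) Ω) (i : X →+ (Ω → R)) (q : Ω → X),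
      (∀ (r : R) x ω, i (r • x) ω = r * i x ω) ∧
      (∀ (k : H × G) x ω,
        i (blockOf c k.1 • MulOpposite.op (blockOf b k.2⁻¹) • x) ω = i x (k⁻¹ • ω)) ∧
      (∀ (k : H × G) ω, q (k • ω) = blockOf c k.1 • MulOpposite.op (blockOf b k.2⁻¹) • q ω) ∧
      ∀ x, ∑ ω, i x ω • q ω = x := by
  refine isPPermutation_iff_of_equiv (M := (bimoduleRep X).asModule) (V := X) (AddEquiv.refl X)
    (fun r v => r • v) (fun (k : H × G) v => blockOf c k.1 • MulOpposite.op (blockOf b k.2⁻¹) • v)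
    (by simp) (by simp) fun g r m => ?_
  rw [Representation.single_smul]
  rfl

end PermutationModules

/-! ### `p`-permutation bimodules: duals and permeability -/

section Splendid

variable {R : Type u} [CommRing R] {G H : Type u} [Group G] [Group H]
  {c : MonoidAlgebra R H} {b : MonoidAlgebra R G}

/-- The dual of a `p`-permutation bimodule is a `p`-permutation bimodule. -/
theorem isPPermutation_dual {X : Bimodule R (BlockAlgebra c) (BlockAlgebra b)}
    (hX : IsPPermutation R (H × G) (bimoduleRep X).asModule) :
    IsPPermutation R (G × H) (bimoduleRep X.dual).asModule := by
  rw [isPPermutation_bimoduleRep_iff] at hX ⊢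
  obtain ⟨Ω, hΩ, a, i, q, hi, hi', hq, h⟩ := hX
  -- The dual basis: `i` and `q` exchange roles. The coefficients of a form are its values at the `q
  -- ω`, and the form attached to `ω` is the coefficient function `i · ω`. The group acts on the
  -- same set `Ω` with its two factors swapped.
  refine ⟨Ω, hΩ, MulAction.compHom Ω (MulEquiv.prodComm (M := G) (N := H)).toMonoidHom,
    { toFun := fun f ω => (show X →ₗ[R] R from f) (q ω)
      map_zero' := rfl
      map_add' := fun _ _ => rfl },
    fun ω => (show X →ₗ[R] R from
      { toFun := fun x => i x ω
        map_add' := fun x y => by simp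
        map_smul' := fun r x => hi r x ω }), fun r f ω => rfl, ?_, ?_, ?_⟩
  · rintro ⟨g, k⟩ f ω
    change (show X →ₗ[R] R from f) (blockOf c k⁻¹ • MulOpposite.op (blockOf b g) • q ω) =
      (show X →ₗ[R] R from f) (q ((k⁻¹, g⁻¹) • ω))
    rw [hq]
    simp
  · rintro ⟨g, k⟩ ω
    refine LinearMap.ext fun x => ?_
    change i x ((k, g) • ω) = i (blockOf c k⁻¹ • MulOpposite.op (blockOf b g) • x) ω
    have := hi' (k⁻¹, g⁻¹) x ω
    simp only [inv_inv, Prod.inv_mk] at this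
    exact this.symm
  · intro f
    refine LinearMap.ext fun x => ?_
    have key : ∀ f : X →ₗ[R] R, ∑ ω, f (q ω) • i x ω = f x := by
      intro f
      conv_rhs => rw [← h x, map_sum]
      exact Finset.sum_congr rfl fun ω _ => by rw [map_smul, smul_eq_mul, smul_eq_mul, mul_comm]
    refine Eq.trans ?_ (key f)
    exact LinearMap.sum_apply (M := X) (M₂ := R) (σ₁₂ := RingHom.id R) _ _ _

/-- A `p`-permutation bimodule is permeable. -/
theorem isPermeable_of_isPPermutation {X : Bimodule R (BlockAlgebra c) (BlockAlgebra b)}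
    (hX : IsPPermutation R (H × G) (bimoduleRep X).asModule) : IsPermeable X := by
  classical
  intro V hV
  rw [isBlockPPermutation_iff] at hV ⊢
  rw [isPPermutation_bimoduleRep_iff] at hX
  obtain ⟨Ω, _, _, i, q, hi, hi', hq, h⟩ := hX
  obtain ⟨Δ, _, _, j, s, hj, hj', hs, h'⟩ := hV
  have hiG : ∀ (g : G) x ω,
      i (MulOpposite.op (blockOf b g) • x) ω = i x (((1 : H), g) • ω) := by
    intro g x ω
    simpa using hi' (1, g⁻¹) x ω
  have hiH : ∀ (k : H) x ω, i (blockOf c k • x) ω = i x ((k⁻¹, (1 : G)) • ω) := by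
    intro k x ω
    simpa using hi' (k, 1) x ω
  have hqG : ∀ (g : G) ω, q (((1 : H), g) • ω) = MulOpposite.op (blockOf b g⁻¹) • q ω := by
    intro g ω
    simpa using hq (1, g) ω
  have hqH : ∀ (k : H) ω, q ((k, (1 : G)) • ω) = blockOf c k • q ω := by
    intro k ω
    simpa using hq (k, 1) ω
  have one_act : ∀ ω : Ω, ((1 : H), (1 : G)) • ω = ω := one_smul (H × G)
  -- The `H`-set for the tensor product is the set of diagonal `G`-orbits on `Ω × Δ`. The element
  -- `(1, g)` acts on `X` as right multiplication by `g⁻¹`, so tensoring over `G` identifies exactly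
  -- the points of one orbit.
  let st : Setoid (Ω × Δ) :=
    { r := fun x y => ∃ g : G, (((1 : H), g) • x.1, g • x.2) = y
      iseqv :=
        { refl := fun x => ⟨1, by simp [one_act]⟩
          symm := by
            rintro x _ ⟨g, rfl⟩
            exact ⟨g⁻¹, by simp [smul_smul, one_act]⟩
          trans := by
            rintro x _ _ ⟨g, rfl⟩ ⟨g', rfl⟩
            exact ⟨g' * g, by simp [smul_smul]⟩ } }
  let Γ := Quotient st
  let actH : MulAction H Γ :=
    { smul := fun k => Quotient.map (fun x => ((k, (1 : G)) • x.1, x.2)) (by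
        rintro x _ ⟨g, rfl⟩
        exact ⟨g, by simp [smul_smul]⟩)
      one_smul := by
        rintro ⟨x⟩
        exact congrArg (Quotient.mk st) (by simp [one_act])
      mul_smul := by
        rintro k k' ⟨x⟩
        exact congrArg (Quotient.mk st) (by simp [smul_smul]) }
  let fib : Γ → Finset (Ω × Δ) := fun γ => Finset.univ.filter fun x => Quotient.mk st x = γ
  -- the coefficients of a tensor
  let I₀ : Γ → X →+ V →+ R := fun γ => AddMonoidHom.mk' (fun y => AddMonoidHom.mk'
      (fun v => ∑ x ∈ fib γ, i y x.1 * j v x.2)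
      (fun v w => by simp [mul_add, Finset.sum_add_distrib]))
      (fun y z => by ext v; simp [add_mul, Finset.sum_add_distrib])
  -- Moving `g` across the tensor sign amounts to reindexing the sum over an orbit by the diagonal
  -- action of `g`.
  have hI₀ : ∀ γ y (a : BlockAlgebra b) v, I₀ γ (MulOpposite.op a • y) v = I₀ γ y (a • v) := by
    intro γ y a v
    obtain ⟨a, rfl⟩ := RingQuot.mkAlgHom_surjective R (BlockRel b) a
    induction a using MonoidAlgebra.induction_linear with
    | zero => simp
    | add a a' ha ha' => simp only [map_add, MulOpposite.op_add, add_smul, AddMonoidHom.add_apply,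
        ha, ha']
    | single g r =>
      change I₀ γ (MulOpposite.op (BlockAlgebra.mk R b _) • y) v =
        I₀ γ y (BlockAlgebra.mk R b _ • v)
      rw [mk_single, Algebra.commutes, MulOpposite.op_mul, mul_smul, ← Algebra.commutes, mul_smul,
        ← MulOpposite.algebraMap_apply, algebraMap_smul]
      change ∑ x ∈ fib γ, i (r • _) x.1 * j v x.2 =
        ∑ x ∈ fib γ, i y x.1 * j (algebraMap R (BlockAlgebra b) r • _) x.2
      simp only [hi, hiG, hj, hj']
      refine Finset.sum_equiv ((MulAction.toPerm ((1 : H), g)).prodCongr (MulAction.toPerm g))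
        (fun x => ?_) (fun x _ => ?_)
      · simp only [fib, Finset.mem_filter, Finset.mem_univ, true_and]
        rw [show Quotient.mk st x = Quotient.mk st (((MulAction.toPerm ((1 : H), g)).prodCongr
          (MulAction.toPerm g)) x) from Quotient.sound ⟨g, rfl⟩]
      · simp only [Equiv.prodCongr_apply, Prod.map_fst, MulAction.toPerm_apply, Prod.map_snd,
          inv_smul_smul]
        ring
  let I : X.Tensor V →+ (Γ → R) := AddMonoidHom.pi fun γ => Bimodule.tensorLiftAdd (I₀ γ) (hI₀ γ)
  have I_tmul : ∀ y v γ, I (X.tmul y v) γ = ∑ x ∈ fib γ, i y x.1 * j v x.2 := fun _ _ _ => rfl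
  let S : Γ → X.Tensor V := Quotient.lift (fun x => X.tmul (q x.1) (s x.2)) (by
    rintro x _ ⟨g, rfl⟩
    simp only [hqG, hs, Bimodule.op_smul_tmul, smul_smul, ← map_mul]
    simp)
  have e1 : ∀ (r : R) (t : X.Tensor V) γ,
      I (algebraMap R (BlockAlgebra c) r • t) γ = r * I t γ := by
    intro r t γ
    induction t using Bimodule.tensor_induction with
    | zero => simp
    | add s t hs ht => simp only [smul_add, map_add, Pi.add_apply, hs, ht, mul_add]
    | tmul y v =>
      rw [Bimodule.smul_tmul, I_tmul, I_tmul, algebraMap_smul, Finset.mul_sum]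
      simp only [hi, mul_assoc]
  have e2 : ∀ (k : H) (t : X.Tensor V) γ, I (blockOf c k • t) γ = I t (k⁻¹ • γ) := by
    intro k t γ
    induction t using Bimodule.tensor_induction with
    | zero => simp
    | add s t hs ht => simp only [smul_add, map_add, Pi.add_apply, hs, ht]
    | tmul y v =>
      rw [Bimodule.smul_tmul, I_tmul, I_tmul]
      simp only [hiH]
      refine Finset.sum_equiv ((MulAction.toPerm (k⁻¹, (1 : G))).prodCongr (Equiv.refl Δ))
        (fun x => ?_) (fun x _ => rfl)
      simp only [fib, Finset.mem_filter, Finset.mem_univ, true_and]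
      rw [eq_inv_smul_iff]
      have : Quotient.mk st x = k • Quotient.mk st
          (((MulAction.toPerm (k⁻¹, (1 : G))).prodCongr (Equiv.refl Δ)) x) := by
        refine congrArg (Quotient.mk st) ?_
        simp [smul_smul, one_act]
      rw [this]
  have e3 : ∀ (k : H) γ, S (k • γ) = blockOf c k • S γ := by
    rintro k ⟨x⟩
    change X.tmul (q ((k, (1 : G)) • x.1)) (s x.2) = blockOf c k • X.tmul (q x.1) (s x.2)
    rw [hqH, Bimodule.smul_tmul]
  have e4 : ∀ t, ∑ γ, algebraMap R (BlockAlgebra c) (I t γ) • S γ = t := by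
    intro t
    induction t using Bimodule.tensor_induction with
    | zero => simp
    | add s t hs ht =>
      simp only [map_add, Pi.add_apply, add_smul, Finset.sum_add_distrib, hs, ht]
    | tmul y v =>
      -- Each orbit sum is spread back over its points. The sum over all orbits is then a double sum
      -- over `Ω × Δ`, which factors into the expansions of `y` and of `v`.
      have h1 : ∀ γ, algebraMap R (BlockAlgebra c) (I (X.tmul y v) γ) • S γ =
          ∑ x ∈ fib γ, X.tmul (i y x.1 • q x.1)
            (algebraMap R (BlockAlgebra b) (j v x.2) • s x.2) := by
        intro γ
        rw [I_tmul, map_sum, Finset.sum_smul]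
        refine Finset.sum_congr rfl fun x hx => ?_
        obtain rfl : Quotient.mk st x = γ := by simpa [fib] using hx
        change _ • X.tmul (q x.1) (s x.2) = _
        rw [← Bimodule.op_smul_tmul, ← MulOpposite.algebraMap_apply, algebraMap_smul,
          algebraMap_smul, smul_smul, mul_comm]
        rfl
      rw [Finset.sum_congr rfl fun γ _ => h1 γ, Finset.sum_fiberwise, Fintype.sum_prod_type]
      simp only [← Bimodule.tmul_sum, h', ← Bimodule.sum_tmul, h]
  exact ⟨Γ, inferInstance, actH, I, S, e1, e2, e3, e4⟩

end Splendid

/-! ### Summands of finite direct sums -/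

section InAdd

/-- `N` is a direct summand of a finite direct sum of copies of `N'`. -/
def InAdd (S : Type*) [Ring S] (N N' : Type*) [AddCommGroup N] [Module S N] [AddCommGroup N']
    [Module S N'] : Prop :=
  ∃ (n : ℕ) (f : Fin n → N →ₗ[S] N') (g : Fin n → N' →ₗ[S] N),
    ∑ i, g i ∘ₗ f i = LinearMap.id

namespace InAdd

variable {S : Type*} [Ring S] {N N' N'' : Type*} [AddCommGroup N] [Module S N] [AddCommGroup N']
    [Module S N'] [AddCommGroup N''] [Module S N'']

theorem of_sum {ι : Type*} [Fintype ι] (f : ι → N →ₗ[S] N') (g : ι → N' →ₗ[S] N)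
    (h : ∑ i, g i ∘ₗ f i = LinearMap.id) : InAdd S N N' := by
  refine ⟨Fintype.card ι, fun i => f ((Fintype.equivFin ι).symm i),
    fun i => g ((Fintype.equivFin ι).symm i), ?_⟩
  rw [← h]
  exact Equiv.sum_comp (Fintype.equivFin ι).symm fun i => g i ∘ₗ f i

theorem of_retract (f : N →ₗ[S] N') (g : N' →ₗ[S] N) (h : g ∘ₗ f = LinearMap.id) : InAdd S N N' :=
  of_sum (ι := Unit) (fun _ => f) (fun _ => g) (by simpa using h)

theorem of_equiv (e : N ≃ₗ[S] N') : InAdd S N N' :=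
  of_retract e.toLinearMap e.symm.toLinearMap (by ext; simp)

theorem trans (h : InAdd S N N') (h' : InAdd S N' N'') : InAdd S N N'' := by
  obtain ⟨n, f, g, h⟩ := h
  obtain ⟨m, f', g', h'⟩ := h'
  refine of_sum (ι := Fin n × Fin m) (fun i => f' i.2 ∘ₗ f i.1) (fun i => g i.1 ∘ₗ g' i.2) ?_
  rw [← h, Fintype.sum_prod_type]
  refine Finset.sum_congr rfl fun i _ => LinearMap.ext fun x => ?_
  have := LinearMap.congr_fun h' (f i x)
  simp only [LinearMap.sum_apply, LinearMap.comp_apply, LinearMap.id_apply] at this ⊢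
  rw [← map_sum, this]

end InAdd

variable {R : Type u} [CommRing R] {A B : Type u} [Ring B] [Algebra R B] [Ring A] [Algebra R A]
  (X : Bimodule R B A) {V W : Type u} [AddCommGroup V] [Module A V] [AddCommGroup W] [Module A W]

namespace Bimodule

theorem tensorMap_id : X.tensorMap (LinearMap.id : V →ₗ[A] V) = LinearMap.id :=
  tensor_hom_ext fun _ _ => rfl

theorem tensorMap_comp {U : Type u} [AddCommGroup U] [Module A U] (f : V →ₗ[A] W)
    (g : W →ₗ[A] U) : X.tensorMap (g ∘ₗ f) = X.tensorMap g ∘ₗ X.tensorMap f :=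
  tensor_hom_ext fun _ _ => rfl

theorem tensorMap_add (f g : V →ₗ[A] W) :
    X.tensorMap (f + g) = X.tensorMap f + X.tensorMap g :=
  tensor_hom_ext fun x v => tmul_add x (f v) (g v)

theorem tensorMap_sum {ι : Type*} (s : Finset ι) (f : ι → V →ₗ[A] W) :
    X.tensorMap (∑ i ∈ s, f i) = ∑ i ∈ s, X.tensorMap (f i) :=
  map_sum (AddMonoidHom.mk' X.tensorMap X.tensorMap_add) f s

end Bimodule

theorem InAdd.tensor (h : InAdd A V W) : InAdd B (X.Tensor V) (X.Tensor W) := by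
  obtain ⟨n, f, g, h⟩ := h
  refine ⟨n, fun i => X.tensorMap (f i), fun i => X.tensorMap (g i), ?_⟩
  simp only [← X.tensorMap_comp]
  rw [← X.tensorMap_sum, h, X.tensorMap_id]

end InAdd

/-! ### The dual bimodule as an inverse -/

section Equivalence

namespace Bimodule

variable {R : Type u} [CommRing R] {A B : Type u} [Ring B] [Algebra R B] [Ring A] [Algebra R A]
  (X : Bimodule R B A)

/-- The isomorphism `X ⊗_A A ≃ X`. -/
def tensorSelf : X.Tensor A ≃ₗ[B] X :=
  LinearEquiv.ofLinearMap
    (tensorLift (AddMonoidHom.mk' (fun x => AddMonoidHom.mk' (fun a => MulOpposite.op a • x)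
        (fun a a' => by simp [add_smul])) (fun x y => by ext a; simp))
      (fun b x a => by simp [smul_comm])
      (fun x a a' => by simp [smul_smul]))
    { toFun := fun x => X.tmul x 1
      map_add' := fun x y => add_tmul x y 1
      map_smul' := fun b x => rfl }
    (LinearMap.ext fun x => by
      change MulOpposite.op (1 : A) • x = x
      rw [MulOpposite.op_one, one_smul])
    (tensor_hom_ext fun x a => by
      change X.tmul (MulOpposite.op a • x) 1 = X.tmul x a
      rw [op_smul_tmul, smul_eq_mul, mul_one])

@[simp] theorem tensorSelf_tmul (x : X) (a : A) :
    X.tensorSelf (X.tmul x a) = MulOpposite.op a • x := rfl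

@[simp] theorem tensorSelf_symm_apply (x : X) : X.tensorSelf.symm x = X.tmul x 1 := rfl

/-- If `X ⊗_A -` is full then every `B`-endomorphism of `X` is a right multiplication. -/
theorem exists_eq_op_smul [X.tensorFunctor.Full] (α : X →ₗ[B] X) :
    ∃ a : A, ∀ x, α x = MulOpposite.op a • x := by
  -- Transported to `X ⊗_A A`, the endomorphism comes from an endomorphism `γ` of the left module
  -- `A`, and `γ` is right multiplication by `γ 1`.
  let β : X.Tensor A →ₗ[B] X.Tensor A := X.tensorSelf.symm.toLinearMap ∘ₗ α ∘ₗ X.tensorSelf.toLinearMap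
  obtain ⟨γ, hγ⟩ := X.tensorFunctor.map_surjective
    (X := ModuleCat.of A A) (Y := ModuleCat.of A A) (ModuleCat.ofHom β)
  have h : X.tensorMap γ.hom = β := congrArg ModuleCat.Hom.hom hγ
  refine ⟨γ.hom 1, fun x => ?_⟩
  have h1 := congrArg X.tensorSelf (LinearMap.congr_fun h (X.tmul x 1))
  simpa [β] using h1.symm

/-- If `X ⊗_A -` is essentially surjective then the trace ideal of `X` is `B`. -/
theorem exists_sum_eq_one [X.tensorFunctor.EssSurj] :
    ∃ (n : ℕ) (φ : Fin n → X →ₗ[B] B) (x : Fin n → X), ∑ i, φ i (x i) = 1 := by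
  -- With `X ⊗ Y ≅ B`, write the preimage of `1` as a sum of tensors `x_i ⊗ y_i`; the required forms
  -- are `x ↦ e(x ⊗ y_i)`.
  let Y := X.tensorFunctor.objPreimage (ModuleCat.of B B)
  let e : X.Tensor Y ≃ₗ[B] B := (X.tensorFunctor.objObjPreimageIso (ModuleCat.of B B)).toLinearEquiv
  obtain ⟨n, x, y, h⟩ := exists_sum_tmul (e.symm 1)
  refine ⟨n, fun i => e.toLinearMap ∘ₗ
    { toFun := fun x => X.tmul x (y i)
      map_add' := fun x x' => add_tmul x x' (y i)
      map_smul' := fun b x => rfl }, x, ?_⟩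
  change ∑ i, e (X.tmul (x i) (y i)) = 1
  rw [← map_sum, ← h, e.apply_symm_apply]

end Bimodule

variable {R : Type u} [CommRing R] {A : Type u} [Ring A] [Algebra R A] {H : Type u} [Group H]
  {c : MonoidAlgebra R H} (X : Bimodule R (BlockAlgebra c) A)

/-- The value of a linear form on a bimodule. -/
def dualApply (f : X.dual) (x : X) : R := (show X →ₗ[R] R from f) x

/-- The `RH`-linear map `X → RH`, `x ↦ ∑ f(h⁻¹x) h` attached to a linear form `f` on `X`. -/
def dualToHom [Finite H] : X.dual →+ X →+ MonoidAlgebra R H :=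
  AddMonoidHom.mk' (fun f => AddMonoidHom.mk'
    (fun x => .ofCoeff (Finsupp.equivFunOnFinite.symm fun h => dualApply X f (blockOf c h⁻¹ • x)))
    (fun x y => by
      ext h
      change (show X →ₗ[R] R from f) _ = (show X →ₗ[R] R from f) _ + (show X →ₗ[R] R from f) _
      rw [smul_add, map_add]))
    (fun f g => by ext x h; rfl)

variable {X}

theorem dualToHom_coeff [Finite H] (f : X.dual) (x : X) (h : H) :
    (dualToHom X f x).coeff h = dualApply X f (blockOf c h⁻¹ • x) := rfl

theorem dualApply_eq [Finite H] (f : X.dual) (x : X) :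
    dualApply X f x = (dualToHom X f x).coeff 1 := by
  rw [dualToHom_coeff, inv_one, map_one, one_smul]

/-- In `∑ f(h⁻¹x) h` a group element applied to `x` is absorbed by a translation of the summation
variable. -/
theorem dualToHom_smul [Finite H] (f : X.dual) (a : MonoidAlgebra R H) (x : X) :
    dualToHom X f (BlockAlgebra.mk R c a • x) = a * dualToHom X f x := by
  induction a using MonoidAlgebra.induction_linear with
  | zero => simp
  | add a a' h h' => rw [map_add, add_smul, map_add, h, h', add_mul]
  | single g r =>
    ext h
    rw [MonoidAlgebra.coeff_single_mul_apply, dualToHom_coeff, dualToHom_coeff, mk_single,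
      mul_smul, algebraMap_smul, smul_comm, smul_smul, ← map_mul, mul_inv_rev, inv_inv]
    exact (show X →ₗ[R] R from f).map_smul r _

theorem dualToHom_op_smul [Finite H] (f : X.dual) (a : MonoidAlgebra R H) (x : X) :
    dualToHom X (MulOpposite.op (BlockAlgebra.mk R c a) • f) x = dualToHom X f x * a := by
  induction a using MonoidAlgebra.induction_linear with
  | zero => simp
  | add a a' h h' =>
    rw [map_add, MulOpposite.op_add, add_smul, map_add, AddMonoidHom.add_apply, h, h', mul_add]
  | single g r =>
    ext h
    rw [MonoidAlgebra.coeff_mul_single_apply, dualToHom_coeff, dualToHom_coeff]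
    change (show X →ₗ[R] R from f) (BlockAlgebra.mk R c (MonoidAlgebra.single g r) • _) =
      (show X →ₗ[R] R from f) _ * _
    rw [mk_single, mul_smul, algebraMap_smul, map_smul, smul_smul, ← map_mul, mul_inv_rev,
      inv_inv, smul_eq_mul, mul_comm]

theorem dualToHom_smul_left [Finite H] (f : X.dual) (a : A) (x : X) :
    dualToHom X (a • f) x = dualToHom X f (MulOpposite.op a • x) := by
  ext h
  rw [dualToHom_coeff, dualToHom_coeff, smul_comm]
  rfl

theorem dualToHom_injective [Finite H] {f g : X.dual} (h : ∀ x, dualToHom X f x = dualToHom X g x) :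
    f = g :=
  LinearMap.ext fun x => by
    have := congrArg (fun y => y.coeff 1) (h x)
    simp only [← dualApply_eq] at this
    exact this

/-- The symmetrizing form of `RH` shows that every `RHc`-linear form `X → RHc` comes from an
`R`-linear form. -/
theorem exists_dualToHom_eq [Finite H] (hc : c ∈ Subring.center (MonoidAlgebra R H))
    (hc' : IsIdempotentElem c) (φ : X →ₗ[BlockAlgebra c] BlockAlgebra c) :
    ∃ f : X.dual, ∀ x, BlockAlgebra.mk R c (dualToHom X f x) = φ x := by
  have hbij := BlockAlgebra.bijective_mk R c hc hc'
  -- Elements of the block algebra are lifted to their unique representatives `a` with `ac = a`.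
  -- This lift is additive and left `RH`-linear.
  let e := (Equiv.ofBijective _ hbij).symm
  have he : ∀ y, BlockAlgebra.mk R c (e y : MonoidAlgebra R H) = y :=
    (Equiv.ofBijective _ hbij).apply_symm_apply
  have he' : ∀ (a : MonoidAlgebra R H), a * c = a → (e (BlockAlgebra.mk R c a)).1 = a := by
    intro a ha
    exact congrArg Subtype.val ((Equiv.ofBijective _ hbij).symm_apply_apply ⟨a, ha⟩)
  have hadd : ∀ y z, (e (y + z)).1 = (e y).1 + (e z).1 := by
    intro y z
    rw [← he' ((e y).1 + (e z).1) (by rw [add_mul, (e y).2, (e z).2]), map_add (BlockAlgebra.mk R c), he, he]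
  have hmul : ∀ a y, (e (BlockAlgebra.mk R c a * y)).1 = a * (e y).1 := by
    intro a y
    rw [← he' (a * (e y).1) (by rw [mul_assoc, (e y).2]), map_mul (BlockAlgebra.mk R c), he]
  -- The form is the coefficient at `1` of the lift of `φ x`. Then `f(h⁻¹x)` is the coefficient at
  -- `1` of `h⁻¹` times the lift, that is, the coefficient of the lift at `h`.
  let f : X.dual := show X →ₗ[R] R from
    { toFun := fun x => (e (φ x)).1.coeff 1
      map_add' := fun x y => by rw [map_add, hadd]; rfl
      map_smul' := fun r x => by
        rw [← algebraMap_smul (BlockAlgebra c) r x, map_smul,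
          ← AlgHom.commutes (BlockAlgebra.mk R c), smul_eq_mul, hmul, ← Algebra.smul_def]
        rfl }
  refine ⟨f, fun x => ?_⟩
  rw [← he (φ x)]
  congr 1
  ext h
  rw [dualToHom_coeff]
  change (e (φ _)).1.coeff 1 = _
  rw [map_smul, blockOf_apply, smul_eq_mul, hmul, MonoidAlgebra.coeff_single_mul_apply]
  simp

variable (X) in
/-- The map `X* ⊗_{RHc} W → W`, `f ⊗ w ↦ ∑ f(h⁻¹x) hw`. -/
def dualPairing [Finite H] (W : Type u) [AddCommGroup W] [Module (BlockAlgebra c) W] (x : X) :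
    X.dual.Tensor W →+ W :=
  Bimodule.tensorLiftAdd
    (AddMonoidHom.mk' (fun f => DistribSMul.toAddMonoidHom W
      (BlockAlgebra.mk R c (dualToHom X f x)))
      (fun f g => by
        ext w
        change BlockAlgebra.mk R c (dualToHom X (f + g) x) • w =
          BlockAlgebra.mk R c (dualToHom X f x) • w + BlockAlgebra.mk R c (dualToHom X g x) • w
        rw [map_add, AddMonoidHom.add_apply, map_add, add_smul]))
    (fun f b w => by
      obtain ⟨a, rfl⟩ := RingQuot.mkAlgHom_surjective R (BlockRel c) b
      change BlockAlgebra.mk R c (dualToHom X (MulOpposite.op (BlockAlgebra.mk R c a) • f) x) • w =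
        BlockAlgebra.mk R c (dualToHom X f x) • BlockAlgebra.mk R c a • w
      rw [dualToHom_op_smul, map_mul, mul_smul])

theorem dualPairing_tmul [Finite H] {W : Type u} [AddCommGroup W] [Module (BlockAlgebra c) W]
    (x : X) (f : X.dual) (w : W) :
    dualPairing X W x (X.dual.tmul f w) = BlockAlgebra.mk R c (dualToHom X f x) • w := rfl

variable (X) in
/-- The map `X ⊗_A X* ⊗_{RHc} W → W`, `x ⊗ f ⊗ w ↦ ∑ f(h⁻¹x) hw`. -/
def dualEval [Finite H] (W : Type u) [AddCommGroup W] [Module (BlockAlgebra c) W] :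
    X.Tensor (X.dual.Tensor W) →ₗ[BlockAlgebra c] W :=
  Bimodule.tensorLift
    (AddMonoidHom.mk' (dualPairing X W) (fun x x' => Bimodule.tensor_addHom_ext fun f w => by
      rw [AddMonoidHom.add_apply, dualPairing_tmul, dualPairing_tmul, dualPairing_tmul, map_add,
        map_add, add_smul]))
    (fun b x t => by
      obtain ⟨a, rfl⟩ := RingQuot.mkAlgHom_surjective R (BlockRel c) b
      change dualPairing X W (BlockAlgebra.mk R c a • x) t =
        BlockAlgebra.mk R c a • dualPairing X W x t
      induction t using Bimodule.tensor_induction with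
      | zero => simp
      | add s t hs ht => rw [map_add, map_add, hs, ht, smul_add]
      | tmul f w => rw [dualPairing_tmul, dualPairing_tmul, dualToHom_smul, map_mul, mul_smul])
    (fun x a t => by
      change dualPairing X W (MulOpposite.op a • x) t = dualPairing X W x (a • t)
      induction t using Bimodule.tensor_induction with
      | zero => simp
      | add s t hs ht => rw [map_add, smul_add, map_add, hs, ht]
      | tmul f w =>
        rw [Bimodule.smul_tmul, dualPairing_tmul, dualPairing_tmul, dualToHom_smul_left])

/-- If `X ⊗_A -` is an equivalence then every `RHc`-module `W` is a direct summand of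
`X ⊗_A X* ⊗_{RHc} W` (in fact they are isomorphic). -/
theorem inAdd_tensor_dual [Finite H] (hc : c ∈ Subring.center (MonoidAlgebra R H))
    (hc' : IsIdempotentElem c) (hX : X.tensorFunctor.IsEquivalence) (W : Type u) [AddCommGroup W]
    [Module (BlockAlgebra c) W] :
    InAdd (BlockAlgebra c) W (X.Tensor (X.dual.Tensor W)) := by
  obtain ⟨n, φ, y, hy⟩ := X.exists_sum_eq_one
  choose f hf using fun i => exists_dualToHom_eq hc hc' (φ i)
  have hα : ∀ i x, ∃ a : A, ∀ z, φ i z • x = MulOpposite.op a • z := fun i x =>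
    X.exists_eq_op_smul ((LinearMap.toSpanSingleton (BlockAlgebra c) X x) ∘ₗ φ i)
  choose α hα using hα
  let ε := dualEval X W
  have ε_tmul : ∀ x f w, ε (X.tmul x (X.dual.tmul f w)) =
    BlockAlgebra.mk R c (dualToHom X f x) • w := fun _ _ _ => rfl
  -- The inverse of the evaluation map is `w ↦ ∑ y_i ⊗ f_i ⊗ w`, where `∑ φ_i(y_i) = 1` and the
  -- linear form `f_i` represents `φ_i`.
  let s : W →+ X.Tensor (X.dual.Tensor W) :=
    ∑ i, (X.tmulHom _ (y i)).comp (X.dual.tmulHom W (f i))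
  have s_apply : ∀ w, s w = ∑ i, X.tmul (y i) (X.dual.tmul (f i) w) := by
    intro w
    simp [s, AddMonoidHom.finsetSum_apply]
  have h1 : ∀ w, ε (s w) = w := by
    intro w
    rw [s_apply, map_sum]
    simp only [ε_tmul, hf]
    rw [← Finset.sum_smul, hy, one_smul]
  -- Both sides induce the map `z ↦ φ_i(z) g(x)`, with forms read as maps to `RH`: on the right, `α
  -- i x` is the element of `A` whose right multiplication is the endomorphism `z ↦ φ_i(z) x`. This
  -- lets `g(x)` move across both tensor signs, turning `y_i` into `φ_i(y_i) x`.
  have key : ∀ i x (g : X.dual),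
      MulOpposite.op (BlockAlgebra.mk R c (dualToHom X g x)) • f i = α i x • g := by
    intro i x g
    refine dualToHom_injective fun z => ?_
    rw [dualToHom_op_smul, dualToHom_smul_left, ← hα, ← hf, dualToHom_smul]
  have h2 : s.comp ε.toAddMonoidHom = AddMonoidHom.id _ := by
    refine Bimodule.tensor_addHom_ext fun x t => ?_
    induction t using Bimodule.tensor_induction with
    | zero =>
      rw [show X.tmul x (0 : X.dual.Tensor W) = 0 from map_zero (X.tmulHom _ x), map_zero,
        map_zero]
    | add t t' ht ht' => rw [Bimodule.tmul_add, map_add, map_add, ht, ht']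
    | tmul g w =>
      change s (BlockAlgebra.mk R c (dualToHom X g x) • w) = X.tmul x (X.dual.tmul g w)
      rw [s_apply]
      have : ∀ i, X.tmul (y i) (X.dual.tmul (f i) (BlockAlgebra.mk R c (dualToHom X g x) • w)) =
          X.tmul (φ i (y i) • x) (X.dual.tmul g w) := by
        intro i
        rw [← Bimodule.op_smul_tmul, key, ← Bimodule.smul_tmul, ← Bimodule.op_smul_tmul, hα]
      rw [Finset.sum_congr rfl fun i _ => this i, ← Bimodule.sum_tmul, ← Finset.sum_smul, hy,
        one_smul]
  have hε : Function.Bijective ε :=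
    ⟨fun t t' h => (DFunLike.congr_fun h2 t).symm.trans
      ((congrArg s h).trans (DFunLike.congr_fun h2 t')), fun w => ⟨s w, h1 w⟩⟩
  exact InAdd.of_equiv (LinearEquiv.ofBijective ε hε).symm

end Equivalence

/-! ### Invariance of the Cartan matrix under linear equivalences -/

section Transport

variable {A B : Type u} [Ring A] [Ring B] (F : ModuleCat.{u} A ⥤ ModuleCat.{u} B)

/-- The linear map underlying the image of a linear map under a functor of module categories. -/
def mapLinear {M M' : Type u} [AddCommGroup M] [Module A M] [AddCommGroup M'] [Module A M']
    (f : M →ₗ[A] M') : F.obj (ModuleCat.of A M) →ₗ[B] F.obj (ModuleCat.of A M') :=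
  (F.map (ModuleCat.ofHom f)).hom

section

variable {M M' M'' : Type u} [AddCommGroup M] [Module A M] [AddCommGroup M'] [Module A M']
  [AddCommGroup M''] [Module A M'']

theorem mapLinear_comp (g : M' →ₗ[A] M'') (f : M →ₗ[A] M') :
    mapLinear F (g ∘ₗ f) = mapLinear F g ∘ₗ mapLinear F f := by
  rw [mapLinear, ModuleCat.ofHom_comp, F.map_comp]
  rfl

theorem mapLinear_zero [F.Additive] : mapLinear F (0 : M →ₗ[A] M') = 0 := by
  rw [mapLinear, ModuleCat.ofHom_zero, F.map_zero]
  rfl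

variable [F.IsEquivalence]

theorem mapLinear_injective {f g : M →ₗ[A] M'} (h : mapLinear F f = mapLinear F g) : f = g := by
  have := F.map_injective (ModuleCat.hom_ext h)
  exact congrArg ModuleCat.Hom.hom this

theorem injective_mapLinear {f : M →ₗ[A] M'} (hf : Function.Injective f) :
    Function.Injective (mapLinear F f) := by
  have : Mono (ModuleCat.ofHom f) := (ModuleCat.mono_iff_injective _).2 hf
  exact (ModuleCat.mono_iff_injective (F.map (ModuleCat.ofHom f))).1 inferInstance

theorem surjective_mapLinear {f : M →ₗ[A] M'} (hf : Function.Surjective f) :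
    Function.Surjective (mapLinear F f) := by
  have : Epi (ModuleCat.ofHom f) := (ModuleCat.epi_iff_surjective _).2 hf
  exact (ModuleCat.epi_iff_surjective (F.map (ModuleCat.ofHom f))).1 inferInstance

theorem range_mapLinear_eq_ker [F.Additive] {f : M →ₗ[A] M'} {g : M' →ₗ[A] M''}
    (h : LinearMap.range f = LinearMap.ker g) :
    LinearMap.range (mapLinear F f) = LinearMap.ker (mapLinear F g) := by
  have hz : ModuleCat.ofHom f ≫ ModuleCat.ofHom g = 0 :=
    ModuleCat.hom_ext (LinearMap.ext fun x => (h ▸ LinearMap.mem_range_self f x :))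
  have hS : (ShortComplex.mk _ _ hz).Exact :=
    (ShortComplex.moduleCat_exact_iff_range_eq_ker _).2 h
  exact (ShortComplex.moduleCat_exact_iff_range_eq_ker _).1 (hS.map F)

end

section

variable [F.IsEquivalence] {M : Type u} [AddCommGroup M] [Module A M] {M' : Type u}
  [AddCommGroup M'] [Module B M'] (e : F.obj (ModuleCat.of A M) ≃ₗ[B] M')

/-- The submodule of `M' ≅ F(M)` corresponding to a submodule of `M`. -/
def mapSubmodule (N : Submodule A M) : Submodule B M' :=
  LinearMap.range (e.toLinearMap ∘ₗ mapLinear F N.subtype)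

/-- An equivalence preserves surjections, so it carries the factorization of `f` through its range
to one of `F(f)`. -/
theorem mapSubmodule_range {L : Type u} [AddCommGroup L] [Module A L] (f : L →ₗ[A] M) :
    mapSubmodule F e (LinearMap.range f) =
      LinearMap.range (e.toLinearMap ∘ₗ mapLinear F f) := by
  have h : f = (LinearMap.range f).subtype ∘ₗ f.rangeRestrict := rfl
  conv_rhs => rw [h, mapLinear_comp, ← LinearMap.comp_assoc, LinearMap.range_comp,
    LinearMap.range_eq_top.2 (surjective_mapLinear F f.surjective_rangeRestrict),
    Submodule.map_top]
  rfl

/-- Exactness of `F` describes the image of `N` as a kernel as well as a range. Containment of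
submodules then becomes the vanishing of a composite `N → M → M/N'`, which a faithful functor
detects. -/
theorem mapSubmodule_eq_ker [F.Additive] (N : Submodule A M) :
    mapSubmodule F e N = LinearMap.ker (mapLinear F N.mkQ ∘ₗ e.symm.toLinearMap) := by
  have h : LinearMap.range (mapLinear F N.subtype) = LinearMap.ker (mapLinear F N.mkQ) :=
    range_mapLinear_eq_ker F (by simp)
  rw [mapSubmodule, LinearMap.range_comp, h, LinearMap.ker_comp]
  exact Submodule.map_equiv_eq_comap_symm e _

theorem mapSubmodule_le_iff [F.Additive] {N N' : Submodule A M} :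
    mapSubmodule F e N ≤ mapSubmodule F e N' ↔ N ≤ N' := by
  constructor
  · intro h
    rw [mapSubmodule_eq_ker F e N', mapSubmodule, LinearMap.range_le_ker_iff] at h
    have h0 : mapLinear F (N'.mkQ ∘ₗ N.subtype) = mapLinear F 0 := by
      rw [mapLinear_comp, mapLinear_zero, ← h]
      ext x
      simp
    have h1 := mapLinear_injective F h0
    intro x hx
    have := LinearMap.congr_fun h1 ⟨x, hx⟩
    simpa using this
  · intro h
    have : N.subtype = N'.subtype ∘ₗ Submodule.inclusion h := rfl
    rw [mapSubmodule, this, mapLinear_comp, ← LinearMap.comp_assoc]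
    exact LinearMap.range_comp_le_range _ _

theorem mapSubmodule_surjective : Function.Surjective (mapSubmodule F e) := by
  intro L
  -- The inclusion of `L` is, up to isomorphism, the image of a map into `M`; the range of that map
  -- corresponds to `L`.
  let Y := F.objPreimage (ModuleCat.of B L)
  let i : F.obj Y ≃ₗ[B] L := (F.objObjPreimageIso (ModuleCat.of B L)).toLinearEquiv
  obtain ⟨h, hh⟩ := F.map_surjective (X := Y) (Y := ModuleCat.of A M)
    (ModuleCat.ofHom (e.symm.toLinearMap ∘ₗ L.subtype ∘ₗ i.toLinearMap))
  refine ⟨LinearMap.range h.hom, ?_⟩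
  rw [mapSubmodule_range]
  have : mapLinear F h.hom = e.symm.toLinearMap ∘ₗ L.subtype ∘ₗ i.toLinearMap :=
    congrArg ModuleCat.Hom.hom hh
  rw [this, ← LinearMap.comp_assoc]
  ext x
  constructor
  · rintro ⟨y, rfl⟩
    simp
  · intro hx
    exact ⟨i.symm ⟨x, hx⟩, by simp⟩

/-- An equivalence `F` of module categories induces an isomorphism between the submodule lattices
of `M` and of `F(M)`. -/
def submoduleOrderIso [F.Additive] : Submodule A M ≃o Submodule B M' where
  toEquiv := Equiv.ofBijective (mapSubmodule F e)
    ⟨fun _ _ h => le_antisymm ((mapSubmodule_le_iff F e).1 h.le)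
      ((mapSubmodule_le_iff F e).1 h.ge), mapSubmodule_surjective F e⟩
  map_rel_iff' := mapSubmodule_le_iff F e

theorem submoduleOrderIso_apply [F.Additive] (N : Submodule A M) :
    submoduleOrderIso F e N = mapSubmodule F e N := rfl

/-- The image of a quotient of `M` is a quotient of `F(M)`. -/
def quotientEquiv [F.Additive] (N : Submodule A M) :
    F.obj (ModuleCat.of A (M ⧸ N)) ≃ₗ[B] M' ⧸ mapSubmodule F e N :=
  ((Submodule.quotEquivOfEq _ _ (mapSubmodule_eq_ker F e N)).trans
    (LinearMap.quotKerEquivOfSurjective (mapLinear F N.mkQ ∘ₗ e.symm.toLinearMap)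
      ((surjective_mapLinear F N.mkQ_surjective).comp e.symm.surjective))).symm

/-- The image of a submodule `N` of `M` is the corresponding submodule of `F(M)`. -/
def submoduleEquiv (N : Submodule A M) : F.obj (ModuleCat.of A N) ≃ₗ[B] mapSubmodule F e N :=
  LinearEquiv.ofInjective (e.toLinearMap ∘ₗ mapLinear F N.subtype)
    (e.injective.comp (injective_mapLinear F N.injective_subtype))

/-- The image of a factor is the corresponding factor. -/
def factorEquiv [F.Additive] {N N' : Submodule A M} (h : N' ≤ N) :
    F.obj (ModuleCat.of A (Factor A N N')) ≃ₗ[B]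
      Factor B (mapSubmodule F e N) (mapSubmodule F e N') :=
  (quotientEquiv F (submoduleEquiv F e N) (N'.submoduleOf N)).trans
    (Submodule.quotEquivOfEq _ _ (by
      have h1 : N'.submoduleOf N = LinearMap.range (Submodule.inclusion h) :=
        (Submodule.range_inclusion _ _ h).symm
      rw [h1, mapSubmodule_range]
      ext x
      have h2 : N'.subtype = N.subtype ∘ₗ Submodule.inclusion h := rfl
      rw [Submodule.submoduleOf, Submodule.mem_comap]
      change _ ↔ _ ∈ LinearMap.range (e.toLinearMap ∘ₗ mapLinear F N'.subtype)
      rw [h2, mapLinear_comp]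
      constructor
      · rintro ⟨y, rfl⟩
        exact ⟨y, rfl⟩
      · rintro ⟨y, hy⟩
        exact ⟨y, Subtype.ext hy⟩))

theorem nonempty_equiv_iff {L S : Type u} [AddCommGroup L] [Module A L] [AddCommGroup S]
    [Module A S] {L' S' : Type u} [AddCommGroup L'] [Module B L'] [AddCommGroup S'] [Module B S']
    (eL : F.obj (ModuleCat.of A L) ≃ₗ[B] L') (eS : F.obj (ModuleCat.of A S) ≃ₗ[B] S') :
    Nonempty (L ≃ₗ[A] S) ↔ Nonempty (L' ≃ₗ[B] S') := by
  constructor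
  · rintro ⟨i⟩
    exact ⟨(eL.symm.trans (F.mapIso i.toModuleIso).toLinearEquiv).trans eS⟩
  · rintro ⟨i⟩
    exact ⟨(F.preimageIso (X := ModuleCat.of A L) (Y := ModuleCat.of A S)
      ((eL.trans i).trans eS.symm).toModuleIso).toLinearEquiv⟩

/-- The image of a composition series. -/
def mapSeries {X Y : Type*} [Lattice X] [IsModularLattice X] [Lattice Y] [IsModularLattice Y]
    (Φ : X ≃o Y) (s : CompositionSeries X) : CompositionSeries Y where
  length := s.length
  toFun i := Φ (s i)
  step i := (apply_covBy_apply_iff Φ).2 (s.step i)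

theorem factorCount_map [F.Additive] {S S' : Type u} [AddCommGroup S] [Module A S] [AddCommGroup S']
    [Module B S'] (eS : F.obj (ModuleCat.of A S) ≃ₗ[B] S')
    (s : CompositionSeries (Submodule A M)) :
    factorCount B S' (mapSeries (submoduleOrderIso F e) s) = factorCount A S s :=
  Nat.card_congr <| Equiv.subtypeEquivRight fun i =>
    (nonempty_equiv_iff F (factorEquiv F e (s.step i).le) eS).symm

/-- Composition series correspond in both directions with equal factor counts, so the two suprema
run over the same set; finite length of the module is not needed. -/
theorem multiplicity_map [F.Additive]
    (e : F.obj (ModuleCat.of A M) ≃ₗ[B] M') {S S' : Type u} [AddCommGroup S] [Module A S] [AddCommGroup S']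
    [Module B S'] (eS : F.obj (ModuleCat.of A S) ≃ₗ[B] S') :
    multiplicity B M' S' = multiplicity A M S := by
  unfold multiplicity
  congr 1
  ext n
  constructor
  · rintro ⟨s, hb, ht, rfl⟩
    refine ⟨mapSeries (submoduleOrderIso F e).symm s, ?_, ?_, ?_⟩
    · exact (congrArg (submoduleOrderIso F e).symm hb).trans (map_bot _)
    · exact (congrArg (submoduleOrderIso F e).symm ht).trans (map_top _)
    · rw [← factorCount_map F e eS]
      congr 1
      refine RelSeries.ext rfl (funext fun i => ?_)
      exact (submoduleOrderIso F e).apply_symm_apply (s i)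
  · rintro ⟨s, hb, ht, rfl⟩
    refine ⟨mapSeries (submoduleOrderIso F e) s, ?_, ?_, factorCount_map F e eS s⟩
    · exact (congrArg (submoduleOrderIso F e) hb).trans (map_bot _)
    · exact (congrArg (submoduleOrderIso F e) ht).trans (map_top _)

/-- The radical is the infimum of the coatoms, hence determined by the submodule lattice. -/
theorem mapSubmodule_jacobson [F.Additive] :
    mapSubmodule F e (Module.jacobson A M) = Module.jacobson B M' := by
  rw [← submoduleOrderIso_apply, Module.jacobson, Module.jacobson, map_sInf]
  congr 1
  ext N
  constructor
  · rintro ⟨N, hN, rfl⟩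
    exact ((submoduleOrderIso F e).isCoatom_iff N).2 hN
  · intro hN
    exact ⟨(submoduleOrderIso F e).symm N, ((submoduleOrderIso F e).symm.isCoatom_iff N).2 hN,
      by simp⟩

theorem isCompactElement_map {X Y : Type*} [PartialOrder X] [PartialOrder Y] (Φ : X ≃o Y) {x : X}
    (hx : IsCompactElement x) : IsCompactElement (Φ x) := by
  intro s u hne hdir hu hxu
  obtain ⟨y, hy, hxy⟩ := hx (Φ.symm '' s) (Φ.symm u) (hne.image _)
    (directedOn_image.2 (hdir.mono fun _ _ h => Φ.symm.monotone h))
    ((Φ.symm.isLUB_image').2 hu) (Φ.le_symm_apply.2 hxu)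
  obtain ⟨z, hz, rfl⟩ := hy
  exact ⟨z, hz, Φ.le_symm_apply.1 hxy⟩

/-- Projectivity is categorical, and the other conditions are read off the submodule lattice: finite
generation is compactness of the top element, and indecomposability is the absence of proper
complements. -/
theorem isPIM_iff [F.Additive] (e : F.obj (ModuleCat.of A M) ≃ₗ[B] M') :
    IsPIM A M ↔ IsPIM B M' := by
  let Φ := submoduleOrderIso F e
  have h1 : Module.Finite A M ↔ Module.Finite B M' := by
    rw [Module.finite_def, Module.finite_def, Submodule.fg_iff_compact, Submodule.fg_iff_compact]
    constructor
    · intro h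
      have := isCompactElement_map Φ h
      rwa [map_top] at this
    · intro h
      have := isCompactElement_map Φ.symm h
      rwa [map_top] at this
  have h2 : Module.Projective A M ↔ Module.Projective B M' := by
    rw [IsProjective.iff_projective, IsProjective.iff_projective,
      ← F.asEquivalence.map_projective_iff]
    exact Projective.iso_iff e.toModuleIso
  have h3 : Nontrivial M ↔ Nontrivial M' := by
    exact (Submodule.nontrivial_iff A).symm.trans
      (Φ.toEquiv.nontrivial_congr.trans (Submodule.nontrivial_iff B))
  have h4 : (∀ N N' : Submodule A M, IsCompl N N' → N = ⊥ ∨ N' = ⊥) ↔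
      ∀ N N' : Submodule B M', IsCompl N N' → N = ⊥ ∨ N' = ⊥ := by
    constructor
    · intro h N N' hN
      have := h _ _ (Φ.symm.isCompl hN)
      simpa using this
    · intro h N N' hN
      have := h _ _ (Φ.isCompl hN)
      simpa using this
  constructor
  · rintro ⟨a, b, c, d⟩
    exact ⟨h1.1 a, h2.1 b, h3.1 c, h4.1 d⟩
  · rintro ⟨a, b, c, d⟩
    exact ⟨h1.2 a, h2.2 b, h3.2 c, h4.2 d⟩

variable {R : Type u} [CommRing R] [Algebra R A] [Algebra R B]

variable (A) in
/-- The action of `r ∈ R` as an endomorphism. -/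
def scalarMap (r : R) (M : Type u) [AddCommGroup M] [Module A M] : M →ₗ[A] M where
  toFun m := algebraMap R A r • m
  map_add' := smul_add _
  map_smul' a m := by
    rw [smul_smul, smul_smul, Algebra.commutes, RingHom.id_apply]

/-- As a supremum of ranges of scalar endomorphisms, `𝔪M` can be followed through any `R`-linear
equivalence. -/
theorem maximalIdealSMul_eq_iSup [IsLocalRing R] (M : Type u) [AddCommGroup M] [Module A M] :
    maximalIdealSMul R A M =
      ⨆ r : IsLocalRing.maximalIdeal R, LinearMap.range (scalarMap A (r : R) M) := by
  refine le_antisymm (Submodule.span_le.2 ?_) (iSup_le fun r => ?_)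
  · rintro _ ⟨r, hr, m, rfl⟩
    exact (le_iSup (fun r : IsLocalRing.maximalIdeal R => LinearMap.range (scalarMap A (r : R) M))
      ⟨r, hr⟩) ⟨m, rfl⟩
  · rintro _ ⟨m, rfl⟩
    exact Submodule.subset_span ⟨r, r.2, m, rfl⟩

variable (R) in
/-- A functor between the module categories of `R`-algebras is `R`-linear. -/
def MapsScalars : Prop :=
  ∀ (r : R) (M : Type u) [AddCommGroup M] [Module A M],
    mapLinear F (scalarMap A r M) = scalarMap B r (F.obj (ModuleCat.of A M))

theorem mapSubmodule_maximalIdealSMul [F.Additive] [IsLocalRing R] (hF : MapsScalars F R) :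
    mapSubmodule F e (maximalIdealSMul R A M) = maximalIdealSMul R B M' := by
  rw [← submoduleOrderIso_apply, maximalIdealSMul_eq_iSup, maximalIdealSMul_eq_iSup, map_iSup]
  congr 1
  ext1 r
  rw [submoduleOrderIso_apply, mapSubmodule_range, hF]
  ext x
  constructor
  · rintro ⟨y, rfl⟩
    exact ⟨e y, (map_smul e (algebraMap R B r) y).symm⟩
  · rintro ⟨y, rfl⟩
    refine ⟨e.symm y, ?_⟩
    change e (algebraMap R B r • e.symm y) = algebraMap R B r • y
    rw [map_smul, e.apply_symm_apply]

end

variable [F.IsEquivalence] [F.Additive]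

theorem isPIM_obj_iff (M : ModuleCat.{u} A) : IsPIM A M ↔ IsPIM B (F.obj M) :=
  isPIM_iff F (LinearEquiv.refl B (F.obj M))

/-- The restriction of an equivalence to projective indecomposable modules. -/
def pimFunctor :
    (ObjectProperty.FullSubcategory fun P : ModuleCat.{u} A => IsPIM A P) ⥤
      ObjectProperty.FullSubcategory fun P : ModuleCat.{u} B => IsPIM B P :=
  ObjectProperty.lift _ (ObjectProperty.ι _ ⋙ F) fun P => (isPIM_obj_iff F P.obj).1 P.property

instance : (pimFunctor F).Full := inferInstanceAs (ObjectProperty.lift _ _ _).Full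
instance : (pimFunctor F).Faithful := inferInstanceAs (ObjectProperty.lift _ _ _).Faithful

instance : (pimFunctor F).EssSurj where
  mem_essImage Q := by
    let i := F.objObjPreimageIso Q.obj
    have hP : IsPIM A (F.objPreimage Q.obj) :=
      ((isPIM_obj_iff F _).trans (isPIM_iff (𝟭 _) i.toLinearEquiv)).2 Q.property
    exact ⟨⟨F.objPreimage Q.obj, hP⟩, ⟨ObjectProperty.isoMk _ i⟩⟩

/-- The bijection between projective indecomposable modules induced by an equivalence. -/
def pimEquiv : PIM A ≃ PIM B :=
  Equiv.ofBijective (pimFunctor F).mapSkeleton.obj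
    ⟨(pimFunctor F).mapSkeleton_injective, (pimFunctor F).mapSkeleton_surjective⟩

/-- The representatives correspond under the bijection. -/
def pimEquivRepEquiv (P : PIM A) : F.obj P.rep ≃ₗ[B] (pimEquiv F P).rep :=
  ((ObjectProperty.ι _).mapIso
    (fromSkeletonToSkeletonIso ((pimFunctor F).obj ((fromSkeleton _).obj P)))).symm.toLinearEquiv

/-- Algebras with `R`-linearly equivalent module categories have the same Cartan matrix. -/
theorem sameCartanMatrix_of_isEquivalence {R : Type u} [CommRing R] [IsLocalRing R] [Algebra R A]
    [Algebra R B] (hF : MapsScalars F R) : SameCartanMatrix R A B := by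
  refine ⟨pimEquiv F, fun P Q => ?_⟩
  refine multiplicity_map F
    ((quotientEquiv F (pimEquivRepEquiv F Q) _).trans (Submodule.quotEquivOfEq _ _
      (mapSubmodule_maximalIdealSMul F _ hF)))
    ((quotientEquiv F (pimEquivRepEquiv F P) _).trans (Submodule.quotEquivOfEq _ _
      (mapSubmodule_jacobson F _)))

end Transport

/-! ### Morita contexts with surjective pairings -/

section MoritaContext

variable {R : Type u} [CommRing R] {A B : Type u} [Ring A] [Algebra R A] [Ring B] [Algebra R B]

instance (X : Bimodule R B A) : X.tensorFunctor.Additive where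
  map_add {_ _ f g} := ModuleCat.hom_ext (X.tensorMap_add f.hom g.hom)

theorem mapsScalars_tensorFunctor (X : Bimodule R B A) : MapsScalars X.tensorFunctor R := by
  intro r M _ _
  refine Bimodule.tensor_hom_ext (X := X) (V := M) fun x m => ?_
  change X.tmul x (algebraMap R A r • m) = X.tmul (algebraMap R B r • x) m
  rw [← Bimodule.op_smul_tmul, ← MulOpposite.algebraMap_apply, algebraMap_smul, algebraMap_smul]

/-- A Morita context between `A` and `B`. -/
structure MoritaContext (U : Bimodule R A B) (V : Bimodule R B A) where
  /-- The pairing `U ⊗_B V → A`. -/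
  left : U →+ V →+ A
  /-- The pairing `V ⊗_A U → B`. -/
  right : V →+ U →+ B
  left_smul : ∀ (a : A) u v, left (a • u) v = a * left u v
  left_balanced : ∀ (b : B) u v, left (MulOpposite.op b • u) v = left u (b • v)
  left_op_smul : ∀ (a : A) u v, left u (MulOpposite.op a • v) = left u v * a
  right_smul : ∀ (b : B) v u, right (b • v) u = b * right v u
  right_balanced : ∀ (a : A) v u, right (MulOpposite.op a • v) u = right v (a • u)
  right_op_smul : ∀ (b : B) v u, right v (MulOpposite.op b • u) = right v u * b
  assoc_left : ∀ u v u', left u v • u' = MulOpposite.op (right v u') • u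
  assoc_right : ∀ v u v', right v u • v' = MulOpposite.op (left u v') • v

namespace MoritaContext

variable {U : Bimodule R A B} {V : Bimodule R B A}

/-- The opposite Morita context. -/
def symm (C : MoritaContext U V) : MoritaContext V U where
  left := C.right
  right := C.left
  left_smul := C.right_smul
  left_balanced := C.right_balanced
  left_op_smul := C.right_op_smul
  right_smul := C.left_smul
  right_balanced := C.left_balanced
  right_op_smul := C.left_op_smul
  assoc_left := C.assoc_right
  assoc_right := C.assoc_left

variable (C : MoritaContext U V)

/-- The map `V ⊗_A Y → Y` given by pairing with an element of `U`. -/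
def pair (Y : Type u) [AddCommGroup Y] [Module A Y] (u : U) : V.Tensor Y →+ Y :=
  Bimodule.tensorLiftAdd
    (AddMonoidHom.mk' (fun v => DistribSMul.toAddMonoidHom Y (C.left u v)) (fun v v' => by
      ext y
      change C.left u (v + v') • y = C.left u v • y + C.left u v' • y
      rw [map_add, add_smul]))
    (fun v a y => by
      change C.left u (MulOpposite.op a • v) • y = C.left u v • a • y
      rw [C.left_op_smul, mul_smul])

theorem pair_tmul {Y : Type u} [AddCommGroup Y] [Module A Y] (u : U) (v : V) (y : Y) :
    C.pair Y u (V.tmul v y) = C.left u v • y := rfl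

/-- The map `U ⊗_B V ⊗_A Y → Y`. -/
def eval (Y : Type u) [AddCommGroup Y] [Module A Y] : U.Tensor (V.Tensor Y) →ₗ[A] Y :=
  Bimodule.tensorLift
    (AddMonoidHom.mk' (C.pair Y) (fun u u' => Bimodule.tensor_addHom_ext fun v y => by
      rw [AddMonoidHom.add_apply, pair_tmul, pair_tmul, pair_tmul, map_add,
        AddMonoidHom.add_apply, add_smul]))
    (fun a u t => by
      change C.pair Y (a • u) t = a • C.pair Y u t
      induction t using Bimodule.tensor_induction with
      | zero => simp
      | add s t hs ht => rw [map_add, map_add, hs, ht, smul_add]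
      | tmul v y => rw [pair_tmul, pair_tmul, C.left_smul, mul_smul])
    (fun u b t => by
      change C.pair Y (MulOpposite.op b • u) t = C.pair Y u (b • t)
      induction t using Bimodule.tensor_induction with
      | zero => simp
      | add s t hs ht => rw [map_add, smul_add, map_add, hs, ht]
      | tmul v y => rw [Bimodule.smul_tmul, pair_tmul, pair_tmul, C.left_balanced])

theorem eval_tmul {Y : Type u} [AddCommGroup Y] [Module A Y] (u : U) (v : V) (y : Y) :
    C.eval Y (U.tmul u (V.tmul v y)) = C.left u v • y := rfl

/-- The inverse is `y ↦ ∑ u_i ⊗ v_i ⊗ y`. The two associativity laws of the context let a factor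
`⟨u', v'⟩` move to the left, where `∑ ⟨u_i, v_i⟩ = 1` removes the auxiliary elements. -/
theorem bijective_eval {n : ℕ} {u : Fin n → U} {v : Fin n → V}
    (h : ∑ i, C.left (u i) (v i) = 1) (Y : Type u) [AddCommGroup Y] [Module A Y] :
    Function.Bijective (C.eval Y) := by
  let s : Y →+ U.Tensor (V.Tensor Y) := ∑ i, (U.tmulHom _ (u i)).comp (V.tmulHom Y (v i))
  have s_apply : ∀ y, s y = ∑ i, U.tmul (u i) (V.tmul (v i) y) := by
    intro y
    simp [s, AddMonoidHom.finsetSum_apply]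
  have h1 : ∀ y, C.eval Y (s y) = y := by
    intro y
    rw [s_apply, map_sum]
    simp only [eval_tmul]
    rw [← Finset.sum_smul, h, one_smul]
  have h2 : s.comp (C.eval Y).toAddMonoidHom = AddMonoidHom.id _ := by
    refine Bimodule.tensor_addHom_ext fun u' t => ?_
    induction t using Bimodule.tensor_induction with
    | zero => rw [show U.tmul u' (0 : V.Tensor Y) = 0 from map_zero (U.tmulHom _ u'), map_zero,
        map_zero]
    | add t t' ht ht' => rw [Bimodule.tmul_add, map_add, map_add, ht, ht']
    | tmul v' y =>
      change s (C.left u' v' • y) = U.tmul u' (V.tmul v' y)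
      rw [s_apply]
      have : ∀ i, U.tmul (u i) (V.tmul (v i) (C.left u' v' • y)) =
          U.tmul (C.left (u i) (v i) • u') (V.tmul v' y) := by
        intro i
        rw [← Bimodule.op_smul_tmul, ← C.assoc_right, ← Bimodule.smul_tmul,
          ← Bimodule.op_smul_tmul, C.assoc_left]
      rw [Finset.sum_congr rfl fun i _ => this i, ← Bimodule.sum_tmul, ← Finset.sum_smul, h,
        one_smul]
  exact ⟨fun t t' h => (DFunLike.congr_fun h2 t).symm.trans
    ((congrArg s h).trans (DFunLike.congr_fun h2 t')), fun y => ⟨s y, h1 y⟩⟩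

/-- The natural isomorphism `U ⊗_B V ⊗_A Y ≅ Y`. -/
def tensorIso {n : ℕ} {u : Fin n → U} {v : Fin n → V} (h : ∑ i, C.left (u i) (v i) = 1) :
    V.tensorFunctor ⋙ U.tensorFunctor ≅ 𝟭 (ModuleCat.{u} A) :=
  NatIso.ofComponents
    (fun Y => (LinearEquiv.ofBijective (C.eval Y) (C.bijective_eval h Y)).toModuleIso)
    (fun {Y Y'} f => by
      refine ModuleCat.hom_ext (Bimodule.tensor_hom_ext (X := U) (V := V.Tensor Y) fun u t => ?_)
      change C.pair Y' u (V.tensorMap f.hom t) = f.hom (C.pair Y u t)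
      induction t using Bimodule.tensor_induction with
      | zero => simp
      | add s t hs ht => rw [map_add, map_add, map_add, map_add, hs, ht]
      | tmul v y => rw [Bimodule.tensorMap_tmul, pair_tmul, pair_tmul, map_smul])

/-- A Morita context with surjective pairings gives an equivalence of module categories. -/
theorem isEquivalence {n : ℕ} {u : Fin n → U} {v : Fin n → V}
    (h : ∑ i, C.left (u i) (v i) = 1) {m : ℕ} {v' : Fin m → V} {u' : Fin m → U}
    (h' : ∑ i, C.right (v' i) (u' i) = 1) : V.tensorFunctor.IsEquivalence :=
  (CategoryTheory.Equivalence.mk V.tensorFunctor U.tensorFunctor (C.tensorIso h).symm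
    (C.symm.tensorIso h')).isEquivalence_functor

end MoritaContext

end MoritaContext

/-! ### Morita equivalence of endomorphism algebras -/

section EndomorphismAlgebras

variable {R : Type u} [CommRing R] {S : Type u} [Ring S] [Algebra R S]
  {N N' : Type u} [AddCommGroup N] [Module S N] [Module R N] [IsScalarTower R S N]
  [AddCommGroup N'] [Module S N'] {A B : Type u} [Ring A] [Algebra R A] [Ring B] [Algebra R B]

variable (N') in
/-- The pairing `Hom(N, N') × Hom(N', N) → A`. -/
def homPairing (α : A ≃ₐ[R] (Module.End S N)ᵐᵒᵖ) : (N →ₗ[S] N') →+ (N' →ₗ[S] N) →+ A :=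
  AddMonoidHom.mk' (fun f => AddMonoidHom.mk' (fun g => α.symm (MulOpposite.op (g ∘ₗ f)))
    (fun g g' => by rw [LinearMap.add_comp, MulOpposite.op_add, map_add]))
    (fun f f' => by
      ext g
      change α.symm _ = α.symm _ + α.symm _
      rw [LinearMap.comp_add, MulOpposite.op_add, map_add])

theorem homPairing_apply (α : A ≃ₐ[R] (Module.End S N)ᵐᵒᵖ) (f : N →ₗ[S] N') (g : N' →ₗ[S] N) :
    α (homPairing N' α f g) = MulOpposite.op (g ∘ₗ f) :=
  α.apply_symm_apply _

theorem homPairing_comp_right (α : A ≃ₐ[R] (Module.End S N)ᵐᵒᵖ) (f : N →ₗ[S] N')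
    (g : N' →ₗ[S] N) (a : A) :
    homPairing N' α (f ∘ₗ (α a).unop) g = a * homPairing N' α f g := by
  apply α.injective
  rw [map_mul, homPairing_apply, homPairing_apply]
  rfl

theorem homPairing_comp_left (α : A ≃ₐ[R] (Module.End S N)ᵐᵒᵖ) (f : N →ₗ[S] N')
    (g : N' →ₗ[S] N) (a : A) :
    homPairing N' α f ((α a).unop ∘ₗ g) = homPairing N' α f g * a := by
  apply α.injective
  rw [map_mul, homPairing_apply, homPairing_apply]
  rfl

theorem unop_homPairing (α : A ≃ₐ[R] (Module.End S N)ᵐᵒᵖ) (f : N →ₗ[S] N') (g : N' →ₗ[S] N) :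
    (α (homPairing N' α f g)).unop = g ∘ₗ f := by
  rw [homPairing_apply, MulOpposite.unop_op]

theorem sum_homPairing (α : A ≃ₐ[R] (Module.End S N)ᵐᵒᵖ) {n : ℕ} {f : Fin n → N →ₗ[S] N'}
    {g : Fin n → N' →ₗ[S] N} (h : ∑ i, g i ∘ₗ f i = LinearMap.id) :
    ∑ i, homPairing N' α (f i) (g i) = 1 := by
  apply α.injective
  rw [map_sum, map_one]
  simp only [homPairing_apply]
  exact (map_sum (MulOpposite.opAddEquiv (α := Module.End S N)) _ _).symm.trans
    (congrArg MulOpposite.op h)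

variable [Module R N'] [IsScalarTower R S N']

theorem homPairing_assoc (α : A ≃ₐ[R] (Module.End S N)ᵐᵒᵖ) (β : B ≃ₐ[R] (Module.End S N')ᵐᵒᵖ)
    (u u' : N →ₗ[S] N') (v : N' →ₗ[S] N) :
    u' ∘ₗ (α (homPairing N' α u v)).unop = (β (homPairing N β v u')).unop ∘ₗ u := by
  rw [unop_homPairing, unop_homPairing]
  rfl

/-- The bimodule `Hom(N, N')` over algebras acting on `N` and `N'` from the right. -/
def homBimodule (α : A ≃ₐ[R] (Module.End S N)ᵐᵒᵖ) (β : B ≃ₐ[R] (Module.End S N')ᵐᵒᵖ) :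
    Bimodule R A B :=
  letI leftMod : Module A (N →ₗ[S] N') :=
    { smul := fun a f => f ∘ₗ (α a).unop
      one_smul := fun f => by ext x; change f ((α 1).unop x) = _; simp
      mul_smul := fun a a' f => by ext x; change f ((α (a * a')).unop x) = _; rw [map_mul]; rfl
      smul_zero := fun a => rfl
      zero_smul := fun f => by ext x; change f ((α 0).unop x) = _; simp
      smul_add := fun a f g => rfl
      add_smul := fun a a' f => by
        ext x; change f ((α (a + a')).unop x) = f ((α a).unop x) + f ((α a').unop x)
        rw [← map_add, map_add α]; rfl }
  letI rightMod : Module Bᵐᵒᵖ (N →ₗ[S] N') :=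
    { smul := fun b f => (β b.unop).unop ∘ₗ f
      one_smul := fun f => by ext x; change (β 1).unop (f x) = _; simp
      mul_smul := fun a a' f => by
        ext x; change (β (a'.unop * a.unop)).unop (f x) = _; rw [map_mul]; rfl
      smul_zero := fun a => by ext x; exact map_zero (β a.unop).unop
      zero_smul := fun f => by ext x; change (β 0).unop (f x) = _; simp
      smul_add := fun a f g => by ext x; exact map_add (β a.unop).unop (f x) (g x)
      add_smul := fun a a' f => by
        ext x; change (β (a.unop + a'.unop)).unop (f x) = _; rw [map_add]; rfl }
  { carrier := N →ₗ[S] N'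
    leftModule := leftMod
    rightModule := rightMod
    leftTower := ⟨fun r a f => by
      ext x
      change f ((α (r • a)).unop x) = r • f ((α a).unop x)
      rw [map_smul, MulOpposite.unop_smul, LinearMap.smul_apply, LinearMap.map_smul_of_tower]⟩
    rightTower := ⟨fun r b f => by
      ext x
      change (β (r • b.unop)).unop (f x) = r • (β b.unop).unop (f x)
      rw [map_smul]
      rfl⟩
    comm := ⟨fun a b f => rfl⟩ }

/-- The Morita context of two modules. -/
def homContext (α : A ≃ₐ[R] (Module.End S N)ᵐᵒᵖ) (β : B ≃ₐ[R] (Module.End S N')ᵐᵒᵖ) :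
    MoritaContext (homBimodule α β) (homBimodule β α) where
  left := homPairing N' α
  right := homPairing N β
  left_smul a u v := homPairing_comp_right α u v a
  left_balanced _ _ _ := rfl
  left_op_smul a u v := homPairing_comp_left α u v a
  right_smul b v u := homPairing_comp_right β v u b
  right_balanced _ _ _ := rfl
  right_op_smul b v u := homPairing_comp_left β v u b
  assoc_left u v u' := homPairing_assoc α β u u' v
  assoc_right v u v' := homPairing_assoc β α v v' u

/-- If `N` and `N'` are direct summands of finite direct sums of copies of each other then their
endomorphism algebras have the same Cartan matrix. -/
theorem sameCartanMatrix_of_inAdd [IsLocalRing R] (α : A ≃ₐ[R] (Module.End S N)ᵐᵒᵖ)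
    (β : B ≃ₐ[R] (Module.End S N')ᵐᵒᵖ) (h : InAdd S N N') (h' : InAdd S N' N) :
    SameCartanMatrix R A B := by
  obtain ⟨n, f, g, h⟩ := h
  obtain ⟨m, f', g', h'⟩ := h'
  -- The two decompositions of the identity say precisely that both pairings of the Hom bimodules
  -- reach `1`.
  have := (homContext α β).isEquivalence (sum_homPairing α h) (sum_homPairing β h')
  exact sameCartanMatrix_of_isEquivalence (homBimodule β α).tensorFunctor
    (mapsScalars_tensorFunctor _)

end EndomorphismAlgebras

/-! ### Invariant relations on cosets and their matrices -/

section CosetMatrices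

variable {G : Type u} [Group G]

variable (G) in
/-- The disjoint union of the `G`-sets `G/L`. -/
abbrev CosetSpace : Type u := Σ L : Subgroup G, G ⧸ L

/-- The coset `gL`. -/
def pt (L : Subgroup G) (g : G) : CosetSpace G := ⟨L, g⟩

theorem pt_eq_iff {L L' : Subgroup G} {g g' : G} :
    pt L g = pt L' g' ↔ L = L' ∧ g⁻¹ * g' ∈ L := by
  constructor
  · intro h
    have h1 : L = L' := congrArg Sigma.fst h
    subst h1
    exact ⟨rfl, QuotientGroup.eq.1 (eq_of_heq (Sigma.mk.inj h).2)⟩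
  · rintro ⟨rfl, h⟩
    exact congrArg (Sigma.mk L) (QuotientGroup.eq.2 h)

theorem exists_pt (ω : CosetSpace G) : ∃ L g, ω = pt L g := by
  obtain ⟨L, ⟨g⟩⟩ := ω
  exact ⟨L, g, rfl⟩

theorem smul_pt (h : G) (L : Subgroup G) (g : G) : h • pt L g = pt L (h * g) := rfl

theorem pt_mul {L : Subgroup G} (g : G) {l : G} (hl : l ∈ L) : pt L (g * l) = pt L g :=
  pt_eq_iff.2 ⟨rfl, by simpa using hl⟩

theorem mem_conj_iff {g x : G} {H : Subgroup G} : x ∈ conj g H ↔ g⁻¹ * x * g ∈ H := by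
  rw [conj, Subgroup.mem_pointwise_smul_iff_inv_smul_mem]
  simp [← map_inv]

theorem conj_one (H : Subgroup G) : conj 1 H = H := by simp [conj]

theorem conj_conj (g h : G) (H : Subgroup G) : conj g (conj h H) = conj (g * h) H := by
  simp [conj, smul_smul]

theorem conj_inf (g : G) (H K : Subgroup G) : conj g (H ⊓ K) = conj g H ⊓ conj g K :=
  Subgroup.smul_inf _ _ _

theorem conj_inf_inv (g : G) (L K : Subgroup G) : conj g (conj g⁻¹ L ⊓ K) = L ⊓ conj g K := by
  rw [conj_inf, conj_conj, mul_inv_cancel, conj_one]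

theorem conj_eq_self {h : G} {H : Subgroup G} (hh : h ∈ H) : conj h H = H := by
  ext x
  rw [mem_conj_iff, H.mul_mem_cancel_right hh, H.mul_mem_cancel_left (H.inv_mem hh)]

/-- The relation on cosets which consists of the pairs `(xK, xgL)`. -/
def CosetRel (K : Subgroup G) (g : G) (L : Subgroup G) (ω ω' : CosetSpace G) : Prop :=
  ∃ x, ω = pt K x ∧ ω' = pt L (x * g)

/-- The orbits of `G` on pairs of a coset of `K` and a coset of `L` are indexed by `K\G/L`; each
such relation is one orbit. -/
theorem cosetRel_pt_iff {K L : Subgroup G} {g x y : G} :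
    CosetRel K g L (pt K x) (pt L y) ↔ ∃ k ∈ K, ∃ l ∈ L, x⁻¹ * y = k * g * l := by
  constructor
  · rintro ⟨z, hx, hy⟩
    refine ⟨_, (pt_eq_iff.1 hx).2, _, (pt_eq_iff.1 hy.symm).2, by group⟩
  · rintro ⟨k, hk, l, hl, h⟩
    refine ⟨x * k, (pt_mul x hk).symm, ?_⟩
    rw [← pt_mul (x * k * g) hl]
    congr 1
    rw [inv_mul_eq_iff_eq_mul.1 h]
    simp only [mul_assoc]

theorem CosetRel.symm {K L : Subgroup G} {g : G} {ω ω' : CosetSpace G}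
    (h : CosetRel K g L ω ω') : CosetRel L g⁻¹ K ω' ω := by
  obtain ⟨x, rfl, rfl⟩ := h
  exact ⟨x * g, rfl, by simp⟩

theorem CosetRel.smul {K L : Subgroup G} {g : G} {ω ω' : CosetSpace G}
    (h : CosetRel K g L ω ω') (y : G) : CosetRel K g L (y • ω) (y • ω') := by
  obtain ⟨x, rfl, rfl⟩ := h
  exact ⟨y * x, rfl, by rw [smul_pt, mul_assoc]⟩

variable (R : Type u) [CommRing R]

open Classical in
/-- The matrix of a relation. -/
def relMatrix {X : Type*} (S : X → X → Prop) : Matrix X X R :=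
  Matrix.of fun ω ω' => if S ω ω' then 1 else 0

open Classical in
theorem relMatrix_apply {X : Type*} (S : X → X → Prop) (ω ω' : X) :
    relMatrix R S ω ω' = if S ω ω' then 1 else 0 := rfl

/-- When the intermediate point is unique, each entry of the product has at most one nonzero term,
so composing relations multiplies their matrices. -/
theorem relMatrix_mul {X : Type*} [Fintype X] {S S' S'' : X → X → Prop}
    (h : ∀ {x y z}, S x y → S' y z → S'' x z)
    (hex : ∀ {x z}, S'' x z → ∃ y, S x y ∧ S' y z)
    (huniq : ∀ {x y y' z}, S x y → S' y z → S x y' → S' y' z → y = y') :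
    relMatrix R S * relMatrix R S' = relMatrix R S'' := by
  classical
  ext x z
  rw [Matrix.mul_apply, relMatrix_apply]
  split_ifs with hS
  · obtain ⟨y, hy, hy'⟩ := hex hS
    rw [Finset.sum_eq_single y]
    · simp [relMatrix_apply, hy, hy']
    · intro y' _ hne
      simp only [relMatrix_apply]
      split_ifs with h1 h2
      · exact absurd (huniq h1 h2 hy hy') hne
      all_goals simp
    · simp
  · refine Finset.sum_eq_zero fun y _ => ?_
    simp only [relMatrix_apply]
    split_ifs with h1 h2
    · exact absurd (h h1 h2) hS
    all_goals simp

theorem finsum_relMatrix {X ι : Type*} [Finite ι] {S : ι → X → X → Prop} {S' : X → X → Prop}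
    (h : ∀ {i x z}, S i x z → S' x z) (hex : ∀ {x z}, S' x z → ∃ i, S i x z)
    (huniq : ∀ {i j x z}, S i x z → S j x z → i = j) :
    ∑ᶠ i, relMatrix R (S i) = relMatrix R S' := by
  classical
  have := Fintype.ofFinite ι
  rw [finsum_eq_sum_of_fintype]
  ext x z
  rw [Matrix.sum_apply, relMatrix_apply]
  split_ifs with hS
  · obtain ⟨i, hi⟩ := hex hS
    rw [Finset.sum_eq_single i]
    · simp [relMatrix_apply, hi]
    · intro j _ hne
      rw [relMatrix_apply, if_neg fun hj => hne (huniq hj hi)]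
    · simp
  · refine Finset.sum_eq_zero fun i _ => ?_
    rw [relMatrix_apply, if_neg fun hi => hS (h hi)]

/-- The matrix of `CosetRel`. -/
def cosetMatrix (K : Subgroup G) (g : G) (L : Subgroup G) :
    Matrix (CosetSpace G) (CosetSpace G) R :=
  relMatrix R (CosetRel K g L)

theorem transpose_cosetMatrix (K : Subgroup G) (g : G) (L : Subgroup G) :
    (cosetMatrix R K g L).transpose = cosetMatrix R L g⁻¹ K := by
  classical
  ext ω ω'
  rw [Matrix.transpose_apply, cosetMatrix, cosetMatrix, relMatrix_apply, relMatrix_apply]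
  refine if_congr ⟨CosetRel.symm, fun h => ?_⟩ rfl rfl
  simpa using h.symm

theorem cosetMatrix_congr {K L : Subgroup G} {g k l : G} (hk : k ∈ K) (hl : l ∈ L) :
    cosetMatrix R K (k * g * l) L = cosetMatrix R K g L := by
  have h : CosetRel K (k * g * l) L = CosetRel K g L := by
    funext ω ω'
    refine propext ⟨?_, ?_⟩
    · rintro ⟨x, rfl, rfl⟩
      refine ⟨x * k, (pt_mul _ hk).symm, ?_⟩
      rw [← pt_mul (x * k * g) hl]
      simp only [mul_assoc]
    · rintro ⟨x, rfl, rfl⟩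
      refine ⟨x * k⁻¹, (pt_mul _ (K.inv_mem hk)).symm, ?_⟩
      rw [← pt_mul (x * g) hl]
      congr 1
      group
  rw [cosetMatrix, h, cosetMatrix]

theorem finsum_cosetMatrix [Finite G] [DecidableEq (CosetSpace G)] :
    ∑ᶠ H : Subgroup G, cosetMatrix R H 1 H = 1 := by
  have h1 : (1 : Matrix (CosetSpace G) (CosetSpace G) R) = relMatrix R (· = ·) := by
    classical
    ext ω ω'
    rw [Matrix.one_apply, relMatrix_apply]
    congr
  rw [h1]
  refine finsum_relMatrix R ?_ ?_ ?_
  · rintro H _ _ ⟨x, rfl, rfl⟩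
    rw [mul_one]
  · rintro ω _ rfl
    obtain ⟨L, g, rfl⟩ := exists_pt ω
    exact ⟨L, g, rfl, by rw [mul_one]⟩
  · rintro H K _ _ ⟨x, rfl, rfl⟩ ⟨y, hy, -⟩
    exact (pt_eq_iff.1 hy).1

variable [Fintype (CosetSpace G)]

theorem cosetMatrix_mul_of_ne {K L L' J : Subgroup G} {g g' : G} (h : L ≠ L') :
    cosetMatrix R K g L * cosetMatrix R L' g' J = 0 := by
  have h0 : relMatrix R (fun _ _ : CosetSpace G => False) = 0 := by
    ext
    simp [relMatrix_apply]
  rw [← h0]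
  refine relMatrix_mul R ?_ (fun h => h.elim) ?_
  · rintro _ _ _ ⟨x, -, rfl⟩ ⟨y, hy, -⟩
    exact h (pt_eq_iff.1 hy).1
  · rintro _ _ _ _ ⟨x, -, rfl⟩ ⟨y, hy, -⟩
    exact absurd (pt_eq_iff.1 hy).1 h

/-- Under these inclusions the relations are graphs of the `G`-maps `xK ↦ xgL` and `xL ↦ xg'J`,
which compose. -/
theorem cosetMatrix_mul_of_le {K L J : Subgroup G} {g g' : G} (h : K ≤ conj g L)
    (h' : L ≤ conj g' J) :
    cosetMatrix R K g L * cosetMatrix R L g' J = cosetMatrix R K (g * g') J := by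
  refine relMatrix_mul R ?_ ?_ ?_
  · rintro _ _ _ ⟨x, rfl, rfl⟩ ⟨y, hy, rfl⟩
    refine ⟨x, rfl, pt_eq_iff.2 ⟨rfl, ?_⟩⟩
    have := J.inv_mem (mem_conj_iff.1 (h' (pt_eq_iff.1 hy).2))
    convert this using 1
    group
  · rintro _ _ ⟨x, rfl, rfl⟩
    exact ⟨_, ⟨x, rfl, rfl⟩, ⟨x * g, rfl, by rw [mul_assoc]⟩⟩
  · rintro _ _ _ _ ⟨x, rfl, rfl⟩ - ⟨y, hy, rfl⟩ -
    refine pt_eq_iff.2 ⟨rfl, ?_⟩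
    have := mem_conj_iff.1 (h (pt_eq_iff.1 hy).2)
    convert this using 1
    group

theorem cosetMatrix_mul_of_ge {K L J : Subgroup G} {g g' : G} (h : conj g L ≤ K)
    (h' : conj g' J ≤ L) :
    cosetMatrix R K g L * cosetMatrix R L g' J = cosetMatrix R K (g * g') J := by
  have key : ∀ (g : G) {K L : Subgroup G}, conj g L ≤ K → L ≤ conj g⁻¹ K := by
    intro g K L h
    rw [← conj_one L, ← inv_mul_cancel g, ← conj_conj]
    exact conj_mono _ h
  apply Matrix.transpose_injective
  rw [Matrix.transpose_mul, transpose_cosetMatrix, transpose_cosetMatrix, transpose_cosetMatrix,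
    cosetMatrix_mul_of_le R (key _ h') (key _ h), mul_inv_rev]

/-- The stabilizer of the pair `(K, gL)` is `K ∩ ᵍL`, so each related pair comes from a unique coset
of this intersection. -/
theorem cosetMatrix_mul_inf {K L : Subgroup G} (g : G) :
    cosetMatrix R K 1 (K ⊓ conj g L) * cosetMatrix R (K ⊓ conj g L) g L = cosetMatrix R K g L := by
  refine relMatrix_mul R ?_ ?_ ?_
  · rintro _ _ _ ⟨x, rfl, rfl⟩ ⟨y, hy, rfl⟩
    refine ⟨y, pt_eq_iff.2 ⟨rfl, ?_⟩, rfl⟩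
    simpa using (pt_eq_iff.1 hy).2.1
  · rintro _ _ ⟨x, rfl, rfl⟩
    exact ⟨_, ⟨x, rfl, rfl⟩, ⟨x, by rw [mul_one], rfl⟩⟩
  · rintro _ _ _ _ ⟨x, rfl, rfl⟩ ⟨y, hy, rfl⟩ ⟨x', hx, rfl⟩ ⟨y', hy', h⟩
    rw [hy, hy']
    have h1 := (pt_eq_iff.1 hx).2
    have h2 : (x * 1)⁻¹ * y ∈ K := (pt_eq_iff.1 hy).2.1
    have h3 : (x' * 1)⁻¹ * y' ∈ K := (pt_eq_iff.1 hy').2.1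
    have h4 := (pt_eq_iff.1 h).2
    refine pt_eq_iff.2 ⟨rfl, show y⁻¹ * y' ∈ K from ?_, mem_conj_iff.2 ?_⟩
    · have := K.mul_mem (K.mul_mem (K.inv_mem h2) h1) h3
      convert this using 1
      group
    · convert h4 using 1
      group

theorem cosetMatrix_triple {K L : Subgroup G} (g : G) :
    cosetMatrix R K 1 (K ⊓ conj g L) *
      cosetMatrix R (conj g (conj g⁻¹ K ⊓ L)) g (conj g⁻¹ K ⊓ L) *
        cosetMatrix R (conj g⁻¹ K ⊓ L) 1 L = cosetMatrix R K g L := by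
  rw [mul_assoc, cosetMatrix_mul_of_le R le_rfl (by rw [conj_one]; exact inf_le_right), mul_one,
    conj_inf_inv, cosetMatrix_mul_inf]

/-- Passing through `G/H` relates `xL` to `xhK` for all `h ∈ H`, with `xH` as the only intermediate
coset. This relation is the disjoint union of the relations of the double cosets in `L\H/K`. -/
theorem cosetMatrix_mackey {L H K : Subgroup G} [Finite G] (hL : L ≤ H) (hK : K ≤ H) :
    cosetMatrix R L 1 H * cosetMatrix R H 1 K =
      ∑ᶠ D : DoubleCoset.Quotient (L.subgroupOf H : Set H) (K.subgroupOf H : Set H),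
        cosetMatrix R L (D.out : G) K := by
  have h1 : cosetMatrix R L 1 H * cosetMatrix R H 1 K =
      relMatrix R (fun ω ω' => ∃ x, ∃ h ∈ H, ω = pt L x ∧ ω' = pt K (x * h)) := by
    refine relMatrix_mul R ?_ ?_ ?_
    · rintro _ _ _ ⟨x, rfl, rfl⟩ ⟨y, hy, rfl⟩
      have := (pt_eq_iff.1 hy).2
      refine ⟨x, _, this, rfl, ?_⟩
      congr 1
      group
    · rintro _ _ ⟨x, h, hh, rfl, rfl⟩
      exact ⟨_, ⟨x, rfl, rfl⟩, ⟨x * h, by rw [pt_mul x hh, mul_one], by rw [mul_one]⟩⟩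
    · rintro _ _ _ _ ⟨x, rfl, rfl⟩ - ⟨y, hy, rfl⟩ -
      refine pt_eq_iff.2 ⟨rfl, ?_⟩
      simpa using hL (pt_eq_iff.1 hy).2
  have : Finite (DoubleCoset.Quotient (L.subgroupOf H : Set H) (K.subgroupOf H : Set H)) :=
    Quotient.finite _
  rw [h1]
  refine (finsum_relMatrix R ?_ ?_ ?_).symm
  · rintro D _ _ ⟨x, rfl, rfl⟩
    exact ⟨x, _, D.out.2, rfl, rfl⟩
  · rintro _ _ ⟨x, h, hh, rfl, rfl⟩
    refine ⟨DoubleCoset.mk _ _ ⟨h, hh⟩, ?_⟩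
    obtain ⟨a, b, ha, hb, hab⟩ := DoubleCoset.mk_out_eq_mul (L.subgroupOf H) (K.subgroupOf H)
      ⟨h, hh⟩
    refine cosetRel_pt_iff.2 ⟨a⁻¹, L.inv_mem ha, b⁻¹, K.inv_mem hb, ?_⟩
    have : ((DoubleCoset.mk (L.subgroupOf H) (K.subgroupOf H) ⟨h, hh⟩).out : G) = a * h * b :=
      congrArg Subtype.val hab
    rw [this]
    group
  · rintro D E _ _ ⟨x, rfl, rfl⟩ h
    obtain ⟨k, hk, l, hl, h⟩ := cosetRel_pt_iff.1 h
    rw [← DoubleCoset.out_eq' _ _ D, ← DoubleCoset.out_eq' _ _ E]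
    refine ((DoubleCoset.eq _ _ _ _).2 ⟨⟨k, hL hk⟩, hk, ⟨l, hK hl⟩, hl, Subtype.ext ?_⟩).symm
    simpa using h

theorem cosetMatrix_cohomological {H K : Subgroup G} [Finite G] (h : K ≤ H) :
    cosetMatrix R H 1 K * cosetMatrix R K 1 H = (K.relIndex H : R) • cosetMatrix R H 1 H := by
  classical
  ext ω ω''
  rw [Matrix.mul_apply, Matrix.smul_apply]
  simp only [cosetMatrix, relMatrix_apply, mul_ite, mul_one, mul_zero, smul_eq_mul, ← ite_and]
  split_ifs with hS
  · obtain ⟨x, rfl, rfl⟩ := hS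
    have := Fintype.ofFinite (H ⧸ K.subgroupOf H)
    -- The entry counts the cosets of `K` contained in `xH`, which `f` enumerates by `H/K`; this is
    -- the index.
    let f : H ⧸ K.subgroupOf H → CosetSpace G := fun q => pt K (x * q.out)
    have hf : Function.Injective f := by
      intro q q' h
      rw [← QuotientGroup.out_eq' q, ← QuotientGroup.out_eq' q', QuotientGroup.eq]
      have := (pt_eq_iff.1 h).2
      rw [Subgroup.mem_subgroupOf]
      convert this using 1
      simp
    rw [Finset.sum_boole, Subgroup.relIndex, Subgroup.index, Nat.card_eq_fintype_card,
      ← Finset.card_univ, ← Finset.card_image_of_injective _ hf]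
    congr 2
    ext ω'
    simp only [Finset.mem_filter, Finset.mem_univ, true_and, Finset.mem_image]
    constructor
    · rintro ⟨⟨y, rfl, hy⟩, -⟩
      have hy' : x⁻¹ * y ∈ H := by simpa using (pt_eq_iff.1 hy).2
      refine ⟨QuotientGroup.mk ⟨x⁻¹ * y, hy'⟩, ?_⟩
      have := QuotientGroup.out_eq' (QuotientGroup.mk (s := K.subgroupOf H) ⟨x⁻¹ * y, hy'⟩)
      rw [QuotientGroup.eq, Subgroup.mem_subgroupOf] at this
      refine pt_eq_iff.2 ⟨rfl, ?_⟩
      convert this using 1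
      simp [mul_assoc]
    · rintro ⟨q, rfl⟩
      have hq : pt H (x * (q.out : G)) = pt H x := pt_mul x q.out.2
      exact ⟨⟨_, rfl, by rw [mul_one, mul_one, hq]⟩, ⟨_, hq.symm, by rw [mul_one]⟩⟩
  · refine Finset.sum_eq_zero fun ω' _ => if_neg ?_
    rintro ⟨⟨y, rfl, rfl⟩, ⟨x, rfl, hx⟩⟩
    refine hS ⟨x, rfl, ?_⟩
    have := (pt_eq_iff.1 hx).2
    rw [mul_one] at this
    exact pt_eq_iff.2 ⟨rfl, by simpa using h this⟩

end CosetMatrices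

/-! ### A spanning set of the cohomological Mackey algebra -/

section Generators

theorem finite_doubleCosetQuotient {K : Type*} [Group K] [Finite K] (s t : Set K) :
    Finite (DoubleCoset.Quotient s t) := Quotient.finite _

variable (R : Type u) [CommRing R] {G : Type u} [Group G]

open Classical in
/-- The generator `t^K_H` of `coμ_R(G)`, or `0` if `H` is not contained in `K`. -/
def coT (K H : Subgroup G) : CoMackeyAlgebra R G :=
  if h : H ≤ K then coGen R (.t K H h) else 0

open Classical in
/-- The generator `r^K_H` of `coμ_R(G)`, or `0` if `H` is not contained in `K`. -/
def coR (K H : Subgroup G) : CoMackeyAlgebra R G :=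
  if h : H ≤ K then coGen R (.r K H h) else 0

/-- The generator `c_{g,H}` of `coμ_R(G)`. -/
def coC (g : G) (H : Subgroup G) : CoMackeyAlgebra R G := coGen R (.c g H)

theorem coT_eq {K H : Subgroup G} (h : H ≤ K) : coT R K H = coGen R (.t K H h) := dif_pos h

theorem coR_eq {K H : Subgroup G} (h : H ≤ K) : coR R K H = coGen R (.r K H h) := dif_pos h

variable (G) in
/-- The projection from the free algebra. -/
def coProj : FreeAlgebra R (Gen G) →ₐ[R] CoMackeyAlgebra R G :=
  (RingQuot.mkAlgHom R (CohomologicalRel R (G := G))).comp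
    (RingQuot.mkAlgHom R (MackeyRel R (G := G)))

theorem coProj_surjective : Function.Surjective (coProj R G) :=
  (RingQuot.mkAlgHom_surjective R _).comp (RingQuot.mkAlgHom_surjective R _)

theorem coProj_rel {x y : FreeAlgebra R (Gen G)} (h : MackeyRel R x y) :
    coProj R G x = coProj R G y :=
  congrArg (RingQuot.mkAlgHom R (CohomologicalRel R (G := G))) (RingQuot.mkAlgHom_rel R h)

theorem sum_coT_self [Finite G] : ∑ᶠ H : Subgroup G, coT R H H = 1 := by
  have h := coProj_rel R (MackeyRel.one (R := R) (G := G))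
  rw [map_one, map_finsum (coProj R G) (Set.toFinite _)] at h
  rw [← h]
  exact finsum_congr fun H => coT_eq R le_rfl

theorem coT_self_eq_coR (H : Subgroup G) : coT R H H = coR R H H := by
  rw [coT_eq R le_rfl, coR_eq R le_rfl]
  exact coProj_rel R (.t_self H)

theorem coC_of_mem {H : Subgroup G} {h : G} (hh : h ∈ H) : coC R h H = coT R H H := by
  rw [coT_eq R le_rfl]
  exact coProj_rel R (.c_self H h hh)

theorem coT_mul_coT {H K L : Subgroup G} (h₁ : H ≤ K) (h₂ : K ≤ L) :
    coT R L K * coT R K H = coT R L H := by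
  rw [coT_eq R h₁, coT_eq R h₂, coT_eq R (h₁.trans h₂)]
  have := coProj_rel R (.t_t H K L h₁ h₂)
  rwa [map_mul] at this

theorem coR_mul_coR {H K L : Subgroup G} (h₁ : H ≤ K) (h₂ : K ≤ L) :
    coR R K H * coR R L K = coR R L H := by
  rw [coR_eq R h₁, coR_eq R h₂, coR_eq R (h₁.trans h₂)]
  have := coProj_rel R (.r_r H K L h₁ h₂)
  rwa [map_mul] at this

theorem coC_mul_coC (H : Subgroup G) (g g' : G) :
    coC R g' (conj g H) * coC R g H = coC R (g' * g) H := by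
  have := coProj_rel R (.c_c H g g')
  rwa [map_mul] at this

theorem coT_mul_coC {H K : Subgroup G} (h : H ≤ K) (g : G) :
    coT R (conj g K) (conj g H) * coC R g H = coC R g K * coT R K H := by
  rw [coT_eq R h, coT_eq R (conj_mono g h)]
  have := coProj_rel R (.t_c H K h g)
  rwa [map_mul, map_mul] at this

theorem coR_mul_coC {H K : Subgroup G} (h : H ≤ K) (g : G) :
    coR R (conj g K) (conj g H) * coC R g K = coC R g H * coR R K H := by
  rw [coR_eq R h, coR_eq R (conj_mono g h)]
  have := coProj_rel R (.r_c H K h g)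
  rwa [map_mul, map_mul] at this

theorem coR_mul_coT [Finite G] {L H K : Subgroup G} (hL : L ≤ H) (hK : K ≤ H) :
    coR R H L * coT R H K =
      ∑ᶠ D : DoubleCoset.Quotient (L.subgroupOf H : Set H) (K.subgroupOf H : Set H),
        coT R L (L ⊓ conj (D.out : G) K) * coC R (D.out : G) (conj (D.out : G)⁻¹ L ⊓ K) *
          coR R K (conj (D.out : G)⁻¹ L ⊓ K) := by
  have := finite_doubleCosetQuotient (L.subgroupOf H : Set H) (K.subgroupOf H : Set H)
  have h := coProj_rel R (.mackey L H K hL hK)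
  rw [map_mul, map_finsum (coProj R G) (Set.toFinite _)] at h
  rw [coR_eq R hL, coT_eq R hK]
  refine h.trans (finsum_congr fun D => ?_)
  rw [map_mul, map_mul, coT_eq R inf_le_left, coR_eq R inf_le_right]
  rfl

theorem coT_mul_coR {H K : Subgroup G} (h : K ≤ H) :
    coT R H K * coR R H K = (K.relIndex H : R) • coT R H H := by
  rw [coT_eq R h, coR_eq R h, coT_eq R le_rfl]
  have := RingQuot.mkAlgHom_rel R (CohomologicalRel.rel (R := R) H K h)
  rwa [map_mul, map_smul] at this

theorem coGen_mul_of_ne {x y : Gen G} (h : x.right ≠ y.left) : coGen R x * coGen R y = 0 := by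
  have := coProj_rel R (.zero x y h)
  rwa [map_mul, map_zero] at this

theorem coC_mul_coT_self (g : G) (H : Subgroup G) : coC R g H * coT R H H = coC R g H := by
  rw [← coC_of_mem R H.one_mem]
  have := coC_mul_coC R H 1 g
  rwa [conj_one, mul_one] at this

/-- The elements `t^K_{ᵍZ} c_{g,Z} r^L_Z`. -/
def coElem (K : Subgroup G) (g : G) (Z L : Subgroup G) : CoMackeyAlgebra R G :=
  coT R K (conj g Z) * coC R g Z * coR R L Z

/-- The elements `t^K_{K ∩ ᵍL} c_{g,K ∩ ᵍL} r^L_{Kᵍ ∩ L}`. -/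
def coBasis (K : Subgroup G) (g : G) (L : Subgroup G) : CoMackeyAlgebra R G :=
  coElem R K g (conj g⁻¹ K ⊓ L) L

theorem conj_le_of_le {K Z L : Subgroup G} {g : G} (h : Z ≤ conj g⁻¹ K ⊓ L) : conj g Z ≤ K :=
  (conj_mono g h).trans ((conj_inf_inv g K L).trans_le inf_le_left)

theorem le_conj_inv {K Z : Subgroup G} {g : G} (h : conj g Z ≤ K) : Z ≤ conj g⁻¹ K := by
  rw [← conj_one Z, ← inv_mul_cancel g, ← conj_conj]
  exact conj_mono _ h

/-- Transfer and restriction both factor through the largest admissible subgroup `Y = Kᵍ ∩ L`.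
Commuting `c_g` past the transfer leaves `t^Y_Z r^Y_Z`, which the cohomological relation replaces by
the index `|Y : Z|`. -/
theorem coElem_eq_smul_coBasis {K Z L : Subgroup G} {g : G} (hK : conj g Z ≤ K) (hL : Z ≤ L) :
    coElem R K g Z L = (Z.relIndex (conj g⁻¹ K ⊓ L) : R) • coBasis R K g L := by
  set Y := conj g⁻¹ K ⊓ L with hY
  have hZ : Z ≤ Y := le_inf (le_conj_inv hK) hL
  have hYK : conj g Y ≤ K := conj_le_of_le hY.le
  rw [coBasis, ← hY, coElem, coElem, ← coT_mul_coT R (conj_mono g hZ) hYK,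
    ← coR_mul_coR R hZ (inf_le_right : Y ≤ L)]
  calc _ = coT R K (conj g Y) * (coT R (conj g Y) (conj g Z) * coC R g Z) *
        (coR R Y Z * coR R L Y) := by simp only [mul_assoc]
    _ = coT R K (conj g Y) * coC R g Y * (coT R Y Z * coR R Y Z) * coR R L Y := by
        rw [coT_mul_coC R hZ]; simp only [mul_assoc]
    _ = _ := by
        rw [coT_mul_coR R hZ, mul_smul_comm, smul_mul_assoc, mul_assoc _ (coC R g Y),
          coC_mul_coT_self]

variable (G) in
/-- The span of the elements `t^K_{ᵍZ} c_{g,Z} r^L_Z`. -/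
def coSpan : Submodule R (CoMackeyAlgebra R G) :=
  Submodule.span R {a | ∃ K g Z L, conj g Z ≤ K ∧ Z ≤ L ∧ a = coElem R K g Z L}

theorem coElem_mem_coSpan {K Z L : Subgroup G} {g : G} (hK : conj g Z ≤ K) (hL : Z ≤ L) :
    coElem R K g Z L ∈ coSpan R G := Submodule.subset_span ⟨K, g, Z, L, hK, hL, rfl⟩

/-- The Mackey formula expands the product of restriction and transfer; in each term the new
restriction moves past `c_g`, giving again the shape `t c r`. -/
theorem coR_mul_coElem_mem [Finite G] {J K Z L : Subgroup G} {g : G} (hJ : J ≤ K)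
    (hK : conj g Z ≤ K) (hL : Z ≤ L) : coR R K J * coElem R K g Z L ∈ coSpan R G := by
  rw [coElem, ← mul_assoc, ← mul_assoc, coR_mul_coT R hJ hK]
  have := finite_doubleCosetQuotient (J.subgroupOf K : Set K)
    ((conj g Z).subgroupOf K : Set K)
  have := Fintype.ofFinite (DoubleCoset.Quotient (J.subgroupOf K : Set K)
    ((conj g Z).subgroupOf K : Set K))
  rw [finsum_eq_sum_of_fintype, Finset.sum_mul, Finset.sum_mul]
  refine Submodule.sum_mem _ fun D _ => ?_
  set d : G := Subtype.val (Quotient.out D)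
  -- The intersection produced by the Mackey formula, pulled back along `g` to a subgroup of `Z`.
  set W := conj g⁻¹ (conj d⁻¹ J ⊓ conj g Z) with hW
  have hW1 : conj d⁻¹ J ⊓ conj g Z = conj g W := by
    rw [hW, conj_conj, mul_inv_cancel, conj_one]
  have hWZ : W ≤ Z := by
    rw [hW, conj_inf, conj_conj g⁻¹ g, inv_mul_cancel, conj_one]
    exact inf_le_right
  have hW2 : J ⊓ conj d (conj g Z) = conj (d * g) W := by
    rw [← conj_conj, ← hW1, conj_inf_inv]
  rw [hW1, hW2]
  have : coT R J (conj (d * g) W) * coC R d (conj g W) * coR R (conj g Z) (conj g W) * coC R g Z *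
      coR R L Z = coElem R J (d * g) W L := by
    calc _ = coT R J (conj (d * g) W) * coC R d (conj g W) *
          (coR R (conj g Z) (conj g W) * coC R g Z) * coR R L Z := by simp only [mul_assoc]
      _ = coT R J (conj (d * g) W) * (coC R d (conj g W) * coC R g W) *
          (coR R Z W * coR R L Z) := by rw [coR_mul_coC R hWZ]; simp only [mul_assoc]
      _ = _ := by rw [coC_mul_coC, coR_mul_coR R hWZ hL, coElem]
  rw [this]
  exact coElem_mem_coSpan R (by rw [← hW2]; exact inf_le_left) (hWZ.trans hL)

theorem coGen_mul_mem [Finite G] (x : Gen G) {a : CoMackeyAlgebra R G} (ha : a ∈ coSpan R G) :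
    coGen R x * a ∈ coSpan R G := by
  induction ha using Submodule.span_induction with
  | zero => rw [mul_zero]; exact Submodule.zero_mem _
  | add a b _ _ ha hb => rw [mul_add]; exact Submodule.add_mem _ ha hb
  | smul r a _ ha => rw [mul_smul_comm]; exact Submodule.smul_mem _ _ ha
  | mem a ha =>
    obtain ⟨K, g, Z, L, hK, hL, rfl⟩ := ha
    by_cases hx : x.right = K
    · subst hx
      cases x with
      | t M K h =>
        change conj g Z ≤ K at hK
        change _ * coElem R K g Z L ∈ _
        rw [coElem, ← mul_assoc, ← mul_assoc, ← coT_eq R h, coT_mul_coT R hK h]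
        exact coElem_mem_coSpan R (hK.trans h) hL
      | r K J h =>
        rw [← coR_eq R h]
        exact coR_mul_coElem_mem R h hK hL
      | c h K =>
        change conj g Z ≤ K at hK
        have : coC R h K * coElem R K g Z L = coElem R (conj h K) (h * g) Z L := by
          calc _ = coC R h K * coT R K (conj g Z) * coC R g Z * coR R L Z := by
                rw [coElem]; simp only [mul_assoc]
            _ = coT R (conj h K) (conj h (conj g Z)) * (coC R h (conj g Z) * coC R g Z) *
                coR R L Z := by rw [← coT_mul_coC R hK]; simp only [mul_assoc]
            _ = _ := by rw [coC_mul_coC, conj_conj, coElem]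
        change coC R h K * coElem R K g Z L ∈ _
        rw [this]
        exact coElem_mem_coSpan R (by rw [← conj_conj]; exact conj_mono h hK) hL
    · rw [coElem, ← mul_assoc, ← mul_assoc, coT_eq R hK, coGen_mul_of_ne R hx, zero_mul, zero_mul]
      exact Submodule.zero_mem _

theorem one_mem_coSpan [Finite G] : (1 : CoMackeyAlgebra R G) ∈ coSpan R G := by
  have := Fintype.ofFinite (Subgroup G)
  rw [← sum_coT_self, finsum_eq_sum_of_fintype]
  refine Submodule.sum_mem _ fun H _ => ?_
  have h : coT R H H = coElem R H 1 H H := by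
    rw [coElem, coC_of_mem R H.one_mem, conj_one, ← coT_self_eq_coR, coT_mul_coT R le_rfl le_rfl,
      coT_mul_coT R le_rfl le_rfl]
  rw [h]
  exact coElem_mem_coSpan R (conj_one H).le le_rfl

theorem coSpan_eq_top [Finite G] : coSpan R G = ⊤ := by
  -- The span is stable under left multiplication by generators and contains `1`, hence is
  -- everything. Keeping `y` arbitrary makes the product case of the induction immediate.
  have key : ∀ (a : FreeAlgebra R (Gen G)) (y : CoMackeyAlgebra R G), y ∈ coSpan R G →
      coProj R G a * y ∈ coSpan R G := by
    intro a
    induction a using FreeAlgebra.induction with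
    | grade0 r =>
      intro y hy
      rw [AlgHom.commutes, ← Algebra.smul_def]
      exact Submodule.smul_mem _ _ hy
    | grade1 x => exact fun y hy => coGen_mul_mem R x hy
    | mul a b ha hb =>
      intro y hy
      rw [map_mul, mul_assoc]
      exact ha _ (hb _ hy)
    | add a b ha hb =>
      intro y hy
      rw [map_add, add_mul]
      exact Submodule.add_mem _ (ha _ hy) (hb _ hy)
  rw [eq_top_iff]
  rintro x -
  obtain ⟨a, rfl⟩ := coProj_surjective R x
  simpa using key a 1 (one_mem_coSpan R)

/-- The elements `t^K_{K ∩ ᵍL} c_g r^L_{Kᵍ ∩ L}` span `coμ_R(G)`. -/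
theorem span_coBasis [Finite G] :
    Submodule.span R {a | ∃ K g L, a = coBasis (G := G) R K g L} = ⊤ := by
  rw [← top_le_iff, ← coSpan_eq_top, coSpan, Submodule.span_le]
  rintro _ ⟨K, g, Z, L, hK, hL, rfl⟩
  rw [coElem_eq_smul_coBasis R hK hL]
  exact Submodule.smul_mem _ _ (Submodule.subset_span ⟨K, g, L, rfl⟩)

theorem coT_mul_coC_mul {K Z : Subgroup G} {k g : G} (hk : k ∈ K) (hZ : conj g Z ≤ K) :
    coT R K (conj (k * g) Z) * coC R (k * g) Z = coT R K (conj g Z) * coC R g Z := by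
  rw [← coC_mul_coC, ← mul_assoc, ← conj_conj]
  have h := coT_mul_coC R hZ k
  rw [conj_eq_self hk, coC_of_mem R hk, coT_mul_coT R hZ le_rfl] at h
  rw [h]

theorem coC_mul_coR_mul {L Z : Subgroup G} {l g : G} (hl : l ∈ L) (hZ : Z ≤ L) :
    coC R (g * l) (conj l⁻¹ Z) * coR R L (conj l⁻¹ Z) = coC R g Z * coR R L Z := by
  have h := coR_mul_coC R (H := conj l⁻¹ Z) (K := L)
    (by rw [← conj_eq_self (L.inv_mem hl)]; exact conj_mono _ hZ) l
  rw [conj_conj, mul_inv_cancel, conj_one, conj_eq_self hl, coC_of_mem R hl, coT_self_eq_coR,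
    coR_mul_coR R hZ le_rfl] at h
  rw [h, ← mul_assoc]
  congr 1
  have := coC_mul_coC R (conj l⁻¹ Z) l g
  rwa [conj_conj, mul_inv_cancel, conj_one, eq_comm] at this

/-- The element `t^K_{K ∩ ᵍL} c_g r^L_{Kᵍ ∩ L}` only depends on the double coset of `g`. -/
theorem coBasis_congr {K L : Subgroup G} {k g l : G} (hk : k ∈ K) (hl : l ∈ L) :
    coBasis R K (k * g * l) L = coBasis R K g L := by
  have h1 : conj (k * g * l)⁻¹ K ⊓ L = conj l⁻¹ (conj g⁻¹ K ⊓ L) := by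
    rw [conj_inf, conj_eq_self (L.inv_mem hl), conj_conj, mul_inv_rev, mul_inv_rev, ← mul_assoc,
      ← conj_conj, conj_eq_self (K.inv_mem hk)]
  have h2 : conj (k * g * l) (conj l⁻¹ (conj g⁻¹ K ⊓ L)) = conj (k * g) (conj g⁻¹ K ⊓ L) := by
    rw [conj_conj, mul_inv_cancel_right]
  rw [coBasis, coBasis, coElem, coElem, h1, h2, mul_assoc, coC_mul_coR_mul R hl inf_le_right,
    ← mul_assoc, coT_mul_coC_mul R hk (conj_le_of_le le_rfl)]

end Generators

/-! ### The faithful matrix representation on cosets -/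

section Yoshida

variable {G : Type u} [Group G]

/-- Every pair of cosets is a translate of `(K, gL)` with `g` the chosen representative of its
double coset. -/
theorem invariant_ext {X : Type*} {N N' : Matrix (CosetSpace G) (CosetSpace G) X}
    (h : ∀ (g : G) ω ω', N (g • ω) (g • ω') = N ω ω')
    (h' : ∀ (g : G) ω ω', N' (g • ω) (g • ω') = N' ω ω')
    (heq : ∀ (K L : Subgroup G) (D : DoubleCoset.Quotient (K : Set G) L),
      N (pt K 1) (pt L D.out) = N' (pt K 1) (pt L D.out)) : N = N' := by
  ext ω ω'
  obtain ⟨K, x, rfl⟩ := exists_pt ω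
  obtain ⟨L, y, rfl⟩ := exists_pt ω'
  obtain ⟨k, l, hk, hl, hD⟩ := DoubleCoset.mk_out_eq_mul K L (x⁻¹ * y)
  have h1 : pt K x = (x * k⁻¹) • pt K 1 := by
    rw [smul_pt, mul_one, pt_mul _ (K.inv_mem hk)]
  have h2 : pt L y = (x * k⁻¹) • pt L (DoubleCoset.mk K L (x⁻¹ * y)).out := by
    rw [hD, smul_pt, ← mul_assoc, pt_mul _ hl]
    congr 1
    group
  rw [h1, h2, h, h', heq]

variable (R : Type u) [CommRing R]

instance decidableEqCosetSpace : DecidableEq (CosetSpace G) := Classical.decEq _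

instance fintypeCosetSpace [Finite G] : Fintype (CosetSpace G) := Fintype.ofFinite _

/-- The matrix of a generator of the Mackey algebra. -/
def genMatrix : Gen G → Matrix (CosetSpace G) (CosetSpace G) R
  | .t K H _ => cosetMatrix R K 1 H
  | .r K H _ => cosetMatrix R H 1 K
  | .c g H => cosetMatrix R (conj g H) g H

theorem exists_genMatrix_eq (x : Gen G) : ∃ g, genMatrix R x = cosetMatrix R x.left g x.right := by
  cases x
  exacts [⟨1, rfl⟩, ⟨1, rfl⟩, ⟨_, rfl⟩]

theorem cosetMatrix_self {H : Subgroup G} {h : G} (hh : h ∈ H) :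
    cosetMatrix R H h H = cosetMatrix R H 1 H := by
  have := cosetMatrix_congr R (K := H) (L := H) (g := 1) hh H.one_mem
  rwa [mul_one, mul_one] at this

theorem coBasis_eq (K L : Subgroup G) (g : G) :
    coBasis R K g L = coGen R (.t K (K ⊓ conj g L) inf_le_left) *
      coGen R (.c g (conj g⁻¹ K ⊓ L)) * coGen R (.r L (conj g⁻¹ K ⊓ L) inf_le_right) := by
  rw [← coT_eq, ← coR_eq, coBasis, coElem, conj_inf_inv]
  rfl

theorem cosetRel_out_iff {K L : Subgroup G} {g : G} {D : DoubleCoset.Quotient (K : Set G) L} :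
    CosetRel K g L (pt K 1) (pt L D.out) ↔ D = DoubleCoset.mk K L g := by
  rw [cosetRel_pt_iff, ← DoubleCoset.out_eq' K L D, eq_comm, DoubleCoset.eq, DoubleCoset.out_eq']
  simp

variable [Finite G]

/-- The representation of the free algebra by matrices. -/
def freeMatrix : FreeAlgebra R (Gen G) →ₐ[R] Matrix (CosetSpace G) (CosetSpace G) R :=
  FreeAlgebra.lift R (genMatrix R)

theorem freeMatrix_ι (x : Gen G) : freeMatrix R (FreeAlgebra.ι R x) = genMatrix R x :=
  FreeAlgebra.lift_ι_apply _ _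

theorem freeMatrix_rel {x y : FreeAlgebra R (Gen G)} (h : MackeyRel R x y) :
    freeMatrix R x = freeMatrix R y := by
  induction h with
  | one =>
    rw [map_finsum (freeMatrix R) (Set.toFinite _), map_one, ← finsum_cosetMatrix]
    exact finsum_congr fun H => freeMatrix_ι R _
  | t_self H => rw [freeMatrix_ι, freeMatrix_ι]; rfl
  | c_self H h hh =>
    rw [freeMatrix_ι, freeMatrix_ι]
    change cosetMatrix R (conj h H) h H = cosetMatrix R H 1 H
    rw [conj_eq_self hh, cosetMatrix_self R hh]
  | t_t H K L h₁ h₂ =>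
    rw [map_mul, freeMatrix_ι, freeMatrix_ι, freeMatrix_ι]
    change cosetMatrix R L 1 K * cosetMatrix R K 1 H = cosetMatrix R L 1 H
    rw [cosetMatrix_mul_of_ge R (by rwa [conj_one]) (by rwa [conj_one]), mul_one]
  | r_r H K L h₁ h₂ =>
    rw [map_mul, freeMatrix_ι, freeMatrix_ι, freeMatrix_ι]
    change cosetMatrix R H 1 K * cosetMatrix R K 1 L = cosetMatrix R H 1 L
    rw [cosetMatrix_mul_of_le R (by rwa [conj_one]) (by rwa [conj_one]), mul_one]
  | c_c H g g' =>
    rw [map_mul, freeMatrix_ι, freeMatrix_ι, freeMatrix_ι]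
    change cosetMatrix R (conj g' (conj g H)) g' (conj g H) * cosetMatrix R (conj g H) g H =
      cosetMatrix R (conj (g' * g) H) (g' * g) H
    rw [cosetMatrix_mul_of_le R le_rfl le_rfl, conj_conj]
  | t_c H K h g =>
    rw [map_mul, map_mul, freeMatrix_ι, freeMatrix_ι, freeMatrix_ι, freeMatrix_ι]
    change cosetMatrix R (conj g K) 1 (conj g H) * cosetMatrix R (conj g H) g H =
      cosetMatrix R (conj g K) g K * cosetMatrix R K 1 H
    rw [cosetMatrix_mul_of_ge R (by rw [conj_one]; exact conj_mono g h) le_rfl,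
      cosetMatrix_mul_of_ge R le_rfl (by rwa [conj_one]), mul_one, one_mul]
  | r_c H K h g =>
    rw [map_mul, map_mul, freeMatrix_ι, freeMatrix_ι, freeMatrix_ι, freeMatrix_ι]
    change cosetMatrix R (conj g H) 1 (conj g K) * cosetMatrix R (conj g K) g K =
      cosetMatrix R (conj g H) g H * cosetMatrix R H 1 K
    rw [cosetMatrix_mul_of_le R (by rw [conj_one]; exact conj_mono g h) le_rfl,
      cosetMatrix_mul_of_le R le_rfl (by rwa [conj_one]), mul_one, one_mul]
  | mackey L H K hL hK =>
    have := finite_doubleCosetQuotient (L.subgroupOf H : Set H) (K.subgroupOf H : Set H)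
    rw [map_finsum (freeMatrix R) (Set.toFinite _), map_mul, freeMatrix_ι, freeMatrix_ι]
    change cosetMatrix R L 1 H * cosetMatrix R H 1 K = _
    rw [cosetMatrix_mackey R hL hK]
    refine finsum_congr fun D => ?_
    rw [map_mul, map_mul, freeMatrix_ι, freeMatrix_ι, freeMatrix_ι]
    exact (cosetMatrix_triple R _).symm
  | zero x y h =>
    rw [map_mul, map_zero, freeMatrix_ι, freeMatrix_ι]
    obtain ⟨g, hg⟩ := exists_genMatrix_eq R x
    obtain ⟨g', hg'⟩ := exists_genMatrix_eq R y
    rw [hg, hg', cosetMatrix_mul_of_ne R h]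

/-- The representation of the Mackey algebra by matrices. -/
def mackeyMatrix : MackeyAlgebra R G →ₐ[R] Matrix (CosetSpace G) (CosetSpace G) R :=
  RingQuot.liftAlgHom R ⟨freeMatrix R, fun _ _ => freeMatrix_rel R⟩

theorem mackeyMatrix_gen (x : Gen G) : mackeyMatrix R (mackeyGen R x) = genMatrix R x :=
  (RingQuot.liftAlgHom_mkAlgHom_apply _ _ _ _).trans (freeMatrix_ι R x)

theorem mackeyMatrix_rel {x y : MackeyAlgebra R G} (h : CohomologicalRel R x y) :
    mackeyMatrix R x = mackeyMatrix R y := by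
  induction h with
  | rel H K h =>
    rw [map_mul, map_smul, mackeyMatrix_gen, mackeyMatrix_gen, mackeyMatrix_gen]
    exact cosetMatrix_cohomological R h

/-- The representation of `coμ_R(G)` by matrices indexed by the cosets of the subgroups. -/
def coMatrix : CoMackeyAlgebra R G →ₐ[R] Matrix (CosetSpace G) (CosetSpace G) R :=
  RingQuot.liftAlgHom R ⟨mackeyMatrix R, fun _ _ => mackeyMatrix_rel R⟩

theorem coMatrix_gen (x : Gen G) : coMatrix R (coGen R x) = genMatrix R x :=
  (RingQuot.liftAlgHom_mkAlgHom_apply _ _ _ _).trans (mackeyMatrix_gen R x)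

theorem coMatrix_coBasis (K L : Subgroup G) (g : G) :
    coMatrix R (coBasis R K g L) = cosetMatrix R K g L := by
  rw [coBasis_eq, map_mul, map_mul, coMatrix_gen, coMatrix_gen, coMatrix_gen]
  exact cosetMatrix_triple R g

/-- The linear combination of the elements `coBasis` with the coefficients in a matrix. -/
def ofMatrix : Matrix (CosetSpace G) (CosetSpace G) R →ₗ[R] CoMackeyAlgebra R G :=
  letI := fun K L : Subgroup G => @Fintype.ofFinite _
    (finite_doubleCosetQuotient (K : Set G) (L : Set G))
  letI := Fintype.ofFinite (Subgroup G)
  ∑ K : Subgroup G, ∑ L : Subgroup G, ∑ D : DoubleCoset.Quotient (K : Set G) (L : Set G),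
    (Matrix.entryLinearMap R R (pt K 1) (pt L D.out)).smulRight (coBasis R K D.out L)

theorem ofMatrix_cosetMatrix (K L : Subgroup G) (g : G) :
    ofMatrix R (cosetMatrix R K g L) = coBasis R K g L := by
  classical
  rw [ofMatrix]
  simp only [LinearMap.sum_apply, LinearMap.smulRight_apply, Matrix.entryLinearMap_apply]
  rw [Finset.sum_eq_single K, Finset.sum_eq_single L, Finset.sum_eq_single (DoubleCoset.mk K L g)]
  · rw [cosetMatrix, relMatrix_apply, if_pos (cosetRel_out_iff.2 rfl), one_smul]
    obtain ⟨k, l, hk, hl, h⟩ := DoubleCoset.mk_out_eq_mul K L g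
    rw [h, coBasis_congr R hk hl]
  · intro D _ hD
    rw [cosetMatrix, relMatrix_apply, if_neg fun h => hD (cosetRel_out_iff.1 h), zero_smul]
  · simp
  · rintro L' - hL
    refine Finset.sum_eq_zero fun D _ => ?_
    rw [cosetMatrix, relMatrix_apply, if_neg, zero_smul]
    rintro ⟨x, -, h⟩
    exact hL (pt_eq_iff.1 h).1
  · simp
  · rintro K' - hK
    refine Finset.sum_eq_zero fun L _ => Finset.sum_eq_zero fun D _ => ?_
    rw [cosetMatrix, relMatrix_apply, if_neg, zero_smul]
    rintro ⟨x, h, -⟩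
    exact hK (pt_eq_iff.1 h).1
  · simp

/-- It suffices to test the spanning elements `t c r`, whose matrices have a single nonzero
representative entry. The left inverse gives faithfulness without a separate proof of linear
independence. -/
theorem ofMatrix_coMatrix (a : CoMackeyAlgebra R G) : ofMatrix R (coMatrix R a) = a := by
  have : (ofMatrix R) ∘ₗ (coMatrix (G := G) R).toLinearMap = LinearMap.id := by
    refine LinearMap.ext_on (span_coBasis R) ?_
    rintro _ ⟨K, g, L, rfl⟩
    change ofMatrix R (coMatrix R _) = _
    rw [coMatrix_coBasis, ofMatrix_cosetMatrix]
    rfl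
  exact LinearMap.congr_fun this a

theorem coMatrix_injective : Function.Injective (coMatrix (G := G) R) :=
  Function.LeftInverse.injective (ofMatrix_coMatrix R)

theorem coMatrix_smul_smul (a : CoMackeyAlgebra R G) (g : G) (ω ω' : CosetSpace G) :
    coMatrix R a (g • ω) (g • ω') = coMatrix R a ω ω' := by
  have ha : a ∈ Submodule.span R {a | ∃ K g L, a = coBasis (G := G) R K g L} := by
    rw [span_coBasis]; trivial
  induction ha using Submodule.span_induction with
  | zero => simp
  | add a b _ _ ha hb => rw [map_add, Matrix.add_apply, Matrix.add_apply, ha, hb]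
  | smul r a _ ha => rw [map_smul, Matrix.smul_apply, Matrix.smul_apply, ha]
  | mem a ha =>
    classical
    obtain ⟨K, x, L, rfl⟩ := ha
    rw [coMatrix_coBasis, cosetMatrix, relMatrix_apply, relMatrix_apply]
    refine if_congr ⟨fun h => ?_, fun h => h.smul g⟩ rfl rfl
    simpa using h.smul g⁻¹

/-- An invariant matrix is the combination of the orbit matrices with its own representative entries
as coefficients, so the image of `coMatrix` contains every invariant matrix. -/
theorem coMatrix_ofMatrix {N : Matrix (CosetSpace G) (CosetSpace G) R}
    (h : ∀ (g : G) ω ω', N (g • ω) (g • ω') = N ω ω') : coMatrix R (ofMatrix R N) = N := by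
  classical
  refine invariant_ext (coMatrix_smul_smul R _) h fun K L D => ?_
  rw [ofMatrix]
  simp only [LinearMap.sum_apply, LinearMap.smulRight_apply, Matrix.entryLinearMap_apply, map_sum,
    map_smul, coMatrix_coBasis, Matrix.sum_apply, Matrix.smul_apply]
  rw [Finset.sum_eq_single K, Finset.sum_eq_single L, Finset.sum_eq_single D]
  · rw [cosetMatrix, relMatrix_apply, if_pos ⟨1, rfl, by rw [one_mul]⟩, smul_eq_mul, mul_one]
  · intro E _ hE
    rw [cosetMatrix, relMatrix_apply, if_neg, smul_zero]
    rw [cosetRel_out_iff, DoubleCoset.out_eq']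
    exact hE.symm
  · simp
  · rintro L' - hL
    refine Finset.sum_eq_zero fun E _ => ?_
    rw [cosetMatrix, relMatrix_apply, if_neg, smul_zero]
    rintro ⟨x, -, h⟩
    exact hL (pt_eq_iff.1 h).1.symm
  · simp
  · rintro K' - hK
    refine Finset.sum_eq_zero fun L _ => Finset.sum_eq_zero fun D _ => ?_
    rw [cosetMatrix, relMatrix_apply, if_neg, smul_zero]
    rintro ⟨x, h, -⟩
    exact hK (pt_eq_iff.1 h).1.symm
  · simp

end Yoshida

section CentralSMul

variable {A : Type*} [Ring A] {V : Type*} [AddCommGroup V] [Module A V]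

variable (V) in
/-- Multiplication by a central element as a linear map. -/
def centralSMul {z : A} (hz : z ∈ Subring.center A) : V →ₗ[A] V where
  toFun v := z • v
  map_add' := smul_add z
  map_smul' a v := by
    rw [RingHom.id_apply, smul_smul, smul_smul, Subring.mem_center_iff.1 hz a]

theorem centralSMul_apply {z : A} (hz : z ∈ Subring.center A) (v : V) :
    centralSMul V hz v = z • v := rfl

end CentralSMul

/-! ### Endomorphisms of permutation modules as invariant matrices -/

section PermEnd

variable {R : Type u} [CommRing R] {G : Type u} [Group G] {Ω : Type u} [MulAction G Ω]

namespace Perm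

theorem coeff_smul_basis [DecidableEq Ω] [Fintype G] (z : MonoidAlgebra R G) (ω ω' : Ω) :
    coeff (z • (basis R ω : Perm R G Ω)) ω' = ∑ g : G, if g • ω = ω' then z.coeff g else 0 := by
  induction z using MonoidAlgebra.induction_linear with
  | zero => simp
  | add a b ha hb =>
    rw [add_smul, coeff_add, ha, hb, ← Finset.sum_add_distrib]
    refine Finset.sum_congr rfl fun g _ => ?_
    split_ifs
    · rfl
    · rw [add_zero]
  | single g r =>
    classical
    rw [coeff_single_smul, coeff_basis, Finset.sum_eq_single g]
    · simp [eq_inv_smul_iff]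
    · intro g' _ hne
      simp [hne.symm]
    · simp

variable [Fintype Ω]

theorem coeff_apply_eq_sum {Ω' : Type u} [MulAction G Ω']
    (f : Perm R G Ω →ₗ[MonoidAlgebra R G] Perm R G Ω') (m : Perm R G Ω) (ω' : Ω') :
    coeff (f m) ω' = ∑ ω, coeff m ω * coeff (f (basis R ω)) ω' := by
  conv_lhs => rw [← sum_coeff m]
  rw [map_sum, coeff_sum]
  refine Finset.sum_congr rfl fun ω _ => ?_
  rw [map_smul, coeff_single_smul, inv_one, one_smul]

theorem hom_ext {M : Type u} [AddCommGroup M] [Module (MonoidAlgebra R G) M]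
    {f g : Perm R G Ω →ₗ[MonoidAlgebra R G] M} (h : ∀ ω, f (basis R ω) = g (basis R ω)) :
    f = g := by
  refine LinearMap.ext fun m => ?_
  rw [← sum_coeff m, map_sum, map_sum]
  exact Finset.sum_congr rfl fun ω _ => by rw [map_smul, map_smul, h]

theorem lift_basis {M : Type u} [AddCommGroup M] [Module (MonoidAlgebra R G) M] (q : Ω → M)
    (hq : ∀ (g : G) ω, q (g • ω) = MonoidAlgebra.single g (1 : R) • q ω) (ω : Ω) :
    lift q hq (basis R ω) = q ω := by
  classical
  rw [lift_apply, Finset.sum_eq_single ω]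
  · rw [coeff_basis, if_pos rfl, ← MonoidAlgebra.one_def, one_smul]
  · intro ω' _ hne
    rw [coeff_basis, if_neg hne.symm, MonoidAlgebra.single_zero, zero_smul]
  · simp

variable (R G Ω) in
/-- The matrices of the endomorphisms of `RΩ`, which act from the right on row vectors. -/
def endMatrix [DecidableEq Ω] :
    (Module.End (MonoidAlgebra R G) (Perm R G Ω))ᵐᵒᵖ →ₐ[R] Matrix Ω Ω R :=
  AlgHom.ofLinearMap
    { toFun := fun f => Matrix.of fun ω ω' => coeff (f.unop (basis R ω)) ω'
      map_add' := fun f g => rfl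
      map_smul' := fun r f => rfl }
    (by
      ext ω ω'
      rw [Matrix.one_apply]
      exact coeff_basis (R := R) (G := G) ω ω')
    (fun f g => by
      ext ω ω'
      rw [Matrix.mul_apply]
      exact coeff_apply_eq_sum g.unop (f.unop (basis R ω)) ω')

theorem endMatrix_apply [DecidableEq Ω] (f : Module.End (MonoidAlgebra R G) (Perm R G Ω))
    (ω ω' : Ω) : endMatrix R G Ω (MulOpposite.op f) ω ω' = coeff (f (basis R ω)) ω' := rfl

theorem endMatrix_injective [DecidableEq Ω] : Function.Injective (endMatrix R G Ω) := by
  intro f g h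
  refine MulOpposite.unop_injective (hom_ext fun ω => ext fun ω' => ?_)
  exact congrFun (congrFun h ω) ω'

theorem endMatrix_smul_smul [DecidableEq Ω]
    (f : (Module.End (MonoidAlgebra R G) (Perm R G Ω))ᵐᵒᵖ) (g : G) (ω ω' : Ω) :
    endMatrix R G Ω f (g • ω) (g • ω') = endMatrix R G Ω f ω ω' := by
  change coeff (f.unop (basis R (g • ω))) (g • ω') = coeff (f.unop (basis R ω)) ω'
  rw [smul_basis, map_smul, coeff_single_smul, one_mul, inv_smul_smul]

/-- Invariance of `N` means that sending `ω` to its row is equivariant, so it extends linearly to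
`RΩ`. -/
theorem exists_endMatrix_eq [DecidableEq Ω] {N : Matrix Ω Ω R}
    (h : ∀ (g : G) ω ω', N (g • ω) (g • ω') = N ω ω') : ∃ f, endMatrix R G Ω f = N := by
  refine ⟨MulOpposite.op (lift (fun ω => ofFun (N ω)) fun g ω => ext fun ω' => ?_), ?_⟩
  · have := h g ω (g⁻¹ • ω')
    rw [smul_inv_smul] at this
    rw [coeff_single_smul, one_mul]
    exact this
  · ext ω ω'
    rw [endMatrix_apply, lift_basis, coeff_ofFun]

end Perm

end PermEnd

/-! ### Yoshida's theorem and the image of the centre -/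

section Yoshida

variable (R : Type u) [CommRing R] (G : Type u) [Group G] [Finite G]

/-- The direct sum of the permutation modules `R[G/L]`. -/
abbrev CosetPerm : Type u := Perm R G (CosetSpace G)

/-- Both ranges are the algebra of `G`-invariant matrices. -/
theorem range_coMatrix : (coMatrix (G := G) R).range = (Perm.endMatrix R G (CosetSpace G)).range := by
  ext N
  constructor
  · rintro ⟨a, rfl⟩
    exact Perm.exists_endMatrix_eq (coMatrix_smul_smul R a)
  · rintro ⟨f, rfl⟩
    exact ⟨_, coMatrix_ofMatrix R (Perm.endMatrix_smul_smul f)⟩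

/-- Yoshida's theorem: `coμ_R(G)` is the opposite of the endomorphism algebra of the sum of the
permutation modules `R[G/L]`. -/
def yoshidaEquiv :
    CoMackeyAlgebra R G ≃ₐ[R] (Module.End (MonoidAlgebra R G) (CosetPerm R G))ᵐᵒᵖ :=
  (AlgEquiv.ofInjective _ (coMatrix_injective R)).trans
    ((Subalgebra.equivOfEq _ _ (range_coMatrix R G)).trans
      (AlgEquiv.ofInjective _ Perm.endMatrix_injective).symm)

variable {G}

theorem endMatrix_yoshidaEquiv (a : CoMackeyAlgebra R G) :
    Perm.endMatrix R G (CosetSpace G) (yoshidaEquiv R G a) = coMatrix R a :=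
  congrArg Subtype.val ((AlgEquiv.ofInjective _ Perm.endMatrix_injective).apply_symm_apply _)

/-- Both matrices are invariant, so only the entries at `(K, gL)` matter. Multiplication by `z`
gives there the sum of the `λ_x` with `xK = gL`: zero unless `K = L`, and otherwise the sum of `λ_x`
over `x ∈ gK`, which is the coefficient in `ι(z)`. -/
theorem coMatrix_iota (z : MonoidAlgebra R G) (hz : z ∈ Subring.center (MonoidAlgebra R G)) :
    coMatrix R (iota R z) =
      Perm.endMatrix R G (CosetSpace G) (MulOpposite.op (centralSMul _ hz)) := by
  classical
  have := Fintype.ofFinite G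
  have := Fintype.ofFinite (Subgroup G)
  have := fun K : Subgroup G => @Fintype.ofFinite _
    (finite_doubleCosetQuotient (K : Set G) (K : Set G))
  have hiota : iota R z = ∑ H : Subgroup G, ∑ D : DoubleCoset.Quotient (H : Set G) (H : Set G),
      (∑ h : H, z.coeff (D.out * h)) • coBasis R H D.out H := by
    rw [iota, finsum_eq_sum_of_fintype]
    refine Finset.sum_congr rfl fun H _ => ?_
    rw [finsum_eq_sum_of_fintype]
    refine Finset.sum_congr rfl fun D _ => ?_
    rw [finsum_eq_sum_of_fintype, coBasis_eq]
  refine invariant_ext (coMatrix_smul_smul R _) (Perm.endMatrix_smul_smul _) fun K L D => ?_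
  rw [Perm.endMatrix_apply, centralSMul_apply, Perm.coeff_smul_basis, hiota]
  simp only [map_sum, map_smul, coMatrix_coBasis, Matrix.sum_apply, Matrix.smul_apply, smul_pt,
    mul_one]
  by_cases hKL : K = L
  · subst hKL
    rw [Finset.sum_eq_single K, Finset.sum_eq_single D]
    · rw [cosetMatrix, relMatrix_apply, if_pos ⟨1, rfl, by rw [one_mul]⟩, smul_eq_mul, mul_one,
        ← Finset.sum_filter]
      refine Finset.sum_bij (fun h _ => D.out * (h : G)) ?_ ?_ ?_ ?_
      · intro h _
        exact Finset.mem_filter.2 ⟨Finset.mem_univ _, pt_mul _ h.2⟩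
      · intro h _ h' _ heq
        exact Subtype.ext (mul_left_cancel heq)
      · intro g hg
        have hg := (pt_eq_iff.1 (Finset.mem_filter.1 hg).2.symm).2
        exact ⟨⟨_, hg⟩, Finset.mem_univ _, mul_inv_cancel_left _ _⟩
      · intro h _
        rfl
    · intro E _ hE
      rw [cosetMatrix, relMatrix_apply, if_neg, smul_zero]
      rw [cosetRel_out_iff, DoubleCoset.out_eq']
      exact hE.symm
    · simp
    · rintro K' - hK
      refine Finset.sum_eq_zero fun E _ => ?_
      rw [cosetMatrix, relMatrix_apply, if_neg, smul_zero]
      rintro ⟨x, h, -⟩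
      exact hK (pt_eq_iff.1 h).1.symm
    · simp
  · rw [Finset.sum_eq_zero, Finset.sum_eq_zero]
    · intro g _
      exact if_neg fun h => hKL (pt_eq_iff.1 h).1
    · intro K' _
      refine Finset.sum_eq_zero fun E _ => ?_
      rw [cosetMatrix, relMatrix_apply, if_neg, smul_zero]
      rintro ⟨x, h, h'⟩
      exact hKL ((pt_eq_iff.1 h).1.trans (pt_eq_iff.1 h').1.symm)

theorem yoshidaEquiv_iota (z : MonoidAlgebra R G) (hz : z ∈ Subring.center (MonoidAlgebra R G)) :
    yoshidaEquiv R G (iota R z) = MulOpposite.op (centralSMul _ hz) :=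
  Perm.endMatrix_injective ((endMatrix_yoshidaEquiv R _).trans (coMatrix_iota R z hz))

theorem yoshidaEquiv_mul_iota (a : CoMackeyAlgebra R G) (z : MonoidAlgebra R G)
    (hz : z ∈ Subring.center (MonoidAlgebra R G)) :
    yoshidaEquiv R G (a * iota R z) =
      MulOpposite.op (centralSMul _ hz * MulOpposite.unop (yoshidaEquiv R G a)) := by
  rw [map_mul, yoshidaEquiv_iota R z hz]
  rfl

theorem mul_iota_eq_zero {a : CoMackeyAlgebra R G} {z : MonoidAlgebra R G}
    (hz : z ∈ Subring.center (MonoidAlgebra R G))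
    (h : ∀ v, MulOpposite.unop (yoshidaEquiv R G a) (z • v) = 0) : a * iota R z = 0 := by
  rw [← map_eq_zero_iff _ (yoshidaEquiv R G).injective, yoshidaEquiv_mul_iota R a z hz,
    MulOpposite.op_eq_zero_iff]
  refine LinearMap.ext fun v => ?_
  rw [LinearMap.zero_apply, ← h v, map_smul]
  rfl

end Yoshida

/-! ### Cutting by a central idempotent -/

section BlockAlgebraEquiv

variable {R : Type u} [CommRing R] {A : Type u} [Ring A] [Algebra R A] {e : A}

/-- A surjection which maps `e` to `1` and only kills what `e` kills identifies `Ae` with its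
target. -/
def blockAlgebraEquiv {E : Type*} [Semiring E] [Algebra R E] (φ : A →ₐ[R] E)
    (hφ : Function.Surjective φ) (he : φ e = 1) (hker : ∀ a, φ a = 0 → a * e = 0) :
    BlockAlgebra e ≃ₐ[R] E :=
  AlgEquiv.ofBijective
    (RingQuot.liftAlgHom R ⟨φ, by rintro _ _ ⟨⟩; rw [he, map_one]⟩) <| by
    constructor
    · rw [injective_iff_map_eq_zero]
      intro x hx
      obtain ⟨a, rfl⟩ := RingQuot.mkAlgHom_surjective R (BlockRel e) x
      rw [RingQuot.liftAlgHom_mkAlgHom_apply] at hx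
      rw [← mul_one (RingQuot.mkAlgHom R (BlockRel e) a), ← BlockAlgebra.mk_self R e, ← map_mul,
        hker a hx, map_zero]
    · intro y
      obtain ⟨a, rfl⟩ := hφ y
      exact ⟨_, RingQuot.liftAlgHom_mkAlgHom_apply _ _ _ a⟩

end BlockAlgebraEquiv

section FixedPart

variable {R : Type u} [CommRing R] {A : Type u} [Ring A] [Algebra R A] {e : A}
  (hc : e ∈ Subring.center A) (V : Type u) [AddCommGroup V] [Module A V]

/-- The submodule `eV` of the elements fixed by a central idempotent `e`. -/
def fixedPart : Submodule A V := LinearMap.ker (LinearMap.id - centralSMul V hc)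

variable {V}

theorem mem_fixedPart {v : V} : v ∈ fixedPart hc V ↔ e • v = v := by
  rw [fixedPart, LinearMap.mem_ker, LinearMap.sub_apply, sub_eq_zero, eq_comm]
  rfl

theorem smul_fixedPart (v : fixedPart hc V) : e • v = v := Subtype.ext ((mem_fixedPart hc).1 v.2)

theorem smul_mem_fixedPart (he : IsIdempotentElem e) (v : V) : e • v ∈ fixedPart hc V := by
  rw [mem_fixedPart, smul_smul, he.eq]

instance fixedPartModule : Module (BlockAlgebra e) (fixedPart hc V) :=
  Module.compHom _ (RingQuot.lift (R := A) (r := BlockRel e)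
    ⟨Module.toAddMonoidEnd A (fixedPart hc V), by
    rintro _ _ ⟨⟩
    refine AddMonoidHom.ext fun v => ?_
    rw [map_one]
    exact smul_fixedPart hc v⟩)

theorem mk_smul_fixedPart (a : A) (v : fixedPart hc V) : BlockAlgebra.mk R e a • v = a • v := by
  have h : BlockAlgebra.mk R e a = RingQuot.mkRingHom (BlockRel e) a :=
    RingHom.congr_fun (RingQuot.mkAlgHom_coe R (BlockRel e)) a
  rw [h]
  exact DFunLike.congr_fun (RingQuot.lift_mkRingHom_apply (Module.toAddMonoidEnd A _) _ a) v

instance fixedPart_isScalarTower [Module R V] [IsScalarTower R A V] :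
    IsScalarTower R (BlockAlgebra e) (fixedPart hc V) where
  smul_assoc r x v := by
    obtain ⟨a, rfl⟩ := RingQuot.mkAlgHom_surjective R (BlockRel e) x
    rw [← map_smul, mk_smul_fixedPart, mk_smul_fixedPart, smul_assoc]

variable (R) in
/-- Linearity over `Ae` follows from linearity over `A`. -/
def linearOfMk {M N : Type*} [AddCommGroup M] [Module (BlockAlgebra e) M] [AddCommGroup N]
    [Module (BlockAlgebra e) N] (f : M →+ N)
    (h : ∀ a m, f (BlockAlgebra.mk R e a • m) = BlockAlgebra.mk R e a • f m) :
    M →ₗ[BlockAlgebra e] N :=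
  { f with
    map_smul' := fun x m => by
      obtain ⟨a, rfl⟩ := RingQuot.mkAlgHom_surjective R (BlockRel e) x
      exact h a m }

theorem map_mem_fixedPart (f : Module.End A V) (v : fixedPart hc V) : f v ∈ fixedPart hc V := by
  rw [mem_fixedPart, ← map_smul, (mem_fixedPart hc).1 v.2]

/-- Since `e` acts as the identity on `W`, every map from `W` to `V` lands in `eV`, and the maps
back may be restricted to it. -/
theorem inAdd_fixedPart {W : Type u} [AddCommGroup W] [Module (BlockAlgebra e) W] [Module A W]
    (hW : ∀ (a : A) (w : W), BlockAlgebra.mk R e a • w = a • w)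
    (h : InAdd A W V) : InAdd (BlockAlgebra e) W (fixedPart hc V) := by
  obtain ⟨n, f, g, h⟩ := h
  have heW : ∀ w : W, e • w = w := fun w => by rw [← hW, BlockAlgebra.mk_self, one_smul]
  refine ⟨n, fun i => linearOfMk R
    { toFun := fun w => ⟨f i w, by rw [mem_fixedPart, ← map_smul, heW]⟩
      map_zero' := Subtype.ext (map_zero (f i))
      map_add' := fun v w => Subtype.ext (map_add (f i) v w) } fun a w => ?_,
    fun i => linearOfMk R ((g i).toAddMonoidHom.comp (fixedPart hc V).subtype.toAddMonoidHom)
      fun a v => ?_, ?_⟩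
  · rw [mk_smul_fixedPart, hW]
    exact Subtype.ext (map_smul (f i) a w)
  · rw [mk_smul_fixedPart, hW]
    exact map_smul (g i) a (v : V)
  · refine LinearMap.ext fun w => ?_
    have := LinearMap.congr_fun h w
    rw [LinearMap.sum_apply] at this ⊢
    exact this

variable [Module R V] [IsScalarTower R A V]

variable (R V) in
/-- The restriction of the endomorphisms of `V` to `eV`. -/
def fixedPartEnd : Module.End A V →ₐ[R] Module.End (BlockAlgebra e) (fixedPart hc V) :=
  AlgHom.ofLinearMap
    { toFun := fun f => linearOfMk R
        { toFun := fun v => ⟨f v, map_mem_fixedPart hc f v⟩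
          map_zero' := Subtype.ext (map_zero f)
          map_add' := fun v w => Subtype.ext (map_add f (v : V) w) }
        fun a v => by
          rw [mk_smul_fixedPart, mk_smul_fixedPart]
          exact Subtype.ext (map_smul f a (v : V))
      map_add' := fun f g => rfl
      map_smul' := fun r f => rfl }
    rfl fun f g => rfl

theorem coe_fixedPartEnd_apply (f : Module.End A V) (v : fixedPart hc V) :
    (fixedPartEnd R hc V f v : V) = f v := rfl

/-- An endomorphism of `eV` extends to `V` by first projecting with `v ↦ ev`. -/
theorem fixedPartEnd_surjective (he : IsIdempotentElem e) :
    Function.Surjective (fixedPartEnd R hc V) := by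
  intro h
  refine ⟨{ toFun := fun v => h ⟨e • v, smul_mem_fixedPart hc he v⟩
            map_add' := fun v w => ?_
            map_smul' := fun a v => ?_ }, ?_⟩
  · rw [← Submodule.coe_add, ← map_add]
    congr 3
    exact smul_add e v w
  · rw [RingHom.id_apply, ← Submodule.coe_smul, ← mk_smul_fixedPart (R := R), ← map_smul,
      mk_smul_fixedPart]
    congr 3
    change e • a • v = a • e • v
    rw [smul_smul, smul_smul, Subring.mem_center_iff.1 hc]
  · refine LinearMap.ext fun v => Subtype.ext ?_
    rw [coe_fixedPartEnd_apply]
    exact congrArg (fun w => (h w : V)) (smul_fixedPart hc v)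

end FixedPart

/-! ### Permutation modules as summands of sums of the coset module -/

section Orbits

variable {G : Type u} [Group G]

/-- Each orbit is identified with `G/L` for `L` the stabilizer of its representative. Injectivity
holds only orbit by orbit, because different orbits may give the same `L`. -/
theorem exists_equivariant (Ω : Type u) [MulAction G Ω] :
    ∃ σ : Ω → CosetSpace G, (∀ (g : G) ω, σ (g • ω) = g • σ ω) ∧
      ∀ ω ω', (⟦ω⟧ : MulAction.orbitRel.Quotient G Ω) = ⟦ω'⟧ → σ ω = σ ω' → ω = ω' := by
  have h : ∀ ω : Ω, ∃ g : G, g • (⟦ω⟧ : MulAction.orbitRel.Quotient G Ω).out = ω := fun ω =>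
    MulAction.orbitRel_apply.1 ((MulAction.orbitRel G Ω).symm (Quotient.mk_out (s := MulAction.orbitRel G Ω) ω))
  choose γ hγ using h
  refine ⟨fun ω => pt (MulAction.stabilizer G (⟦ω⟧ : MulAction.orbitRel.Quotient G Ω).out) (γ ω),
    fun g ω => ?_, fun ω ω' h h' => ?_⟩
  · have hq : (⟦g • ω⟧ : MulAction.orbitRel.Quotient G Ω) = ⟦ω⟧ :=
      Quotient.sound (MulAction.mem_orbit ω g)
    have h1 := hγ (g • ω)
    dsimp only
    rw [smul_pt]
    generalize γ (g • ω) = x at h1 ⊢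
    rw [hq] at h1 ⊢
    refine pt_eq_iff.2 ⟨rfl, ?_⟩
    rw [MulAction.mem_stabilizer_iff, mul_smul, mul_smul, hγ, inv_smul_eq_iff, h1]
  · have h1 := hγ ω'
    dsimp only at h'
    generalize γ ω' = x at h1 h'
    rw [← h] at h1 h'
    have h2 := (pt_eq_iff.1 h').2
    rw [MulAction.mem_stabilizer_iff, mul_smul, inv_smul_eq_iff, h1, hγ] at h2
    exact h2.symm

variable (R : Type u) [CommRing R] [Finite G]

/-- One copy of `⊕_L R[G/L]` is used for each orbit, which keeps apart the orbits that `σ`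
identifies: `f o` embeds the span of the orbit `o` and kills the other orbits, and `f' o` sends a
coset to the point of `o` over it, or to `0`. -/
theorem inAdd_cosetPerm (Ω : Type u) [Finite Ω] [MulAction G Ω] :
    InAdd (MonoidAlgebra R G) (Perm R G Ω) (CosetPerm R G) := by
  classical
  have := Fintype.ofFinite Ω
  have : Fintype (MulAction.orbitRel.Quotient G Ω) := @Fintype.ofFinite _ (Quotient.finite _)
  obtain ⟨σ, hσ, hinj⟩ := exists_equivariant (G := G) Ω
  have hq : ∀ (g : G) (ω : Ω), (⟦g • ω⟧ : MulAction.orbitRel.Quotient G Ω) = ⟦ω⟧ := fun g ω =>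
    Quotient.sound (MulAction.mem_orbit ω g)
  let f (o : MulAction.orbitRel.Quotient G Ω) :
      Perm R G Ω →ₗ[MonoidAlgebra R G] CosetPerm R G :=
    Perm.lift (fun ω => if ⟦ω⟧ = o then Perm.basis R (σ ω) else 0) fun g ω => by
      rw [hq, hσ]
      split_ifs
      · exact Perm.smul_basis g _
      · rw [smul_zero]
  let f' (o : MulAction.orbitRel.Quotient G Ω) :
      CosetPerm R G →ₗ[MonoidAlgebra R G] Perm R G Ω :=
    Perm.lift (fun y => ∑ ω : Ω, if ⟦ω⟧ = o ∧ σ ω = y then Perm.basis R ω else 0) fun g y => by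
      rw [Finset.smul_sum, ← Equiv.sum_comp (MulAction.toPerm g)]
      refine Finset.sum_congr rfl fun ω _ => ?_
      simp only [MulAction.toPerm_apply, hq, hσ, smul_left_cancel_iff, smul_ite, smul_zero,
        Perm.smul_basis]
  refine InAdd.of_sum f f' (Perm.hom_ext fun ω => ?_)
  rw [LinearMap.sum_apply, LinearMap.id_apply, Finset.sum_eq_single ⟦ω⟧]
  · rw [LinearMap.comp_apply, Perm.lift_basis, if_pos rfl, Perm.lift_basis,
      Finset.sum_eq_single ω]
    · rw [if_pos ⟨rfl, rfl⟩]
    · exact fun ω' _ hne => if_neg fun h => hne (hinj _ _ h.1 h.2)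
    · simp
  · intro o _ ho
    rw [LinearMap.comp_apply, Perm.lift_basis, if_neg ho.symm, map_zero]
  · simp

end Orbits

/-! ### The additive generator of the `p`-permutation modules in a block -/

section Blocks

variable {R : Type u} [CommRing R] {G : Type u} [Group G] {b : MonoidAlgebra R G}

theorem isBlockPPermutation_iff_of_compat {V : Type u} [AddCommGroup V]
    [Module (BlockAlgebra b) V] [h : Module (MonoidAlgebra R G) V]
    (hV : ∀ (a : MonoidAlgebra R G) (v : V), BlockAlgebra.mk R b a • v = a • v) :
    IsBlockPPermutation b (ModuleCat.of (BlockAlgebra b) V) ↔ IsPPermutation R G V := by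
  have : h = Module.compHom V (BlockAlgebra.mk R b).toRingHom :=
    Module.ext' _ _ fun a v => (hV a v).symm
  subst this
  rfl

variable [Finite G]

/-- The part of the sum of the permutation modules `R[G/L]` in the block `b`. -/
abbrev BlockPerm (hb : b ∈ Subring.center (MonoidAlgebra R G)) : Type u :=
  fixedPart hb (CosetPerm R G)

/-- Multiplication by `b` is a retraction of the permutation module on `CosetSpace G` onto its
`b`-part. -/
theorem isBlockPPermutation_blockPerm (hb : b ∈ Subring.center (MonoidAlgebra R G))
    (hb' : IsIdempotentElem b) :
    IsBlockPPermutation b (ModuleCat.of (BlockAlgebra b) (BlockPerm hb)) := by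
  rw [isBlockPPermutation_iff_of_compat (mk_smul_fixedPart hb)]
  refine ⟨CosetSpace G, inferInstance, inferInstance, Submodule.subtype _,
    (centralSMul _ hb).codRestrict _ (smul_mem_fixedPart hb hb'), ?_⟩
  exact LinearMap.ext fun v => smul_fixedPart hb v

theorem inAdd_blockPerm (hb : b ∈ Subring.center (MonoidAlgebra R G))
    {V : Type u} [AddCommGroup V] [Module (BlockAlgebra b) V]
    (hV : IsBlockPPermutation b (ModuleCat.of (BlockAlgebra b) V)) :
    InAdd (BlockAlgebra b) V (BlockPerm hb) := by
  let : Module (MonoidAlgebra R G) V := Module.compHom V (BlockAlgebra.mk R b).toRingHom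
  have hmk : ∀ (a : MonoidAlgebra R G) (v : V), BlockAlgebra.mk R b a • v = a • v :=
    fun _ _ => rfl
  obtain ⟨Ω, _, _, i, q, h⟩ := (isBlockPPermutation_iff_of_compat hmk).1 hV
  exact inAdd_fixedPart hb hmk ((InAdd.of_retract i q h).trans (inAdd_cosetPerm R Ω))

/-- The action of `coμ_R(G)` on the part of the permutation modules in the block `b`. -/
def coMackeyToEnd (hb : b ∈ Subring.center (MonoidAlgebra R G)) :
    CoMackeyAlgebra R G →ₐ[R] (Module.End (BlockAlgebra b) (BlockPerm hb))ᵐᵒᵖ :=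
  (AlgHom.op (fixedPartEnd R hb (CosetPerm R G))).comp (yoshidaEquiv R G).toAlgHom

theorem coMackeyToEnd_apply (hb : b ∈ Subring.center (MonoidAlgebra R G))
    (a : CoMackeyAlgebra R G) : coMackeyToEnd hb a =
      MulOpposite.op (fixedPartEnd R hb _ (MulOpposite.unop (yoshidaEquiv R G a))) := rfl

theorem coMackeyToEnd_surjective (hb : b ∈ Subring.center (MonoidAlgebra R G))
    (hb' : IsIdempotentElem b) : Function.Surjective (coMackeyToEnd hb) := by
  intro f
  obtain ⟨h, hh⟩ := fixedPartEnd_surjective (R := R) (V := CosetPerm R G) hb hb'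
    (MulOpposite.unop f)
  refine ⟨(yoshidaEquiv R G).symm (MulOpposite.op h), ?_⟩
  rw [coMackeyToEnd_apply, AlgEquiv.apply_symm_apply, MulOpposite.unop_op, hh, MulOpposite.op_unop]

theorem coMackeyToEnd_iota (hb : b ∈ Subring.center (MonoidAlgebra R G)) :
    coMackeyToEnd hb (iota R b) = 1 := by
  rw [coMackeyToEnd_apply, yoshidaEquiv_iota R b hb]
  refine congrArg MulOpposite.op (LinearMap.ext fun v => ?_)
  exact smul_fixedPart hb v

/-- An endomorphism vanishing on the `b`-part vanishes after composition with multiplication by `b`,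
which is what `ι(b)` corresponds to. -/
theorem mul_iota_eq_zero_of_coMackeyToEnd (hb : b ∈ Subring.center (MonoidAlgebra R G))
    (hb' : IsIdempotentElem b) (a : CoMackeyAlgebra R G) (ha : coMackeyToEnd hb a = 0) :
    a * iota R b = 0 := by
  refine mul_iota_eq_zero R hb fun v => ?_
  exact congrArg Subtype.val (LinearMap.congr_fun (congrArg MulOpposite.unop ha)
    ⟨b • v, smul_mem_fixedPart hb hb' v⟩)

/-- The block algebra `coμ_R(G) ι(b)` is the opposite of an endomorphism algebra. -/
def blockYoshidaEquiv (hb : b ∈ Subring.center (MonoidAlgebra R G)) (hb' : IsIdempotentElem b) :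
    BlockAlgebra (iota R b) ≃ₐ[R] (Module.End (BlockAlgebra b) (BlockPerm hb))ᵐᵒᵖ :=
  blockAlgebraEquiv (coMackeyToEnd hb) (coMackeyToEnd_surjective hb hb') (coMackeyToEnd_iota hb)
    (mul_iota_eq_zero_of_coMackeyToEnd hb hb')

end Blocks

/-! ### Endomorphism algebras under tensoring -/

section Transport

variable {R : Type u} [CommRing R] {A B : Type u} [Ring B] [Algebra R B] [Ring A] [Algebra R A]
  (X : Bimodule R B A) {V : Type u} [AddCommGroup V] [Module A V] [Module R V]
  [IsScalarTower R A V]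

theorem Bimodule.tmul_smul_scalar (r : R) (x : X) (v : V) : X.tmul x (r • v) = r • X.tmul x v := by
  rw [← algebraMap_smul A r v, ← Bimodule.op_smul_tmul]
  have : MulOpposite.op (algebraMap R A r) • x = r • x := algebraMap_smul Aᵐᵒᵖ r x
  rw [this]
  rfl

theorem Bimodule.tensorMap_smul (r : R) (f : Module.End A V) :
    X.tensorMap (r • f) = r • X.tensorMap f :=
  tensor_hom_ext fun x v => X.tmul_smul_scalar r x (f v)

variable (V) in
/-- The action of `X ⊗_A -` on endomorphisms. -/
def Bimodule.tensorEnd : Module.End A V →ₐ[R] Module.End B (X.Tensor V) :=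
  AlgHom.ofLinearMap
    { toFun := X.tensorMap
      map_add' := X.tensorMap_add
      map_smul' := X.tensorMap_smul }
    X.tensorMap_id fun f g => X.tensorMap_comp g f

theorem Bimodule.tensorEnd_bijective [X.tensorFunctor.Full] [X.tensorFunctor.Faithful] :
    Function.Bijective (X.tensorEnd V) := by
  constructor
  · intro f g h
    have := X.tensorFunctor.map_injective (X := ModuleCat.of A V) (Y := ModuleCat.of A V)
      (a₁ := ModuleCat.ofHom f) (a₂ := ModuleCat.ofHom g) (congrArg ModuleCat.ofHom h)
    exact congrArg ModuleCat.Hom.hom this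
  · intro h
    obtain ⟨f, hf⟩ := X.tensorFunctor.map_surjective (X := ModuleCat.of A V)
      (Y := ModuleCat.of A V) (ModuleCat.ofHom h)
    exact ⟨f.hom, congrArg ModuleCat.Hom.hom hf⟩

variable (V) in
/-- A fully faithful functor `X ⊗_A -` identifies endomorphism algebras. -/
def Bimodule.tensorEndEquiv [X.tensorFunctor.Full] [X.tensorFunctor.Faithful] :
    Module.End A V ≃ₐ[R] Module.End B (X.Tensor V) :=
  AlgEquiv.ofBijective (X.tensorEnd V) X.tensorEnd_bijective

end Transport

/-! ### Comparison of the two blocks -/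

section Main

variable {R : Type u} [CommRing R] {G H : Type u} [Group G] [Group H]
  {b : MonoidAlgebra R G} {c : MonoidAlgebra R H}

theorem SplendidlyMoritaEquivalent.permeablyMoritaEquivalent
    (h : SplendidlyMoritaEquivalent b c) : PermeablyMoritaEquivalent b c := by
  obtain ⟨X, hX, hp⟩ := h
  exact ⟨X, hX, isPermeable_of_isPPermutation hp,
    isPermeable_of_isPPermutation (isPPermutation_dual hp)⟩

variable [IsLocalRing R] [Finite G] [Finite H]

theorem sameCartanMatrix_of_permeablyMoritaEquivalent
    (hb : b ∈ Subring.center (MonoidAlgebra R G)) (hb' : IsIdempotentElem b)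
    (hc : c ∈ Subring.center (MonoidAlgebra R H)) (hc' : IsIdempotentElem c)
    (h : PermeablyMoritaEquivalent b c) :
    SameCartanMatrix R (BlockAlgebra (iota R b)) (BlockAlgebra (iota R c)) := by
  obtain ⟨X, hX, hper, hper'⟩ := h
  have hdual : IsBlockPPermutation b
      (ModuleCat.of (BlockAlgebra b) (X.dual.Tensor (BlockPerm hc))) :=
    hper' _ (isBlockPPermutation_blockPerm hc hc')
  have hten : IsBlockPPermutation c
      (ModuleCat.of (BlockAlgebra c) (X.Tensor (BlockPerm hb))) :=
    hper _ (isBlockPPermutation_blockPerm hb hb')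
  -- The modules compared over `RHc` are `X ⊗ N_b`, whose endomorphism algebra is that of `N_b`, and
  -- `N_c`. The second containment uses that `N_c` is a summand of `X ⊗ (X* ⊗ N_c)`, where `X* ⊗
  -- N_c` is a summand of a power of `N_b`.
  exact sameCartanMatrix_of_inAdd
    ((blockYoshidaEquiv hb hb').trans
      (AlgEquiv.op (X.tensorEndEquiv (BlockPerm hb))))
    (blockYoshidaEquiv hc hc') (inAdd_blockPerm hc hten)
    ((inAdd_tensor_dual hc hc' hX _).trans ((inAdd_blockPerm hb hdual).tensor X))

end Main

end CohomologicalMackey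

end

theorem mainTheorem7 {p : ℕ} [Fact p.Prime] {R : Type u} [CommRing R] [IsLocalRing R]
    (hR : CohomologicalMackey.IsModularCoefficientRing p R)
    {G H : Type u} [Group G] [Finite G] [Group H] [Finite H]
    {b : MonoidAlgebra R G} {c : MonoidAlgebra R H}
    (hb : CohomologicalMackey.IsBlock b) (hc : CohomologicalMackey.IsBlock c)
    (hC : ¬ CohomologicalMackey.SameCartanMatrix R
      (CohomologicalMackey.BlockAlgebra (CohomologicalMackey.iota R b))
      (CohomologicalMackey.BlockAlgebra (CohomologicalMackey.iota R c))) :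
    ¬ CohomologicalMackey.SplendidlyMoritaEquivalent b c ∧
      ¬ CohomologicalMackey.PermeablyMoritaEquivalent b c := by
  have h : ¬ CohomologicalMackey.PermeablyMoritaEquivalent b c := fun h =>
    hC (CohomologicalMackey.sameCartanMatrix_of_permeablyMoritaEquivalent hb.mem_center
      hb.isIdempotentElem hc.mem_center hc.isIdempotentElem h)
  exact ⟨fun h' => h h'.permeablyMoritaEquivalent, h⟩
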